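/- Let $\mu$ be a probability distribution on $\mathbb N=\{0,1,2,\dots\}$ with mean $1$ and finite variance, $\mu\neq\delta_1$. Let $\theta,\eta$ be probability distributions on $\mathbb Z^6$ such that both are aperiodic and irreducible (as step distributions of random walks), $\theta$ is symmetric with $\sum_x\theta(x)e^{\sqrt{|x|}}<\infty$, and $\eta$ has mean $0$ and a finite $7$-th moment; $|\cdot|$ is the Euclidean norm. Let $g_\eta(x)=\sum_{n\ge 0}\mathbb P(S_n=x)$, $x\in\mathbb Z^6$, where $(S_n)$ is the random walk started at $0$ with step distribution $\eta$. For $\nu\in\{\eta,\theta\}$ let $\Gamma_\nu$ be the covariance matrix of $\nu$, and set $$\mathcal J_\nu(x)=\sqrt{x\cdot\Gamma_\nu^{-1}x}\quad(x\in\mathbb R^6),\qquad C_{6,\nu}=\frac{\mathbf\Gamma(3)}{4\pi^{3}\sqrt{\det\Gamma_\nu}}=\frac{1}{2\pi^3\sqrt{\det\Gamma_\nu}},$$ where $\mathbf\Gamma$ is the Gamma function. Let $(X_u)_{u\in T}$ be the branching random walk: $T$ is the Galton–Watson tree with offspring distribution $\mu$, independent displacements of law $\theta$ (independent of $T$) are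 attached to its edges, and $X_u\in\mathbb Z^6$ is the sum of the displacements on the path from the root to $u$, so that the root is at $0$. Let $E$ denote the expectation under its law. 1. The expectation $E\big[\sum_{u\in T}g_\eta(z+X_u)\big]$ is finite for every $z\in\mathbb Z^6$, and, as $|z|\to\infty$ with $z\in\mathbb Z^6$, $$E\Big[\sum_{u\in T}g_\eta(z+X_u)\Big]=F_{\eta,\theta}(z)+O(|z|^{-3}),$$ where $$F_{\eta,\theta}(z)=C_{6,\eta}\,C_{6,\theta}\int_{\mathbb R^6}\mathcal J_\eta(z+x)^{-4}\,\mathcal J_\theta(x)^{-4}\,dx .$$ The integral converges for every $z\in\mathbb R^6\setminus\{0\}$, $F_{\eta,\theta}$ is continuous on $\mathbb R^6\setminus\{0\}$, and $F_{\eta,\theta}(\lambda z)=\lambda^{-2}F_{\eta,\theta}(z)$ for all $\lambda>0$ and $z\neq0$. 2. For every integer $m\ge2$, if $\mu$ has a finite $m$-th moment, then there is a constant $C=C(m,\mu,\theta,\eta)>0$ such that for all $z\in\mathbb Z^6\setminus\{0\}$, $$E\Big[\Big(\sum_{u\in T}g_\eta(z+X_u)\Big)^m\Big]\le C\,|z|^{-2}.$$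 -/

import Mathlib

open MeasureTheory ProbabilityTheory Filter Topology Asymptotics
open scoped ENNReal Matrix

noncomputable section

namespace TreeWalk

/-- The inclusion of the lattice `ℤ^d` in `ℝ^d` with its Euclidean norm. -/
def toE {d : ℕ} (x : Fin d → ℤ) : EuclideanSpace ℝ (Fin d) :=
  WithLp.toLp 2 (fun i => (x i : ℝ))

/-! ### Random walks and Green's functions -/

/-- The law of `S n`, for the random walk started at `0` with independent steps of law `η`. -/
def walkLaw {d : ℕ} (η : PMF (Fin d → ℤ)) : ℕ → PMF (Fin d → ℤ)
  | 0 => PMF.pure 0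
  | n + 1 => (walkLaw η n).bind (fun x => η.map (fun y => x + y))

/-- The Green's function `x ↦ ∑ n ≥ 0, P (S n = x)`, with values in `[0, ∞]`. -/
def green {d : ℕ} (η : PMF (Fin d → ℤ)) (x : Fin d → ℤ) : ℝ≥0∞ :=
  ∑' n : ℕ, walkLaw η n x

/-- The walk started at `0` reaches every site with positive probability. -/
def WalkIrreducible {d : ℕ} (η : PMF (Fin d → ℤ)) : Prop :=
  ∀ x : Fin d → ℤ, ∃ n : ℕ, 0 < walkLaw η n x

/-- The possible return times `n ≥ 1` to `0` have greatest common divisor `1`. -/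
def WalkAperiodic {d : ℕ} (η : PMF (Fin d → ℤ)) : Prop :=
  ∀ p : ℕ, (∀ n : ℕ, 1 ≤ n → 0 < walkLaw η n 0 → p ∣ n) → p = 1

/-- The covariance matrix of a law on `ℤ^d`. -/
def covMatrix {d : ℕ} (η : PMF (Fin d → ℤ)) : Matrix (Fin d) (Fin d) ℝ :=
  Matrix.of fun i j =>
    cov[fun x : Fin d → ℤ => (x i : ℝ), fun x : Fin d → ℤ => (x j : ℝ); η.toMeasure]

/-- The norm `x ↦ √(x · Γ⁻¹ x)` on `ℝ^d`, where `Γ` is the covariance matrix of `η`. -/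
def normJ {d : ℕ} (η : PMF (Fin d → ℤ)) (x : EuclideanSpace ℝ (Fin d)) : ℝ :=
  Real.sqrt (x.ofLp ⬝ᵥ ((covMatrix η)⁻¹ *ᵥ x.ofLp))

/-- The constant `Γ(d/2) / ((d - 2) π^(d/2) √(det Γ))`, for `d ≥ 3`. -/
def greenConst {d : ℕ} (η : PMF (Fin d → ℤ)) : ℝ :=
  Real.Gamma ((d : ℝ) / 2) /
    (((d : ℝ) - 2) * Real.pi ^ ((d : ℝ) / 2) * Real.sqrt (covMatrix η).det)

/-- The integrand `x ↦ J_η(z + x)^(-4) J_θ(x)^(-4)` on `ℝ^6`. -/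
def kernelF (η θ : PMF (Fin 6 → ℤ)) (z x : EuclideanSpace ℝ (Fin 6)) : ℝ :=
  normJ η (z + x) ^ (-4 : ℤ) * normJ θ x ^ (-4 : ℤ)

/-- The function `F_{η,θ}` on `ℝ^6`. -/
def limitF (η θ : PMF (Fin 6 → ℤ)) (z : EuclideanSpace ℝ (Fin 6)) : ℝ :=
  greenConst η * greenConst θ * ∫ x : EuclideanSpace ℝ (Fin 6), kernelF η θ z x

/-! ### Branching random walks

Nodes are finite words `u = (u₁, …, uₙ)`, stored as lists in this order; `u.take i` is the ancestor
of `u` in generation `i`. A configuration attaches to each word `u` a number of offspring `(ω u).1`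
and a displacement `(ω u).2` along the edge from the parent of `u` to `u`. -/

/-- Configurations of offspring numbers and displacements. -/
abbrev Config (d : ℕ) : Type := List ℕ → ℕ × (Fin d → ℤ)

/-- The tree of a configuration: the children of a node `v` of the tree are the words `v j` with
`1 ≤ j ≤ (ω v).1`. -/
def tree {d : ℕ} (ω : Config d) : Set (List ℕ) :=
  {u | ∀ (i : ℕ) (h : i < u.length), 1 ≤ u[i] ∧ u[i] ≤ (ω (u.take i)).1}

/-- The position of the node `u`: the sum of the displacements on the path from the root, which is
placed at `0`, to `u`. -/
def position {d : ℕ} (ω : Config d) (u : List ℕ) : Fin d → ℤ :=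
  ∑ i ∈ Finset.range u.length, (ω (u.take (i + 1))).2

/-- The law of the branching random walk: offspring numbers of law `μ` and displacements of law
`θ`, all independent. -/
def brwMeasure {d : ℕ} (μ : PMF ℕ) (θ : PMF (Fin d → ℤ)) : Measure (Config d) :=
  Measure.infinitePi (fun _ : List ℕ => μ.toMeasure.prod θ.toMeasure)

/-- The sum over the nodes `u` of the tree of the Green's function at `z + X_u`. -/
def greenSum {d : ℕ} (η : PMF (Fin d → ℤ)) (z : Fin d → ℤ) (ω : Config d) : ℝ≥0∞ :=
  ∑' u : tree ω, green η (z + position ω (u : List ℕ))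

end TreeWalk

end

/-! First moment. Since the offspring mean is 1, the expected sum over generation `n` is the
expectation of `g_η(z + S_n)` for a walk `S` with step law `θ`. Summing over `n` gives the lattice
convolution `∑ x, g_η(z + x) g_θ(x)` (`lintegral_greenSum`). By symmetry of `θ` its Fourier symbol
is `1 / ((1 - φ_η)(1 - φ_θ))`. Near the origin `1 - φ` is `Q/2` up to a cubic error, where `Q` is
the covariance form, so the symbol is compared with `exp(-(Q_η + Q_θ)/2) · 4 / (Q_η Q_θ)`. The
difference is of size `|k|^(-3)`, with each derivative costing one more power, up to order 6
(`sym_symbolDiff`). In dimension 6 the Fourier integral of a symbol of degree `a` is `O(|z|^(-6-a))`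
(`norm_integral_mul_chr_le`), which is the error `O(|z|^(-3))`. A smooth window whose
`2πℤ^6`-translates sum to 1 replaces the torus by `ℝ^6`, so only one kind of integral occurs.

The Gaussian symbol is exactly the transform of the convolution of two Gaussian Green's functions
from which the times `t ≤ 1` have been removed. Restoring these times changes each Green's function
by `O(|x|^(-5))`, hence the convolution by `O(|z|^(6-5-4)) = O(|z|^(-3))` (`limitF_sub_le`).
Homogeneity of the limit is a change of variables. Continuity follows from homogeneity together with
this comparison with a continuous function.

Decay of Fourier integrals is proved without integration by parts. A translation by `t` with `t · z
= π` changes the sign of the character, so `M` finite differences in the direction of `z` multiply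
the integral by `(-2)^M`. Only derivatives along one fixed direction are ever needed; this is why
symbols are functions `f v k` differentiated along `v`, uniformly in `‖v‖ ≤ 1`.

Higher moments. Let `H(z) = (1 + |z|)^(-2)`. Decomposing at the root, the `m`-th moment `M_m` of the
sum satisfies `M_m ≤ P_θ M_m + R H²`: the pure `m`-th powers of the branches contribute exactly `P_θ
M_m`, because the offspring mean is 1. Every other term contains either two independent branches,
each `O(H)` by induction on `m`, or a factor `g_η = O(H²)`. Iterating, `M_m ≤ R · (g_θ * H²)`, and
`g_θ = O(H²)` with `H² * H² = O(H)` in dimension 6 closes the induction (`moment_le`). All of this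
is done for the tree cut at height `h`, uniformly in `h`. -/

noncomputable section

namespace TreeWalk

section

/-! ### The branching property -/

/-- The configuration with root label `a` and with subtrees `ws j` above the words `[j]`. -/
def graft {d : ℕ} (p : (ℕ × (Fin d → ℤ)) × (ℕ → Config d)) : Config d
  | [] => p.1
  | j :: v => p.2 j v

lemma measurable_graft {d : ℕ} : Measurable (graft (d := d)) := by
  refine measurable_pi_lambda _ fun u => ?_
  cases u with
  | nil => exact measurable_fst
  | cons j v =>
    exact (measurable_pi_apply v).comp ((measurable_pi_apply j).comp measurable_snd)

instance {d : ℕ} (μ : PMF ℕ) (θ : PMF (Fin d → ℤ)) : IsProbabilityMeasure (brwMeasure μ θ) := by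
  unfold brwMeasure; infer_instance

/-- Branching property: the root label and the subtrees of the root are independent. -/
lemma map_graft {d : ℕ} (μ : PMF ℕ) (θ : PMF (Fin d → ℤ)) :
    ((μ.toMeasure.prod θ.toMeasure).prod
      (Measure.infinitePi fun _ : ℕ => brwMeasure μ θ)).map graft = brwMeasure μ θ := by
  set ν := μ.toMeasure.prod θ.toMeasure with hν
  refine Measure.eq_infinitePi _ fun s t ht => ?_
  rw [Measure.map_apply measurable_graft (.pi (Finset.countable_toSet _) fun i _ => ht i)]
  classical
  -- The nonempty words of `s`, split into head and tail. Under `graft` a cylinder over `s` becomes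
  -- a condition on the root label times a cylinder over `s'` for the uncurried product, so both
  -- sides are explicit finite products.
  set s' : Finset (ℕ × List ℕ) := s.biUnion fun u =>
    match u with
    | [] => ∅
    | j :: v => {(j, v)} with hs'
  have mem_s' : ∀ j v, (j, v) ∈ s' ↔ (j :: v) ∈ s := by
    intro j v
    simp only [hs', Finset.mem_biUnion]
    constructor
    · rintro ⟨u, hu, huv⟩
      cases u with
      | nil => simp at huv
      | cons a b => simp at huv; obtain ⟨rfl, rfl⟩ := huv; exact hu
    · intro h
      exact ⟨_, h, by simp⟩
  have hpre : graft ⁻¹' (Set.pi (s : Set (List ℕ)) t) =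
      (if [] ∈ s then t [] else Set.univ) ×ˢ
        ((MeasurableEquiv.curry ℕ (List ℕ) (ℕ × (Fin d → ℤ))).symm ⁻¹'
          (Set.pi (s' : Set (ℕ × List ℕ)) fun p => t (p.1 :: p.2))) := by
    ext ⟨a, ws⟩
    simp only [Set.mem_preimage, Set.mem_pi, Finset.mem_coe, Set.mem_prod]
    constructor
    · intro h
      refine ⟨?_, ?_⟩
      · split_ifs with h0
        · exact h [] h0
        · trivial
      · rintro ⟨j, v⟩ hjv
        exact h (j :: v) ((mem_s' j v).1 hjv)
    · rintro ⟨h1, h2⟩ u hu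
      cases u with
      | nil => rw [if_pos hu] at h1; exact h1
      | cons j v => exact h2 (j, v) ((mem_s' j v).2 hu)
  have hm : MeasurableSet (Set.pi (s' : Set (ℕ × List ℕ)) fun p => t (p.1 :: p.2)) :=
    .pi (Finset.countable_toSet _) fun i _ => ht _
  rw [hpre, Measure.prod_prod, ← Measure.map_apply (MeasurableEquiv.measurable _) hm]
  have := Measure.infinitePi_map_curry_symm (fun (_ : ℕ) (_ : List ℕ) => ν)
  unfold brwMeasure
  rw [this, Measure.infinitePi_pi _ fun i _ => ht _]
  have hsplit : ∏ u ∈ s, ν (t u) =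
      (if [] ∈ s then ν (t []) else 1) * ∏ u ∈ s.erase [], ν (t u) := by
    split_ifs with h
    · rw [Finset.mul_prod_erase s (fun u => ν (t u)) h]
    · rw [Finset.erase_eq_of_notMem h, one_mul]
  rw [hsplit]
  congr 1
  · split_ifs <;> simp
  · refine Finset.prod_bij (fun p _ => p.1 :: p.2) ?_ ?_ ?_ ?_
    · rintro ⟨j, v⟩ h
      simpa using (mem_s' j v).1 h
    · rintro ⟨j, v⟩ _ ⟨j', v'⟩ _ h
      simpa using h
    · intro u hu
      cases u with
      | nil => simp at hu
      | cons j v => exact ⟨(j, v), (mem_s' j v).2 (by simpa using hu), rfl⟩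
    · intros; rfl

lemma lintegral_brwMeasure {d : ℕ} (μ : PMF ℕ) (θ : PMF (Fin d → ℤ)) {F : Config d → ℝ≥0∞}
    (hF : Measurable F) :
    ∫⁻ ω, F ω ∂(brwMeasure μ θ) = ∫⁻ n, ∫⁻ ξ, ∫⁻ ws, F (graft ((n, ξ), ws))
      ∂(Measure.infinitePi fun _ : ℕ => brwMeasure μ θ) ∂θ.toMeasure ∂μ.toMeasure := by
  have hG : Measurable fun p => F (graft p) := hF.comp measurable_graft
  conv_lhs => rw [← map_graft μ θ]
  rw [lintegral_map hF measurable_graft, lintegral_prod _ hG.aemeasurable,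
    lintegral_prod _ (Measurable.aemeasurable hG.lintegral_prod_right')]

/-- The sum of `g (z + X_u)` over the nodes `u` of the first `h` generations after the root. -/
def truncSum {d : ℕ} (g : (Fin d → ℤ) → ℝ≥0∞) : ℕ → (Fin d → ℤ) → Config d → ℝ≥0∞
  | 0, z, _ => g z
  | h + 1, z, ω => g z + ∑ j ∈ Finset.range (ω []).1,
      truncSum g h (z + (ω [j + 1]).2) (fun v => ω ((j + 1) :: v))

lemma measurable_truncSum {d : ℕ} (g : (Fin d → ℤ) → ℝ≥0∞) (h : ℕ) :
    Measurable fun p : (Fin d → ℤ) × Config d => truncSum g h p.1 p.2 := by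
  have hg : Measurable g := measurable_of_countable g
  induction h with
  | zero => exact hg.comp measurable_fst
  | succ h ih =>
    -- A sum over a random range is written as a full series with indicators, to which measurability
    -- of series applies. Joint measurability in position and configuration is needed because the
    -- recursive call moves the position.
    have e : (fun p : (Fin d → ℤ) × Config d => truncSum g (h + 1) p.1 p.2) = fun p =>
        g p.1 + ∑' j : ℕ, (if j < (p.2 []).1 then
          truncSum g h (p.1 + (p.2 [j + 1]).2) (fun v => p.2 ((j + 1) :: v)) else 0) := by
      funext p
      simp only [truncSum]
      congr 1
      rw [tsum_eq_sum (s := Finset.range (p.2 []).1)]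
      · exact Finset.sum_congr rfl fun j hj => by rw [if_pos (Finset.mem_range.1 hj)]
      · intro j hj
        rw [if_neg (by simpa using hj)]
    rw [e]
    refine (hg.comp measurable_fst).add (Measurable.tsum fun j => ?_)
    have hev : ∀ u : List ℕ, Measurable fun p : (Fin d → ℤ) × Config d => p.2 u :=
      fun u => (measurable_pi_apply u).comp measurable_snd
    refine Measurable.ite ?_ ?_ measurable_const
    · exact measurableSet_lt measurable_const ((hev []).fst)
    · have : Measurable fun p : (Fin d → ℤ) × Config d =>
          ((p.1 + (p.2 [j + 1]).2, fun v => p.2 ((j + 1) :: v)) : (Fin d → ℤ) × Config d) := by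
        refine Measurable.prodMk (measurable_fst.add (hev _).snd) ?_
        exact measurable_pi_lambda _ fun v => hev _
      exact ih.comp this

lemma cons_mem_tree {d : ℕ} {ω : Config d} {j : ℕ} {v : List ℕ} :
    j :: v ∈ tree ω ↔ (1 ≤ j ∧ j ≤ (ω []).1) ∧ v ∈ tree (fun w => ω (j :: w)) := by
  constructor
  · intro h
    exact ⟨h 0 (by simp), fun i hi => h (i + 1) (by simpa using hi)⟩
  · rintro ⟨h0, h⟩ i hi
    cases i with
    | zero => exact h0
    | succ i => exact h i (by simpa using hi)

lemma position_cons {d : ℕ} (ω : Config d) (j : ℕ) (v : List ℕ) :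
    position ω (j :: v) = (ω [j]).2 + position (fun w => ω (j :: w)) v := by
  simp only [position, List.length_cons]
  rw [Finset.sum_range_succ', add_comm]
  simp

lemma tsum_list (f : List ℕ → ℝ≥0∞) : ∑' u, f u = f [] + ∑' j, ∑' v, f (j :: v) := by
  classical
  have hinj : Function.Injective fun p : ℕ × List ℕ => p.1 :: p.2 := by
    rintro ⟨j, v⟩ ⟨j', v'⟩ h
    simpa using h
  rw [ENNReal.tsum_eq_add_tsum_ite []]
  congr 1
  have hsupp : Function.support (fun u : List ℕ => if u = [] then 0 else f u) ⊆
      Set.range fun p : ℕ × List ℕ => p.1 :: p.2 := by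
    intro u hu
    cases u with
    | nil => simp at hu
    | cons j v => exact ⟨(j, v), rfl⟩
  have h1 := hinj.tsum_eq hsupp
  have h2 := ENNReal.tsum_prod (f := fun j v => f (j :: v))
  simp only [reduceCtorEq, if_false] at h1
  rw [← h2, h1]
  exact tsum_congr fun u => by split_ifs <;> rfl

-- Links the recursion at the root, on which the branching property acts, with the sum over nodes of
-- the tree, which is how `greenSum` is defined.
open Classical in
lemma truncSum_eq {d : ℕ} (g : (Fin d → ℤ) → ℝ≥0∞) (h : ℕ) (z : Fin d → ℤ) (ω : Config d) :
    truncSum g h z ω = ∑' u : List ℕ,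
      if u ∈ tree ω ∧ u.length ≤ h then g (z + position ω u) else 0 := by
  induction h generalizing z ω with
  | zero =>
    rw [tsum_list]
    have h0 : ([] : List ℕ) ∈ tree ω := fun i hi => absurd hi (by simp)
    simp [truncSum, h0, position]
  | succ h ih =>
    rw [tsum_list, truncSum]
    have h0 : ([] : List ℕ) ∈ tree ω := fun i hi => absurd hi (by simp)
    congr 1
    · simp [h0, position]
    -- Children are numbered from 1, so the words beginning with the letter 0 drop out and the index
    -- shifts by one.
    · rw [tsum_eq_zero_add' ENNReal.summable]
      simp only [cons_mem_tree, position_cons, List.length_cons]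
      simp only [ih]
      rw [tsum_eq_sum (s := Finset.range (ω []).1)]
      · simp only [nonpos_iff_eq_zero, one_ne_zero, false_and, if_false, tsum_zero, zero_add]
        refine Finset.sum_congr rfl fun j hj => tsum_congr fun v => ?_
        have hj' : j + 1 ≤ (ω []).1 := Finset.mem_range.1 hj
        simp [hj', add_assoc]
      · intro j hj
        have hj' : ¬ j + 1 ≤ (ω []).1 := fun hh => hj (Finset.mem_range.2 hh)
        simp [hj']

lemma truncSum_mono {d : ℕ} (g : (Fin d → ℤ) → ℝ≥0∞) (z : Fin d → ℤ) (ω : Config d) :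
    Monotone fun h => truncSum g h z ω := by
  classical
  intro h h' hh
  simp only [truncSum_eq]
  refine ENNReal.tsum_le_tsum fun u => ?_
  by_cases hu : u ∈ tree ω ∧ u.length ≤ h
  · rw [if_pos hu, if_pos ⟨hu.1, hu.2.trans hh⟩]
  · rw [if_neg hu]; exact zero_le

lemma greenSum_eq_iSup {d : ℕ} (η : PMF (Fin d → ℤ)) (z : Fin d → ℤ) (ω : Config d) :
    greenSum η z ω = ⨆ h, truncSum (green η) h z ω := by
  classical
  have e : greenSum η z ω = ∑' u : List ℕ,
      if u ∈ tree ω then green η (z + position ω u) else 0 := by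
    unfold greenSum
    rw [tsum_subtype (tree ω) (fun u => green η (z + position ω u))]
    rfl
  apply le_antisymm
  · rw [e, ENNReal.tsum_eq_iSup_sum]
    refine iSup_le fun s => ?_
    refine le_iSup_of_le (s.sup List.length) ?_
    rw [truncSum_eq]
    refine le_trans (Finset.sum_le_sum fun u hu => ?_) (ENNReal.sum_le_tsum s)
    have hl : u.length ≤ s.sup List.length := Finset.le_sup hu
    simp [hl]
  · refine iSup_le fun h => ?_
    rw [truncSum_eq, e]
    refine ENNReal.tsum_le_tsum fun u => ?_
    by_cases hu : u ∈ tree ω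
    · rw [if_pos hu]; split_ifs <;> simp
    · rw [if_neg hu, if_neg (fun h => hu h.1)]

/-- Monotone convergence in the height. Bounds for the truncated sums that are uniform in `h` pass
to the whole tree, so recursions may be closed by induction on `h` with no prior finiteness. -/
lemma lintegral_greenSum_pow {d : ℕ} (η : PMF (Fin d → ℤ)) (P : Measure (Config d))
    (z : Fin d → ℤ) (m : ℕ) :
    ∫⁻ ω, greenSum η z ω ^ m ∂P = ⨆ h, ∫⁻ ω, truncSum (green η) h z ω ^ m ∂P := by
  rw [← lintegral_iSup]
  · congr 1
    funext ω
    rw [greenSum_eq_iSup]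
    exact tendsto_nhds_unique (((ENNReal.continuous_pow m).tendsto _).comp
      (tendsto_atTop_iSup (truncSum_mono (green η) z ω)))
      (tendsto_atTop_iSup fun a b hab => pow_le_pow_left' (truncSum_mono (green η) z ω hab) m)
  · exact fun h => ((measurable_truncSum (green η) h).comp measurable_prodMk_left).pow_const m
  · exact fun a b hab ω => pow_le_pow_left' (truncSum_mono (green η) z ω hab) m

end

section

/-! ### Moments of sums of independent variables -/

lemma lintegral_pow_sum_le {Ω : Type*} [MeasurableSpace Ω] {P : Measure Ω}
    [IsProbabilityMeasure P] {a : ℕ → Ω → ℝ≥0∞} (ha : ∀ i, Measurable (a i)) {l : ℕ} (hl : 1 ≤ l)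
    {K : ℝ≥0∞} (hK : ∀ i, ∫⁻ ω, a i ω ^ l ∂P ≤ K) (s : Finset ℕ) :
    ∫⁻ ω, (∑ i ∈ s, a i ω) ^ l ∂P ≤ (s.card : ℝ≥0∞) ^ l * K := by
  obtain ⟨l, rfl⟩ : ∃ k, l = k + 1 := ⟨l - 1, by omega⟩
  have h1 : ∀ ω, (∑ i ∈ s, a i ω) ^ (l + 1) ≤ (s.card : ℝ≥0∞) ^ l * ∑ i ∈ s, a i ω ^ (l + 1) := by
    intro ω
    have := ENNReal.rpow_sum_le_const_mul_sum_rpow s (fun i => a i ω) (p := (l + 1 : ℕ))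
      (by push_cast; linarith [Nat.cast_nonneg (α := ℝ) l])
    simp only [ENNReal.rpow_natCast] at this
    have e : ((l + 1 : ℕ) : ℝ) - 1 = (l : ℕ) := by push_cast; ring
    rwa [e, ENNReal.rpow_natCast] at this
  calc ∫⁻ ω, (∑ i ∈ s, a i ω) ^ (l + 1) ∂P
      ≤ ∫⁻ ω, (s.card : ℝ≥0∞) ^ l * ∑ i ∈ s, a i ω ^ (l + 1) ∂P := lintegral_mono h1
    _ = (s.card : ℝ≥0∞) ^ l * ∑ i ∈ s, ∫⁻ ω, a i ω ^ (l + 1) ∂P := by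
        rw [lintegral_const_mul _ (Finset.measurable_sum _ fun i _ => (ha i).pow_const _),
          lintegral_finsetSum _ fun i _ => (ha i).pow_const _]
    _ ≤ (s.card : ℝ≥0∞) ^ l * (s.card * K) := by
        gcongr
        exact (Finset.sum_le_card_nsmul _ _ _ fun i _ => hK i).trans (by simp)
    _ = _ := by ring

/-- The pure powers give `n * v`, and it matters later that this coefficient is exactly `n`. Every
mixed term splits into a power of one variable and a power of the sum of the others; these are
independent and of order below `m`, which produces the square of `K`. -/
lemma lintegral_pow_sum_le_of_iIndepFun {Ω : Type*} [MeasurableSpace Ω] {P : Measure Ω}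
    [IsProbabilityMeasure P] {a : ℕ → Ω → ℝ≥0∞} (ha : ∀ i, Measurable (a i))
    (hind : iIndepFun a P) {m : ℕ} (hm : 1 ≤ m) {K v : ℝ≥0∞}
    (hv : ∀ i, ∫⁻ ω, a i ω ^ m ∂P ≤ v)
    (hK : ∀ l, 1 ≤ l → l < m → ∀ i, ∫⁻ ω, a i ω ^ l ∂P ≤ K) (n : ℕ) :
    ∫⁻ ω, (∑ i ∈ Finset.range n, a i ω) ^ m ∂P ≤ n * v + 2 ^ m * n ^ m * K ^ 2 := by
  obtain ⟨m, rfl⟩ : ∃ k, m = k + 1 := ⟨m - 1, by omega⟩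
  set s := Finset.range n
  -- One factor `a i` is taken out of the power and the remaining `m` factors are expanded as `a i`
  -- plus the rest. In the inner sum both exponents `m - l` and `l + 1` are positive, so every term
  -- is mixed.
  have hdec : ∀ ω, (∑ i ∈ s, a i ω) ^ (m + 1) = ∑ i ∈ s, (a i ω ^ (m + 1) +
      ∑ l ∈ Finset.range m, a i ω ^ (m - l) * (∑ j ∈ s.erase i, a j ω) ^ (l + 1)
        * (m.choose (l + 1) : ℝ≥0∞)) := by
    intro ω
    rw [pow_succ, Finset.mul_sum]
    refine Finset.sum_congr rfl fun i hi => ?_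
    rw [← Finset.add_sum_erase s (fun j => a j ω) hi, add_comm (a i ω), add_pow,
      Finset.sum_range_succ', add_mul, add_comm]
    congr 1
    · simp [pow_succ]
    · rw [Finset.sum_mul]
      refine Finset.sum_congr rfl fun l hl => ?_
      have : m - l = (m - (l + 1)) + 1 := by have := Finset.mem_range.1 hl; omega
      rw [this, pow_succ]
      ring
  have hmS : ∀ i, Measurable fun ω => ∑ j ∈ s.erase i, a j ω :=
    fun i => Finset.measurable_sum _ fun j _ => ha j
  have hterm : ∀ i ∈ s, ∀ l ∈ Finset.range m,
      ∫⁻ ω, a i ω ^ (m - l) * (∑ j ∈ s.erase i, a j ω) ^ (l + 1) * (m.choose (l + 1) : ℝ≥0∞) ∂P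
        ≤ (n : ℝ≥0∞) ^ m * K ^ 2 * (m.choose (l + 1) : ℝ≥0∞) := by
    intro i hi l hl
    have hl' := Finset.mem_range.1 hl
    have hmm : Measurable fun ω => a i ω ^ (m - l) * (∑ j ∈ s.erase i, a j ω) ^ (l + 1) :=
      ((ha i).pow_const _).mul ((hmS i).pow_const _)
    rw [lintegral_mul_const _ hmm]
    gcongr
    have hI : IndepFun (fun ω => a i ω ^ (m - l)) (fun ω => (∑ j ∈ s.erase i, a j ω) ^ (l + 1)) P := by
      have h := (hind.indepFun_finsetSum_of_notMem ha (Finset.notMem_erase i s)).symm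
      have h2 := h.comp (φ := fun x => x ^ (m - l)) (ψ := fun x => x ^ (l + 1))
        (measurable_id.pow_const _) (measurable_id.pow_const _)
      have e : (fun ω => (∑ j ∈ s.erase i, a j ω) ^ (l + 1))
          = (fun x => x ^ (l + 1)) ∘ ∑ j ∈ s.erase i, a j := by
        funext ω
        simp [Finset.sum_apply]
      rw [e]
      exact h2
    have := lintegral_mul_eq_lintegral_mul_lintegral_of_indepFun ((ha i).pow_const (m - l))
      ((hmS i).pow_const (l + 1)) hI
    simp only [Pi.mul_apply] at this
    rw [this]
    have hb := lintegral_pow_sum_le ha (l := l + 1) (by omega) (hK (l + 1) (by omega) (by omega))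
      (s.erase i)
    have hc : ((s.erase i).card : ℝ≥0∞) ^ (l + 1) ≤ (n : ℝ≥0∞) ^ m := by
      have h1 : (s.erase i).card ≤ n := (Finset.card_erase_le).trans (by simp [s])
      have hn : 1 ≤ n := by have := Finset.mem_range.1 hi; omega
      calc ((s.erase i).card : ℝ≥0∞) ^ (l + 1) ≤ (n : ℝ≥0∞) ^ (l + 1) := by gcongr
        _ ≤ (n : ℝ≥0∞) ^ m := pow_le_pow_right₀ (by exact_mod_cast hn) (by omega)
    calc _ ≤ K * ((n : ℝ≥0∞) ^ m * K) := by
          refine mul_le_mul' (hK _ (by omega) (by omega) i) (hb.trans (mul_le_mul' hc le_rfl))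
      _ = _ := by ring
  have hmT : ∀ i l, Measurable fun ω => a i ω ^ (m - l) * (∑ j ∈ s.erase i, a j ω) ^ (l + 1)
        * (m.choose (l + 1) : ℝ≥0∞) := fun i l =>
    (((ha i).pow_const _).mul ((hmS i).pow_const _)).mul_const _
  have hsum : ∑ l ∈ Finset.range m, (m.choose (l + 1) : ℝ≥0∞) ≤ 2 ^ (m + 1) := by
    have h1 : ∑ l ∈ Finset.range m, m.choose (l + 1) ≤ 2 ^ (m + 1) := by
      have := Nat.sum_range_choose m
      rw [Finset.sum_range_succ'] at this
      have h2 : 2 ^ (m + 1) = 2 * 2 ^ m := by ring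
      omega
    exact_mod_cast h1
  have hmA : ∀ i, Measurable fun ω => a i ω ^ (m + 1) + ∑ l ∈ Finset.range m,
      a i ω ^ (m - l) * (∑ j ∈ s.erase i, a j ω) ^ (l + 1) * (m.choose (l + 1) : ℝ≥0∞) := fun i =>
    ((ha i).pow_const _).add (Finset.measurable_sum _ fun l _ => hmT i l)
  simp only [hdec]
  rw [lintegral_finsetSum _ fun i _ => hmA i]
  calc _ ≤ ∑ i ∈ s, (v + (n : ℝ≥0∞) ^ m * K ^ 2 * 2 ^ (m + 1)) := by
        refine Finset.sum_le_sum fun i hi => ?_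
        rw [lintegral_add_left ((ha i).pow_const _), lintegral_finsetSum _ fun l _ => hmT i l]
        refine add_le_add (hv i) ((Finset.sum_le_sum (hterm i hi)).trans ?_)
        rw [← Finset.mul_sum]
        gcongr
    _ = _ := by
        simp only [s, Finset.sum_const, Finset.card_range, nsmul_eq_mul]
        ring

/-! ### Moment recursions -/

/-- The transition operator of the walk with step law `θ`. -/
def stepOp {d : ℕ} (θ : PMF (Fin d → ℤ)) (f : (Fin d → ℤ) → ℝ≥0∞) (z : Fin d → ℤ) : ℝ≥0∞ :=
  ∫⁻ x, f (z + x) ∂θ.toMeasure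

lemma stepOp_mono {d : ℕ} {θ : PMF (Fin d → ℤ)} {f g : (Fin d → ℤ) → ℝ≥0∞} (h : ∀ z, f z ≤ g z)
    (z : Fin d → ℤ) : stepOp θ f z ≤ stepOp θ g z :=
  lintegral_mono fun _ => h _

lemma stepOp_eq_tsum {d : ℕ} (θ : PMF (Fin d → ℤ)) (f : (Fin d → ℤ) → ℝ≥0∞) (z : Fin d → ℤ) :
    stepOp θ f z = ∑' x, f (z + x) * θ x := by
  rw [stepOp, lintegral_countable']
  refine tsum_congr fun x => ?_
  rw [PMF.toMeasure_apply_singleton _ _ (measurableSet_singleton x)]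

/-- The expectation of `g` along the walk after `n` steps. -/
def walkOp {d : ℕ} (θ : PMF (Fin d → ℤ)) (n : ℕ) (f : (Fin d → ℤ) → ℝ≥0∞) (z : Fin d → ℤ) :
    ℝ≥0∞ :=
  ∑' x, f (z + x) * walkLaw θ n x

lemma walkLaw_succ_tsum {d : ℕ} (θ : PMF (Fin d → ℤ)) (n : ℕ) (f : (Fin d → ℤ) → ℝ≥0∞) :
    ∑' x, f x * walkLaw θ (n + 1) x = ∑' x, ∑' y, f (x + y) * θ y * walkLaw θ n x := by
  have key : ∀ (x : Fin d → ℤ) (p : PMF (Fin d → ℤ)), ∑' w, f w * (p.map fun y => x + y) w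
      = ∑' y, f (x + y) * p y := by
    intro x p
    classical
    simp only [PMF.map_apply, ← ENNReal.tsum_mul_left]
    rw [ENNReal.tsum_comm]
    refine tsum_congr fun y => ?_
    rw [tsum_eq_single (x + y)]
    · simp
    · intro w hw; simp [hw]
  simp only [walkLaw, PMF.bind_apply, ← ENNReal.tsum_mul_left]
  rw [ENNReal.tsum_comm]
  refine tsum_congr fun x => ?_
  rw [ENNReal.tsum_mul_right, ← key x θ, ← ENNReal.tsum_mul_right]
  exact tsum_congr fun w => by ring

lemma walkOp_zero {d : ℕ} (θ : PMF (Fin d → ℤ)) (f : (Fin d → ℤ) → ℝ≥0∞) :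
    walkOp θ 0 f = f := by
  classical
  funext z
  rw [walkOp, tsum_eq_single 0]
  · simp [walkLaw]
  · intro x hx; simp [walkLaw, hx]

/-- `walkLaw` appends the new step at the end, while `stepOp` takes it at the start; commutativity
of addition reconciles the two orders. -/
lemma walkOp_succ {d : ℕ} (θ : PMF (Fin d → ℤ)) (n : ℕ) (f : (Fin d → ℤ) → ℝ≥0∞) :
    walkOp θ (n + 1) f = stepOp θ (walkOp θ n f) := by
  funext z
  rw [walkOp, walkLaw_succ_tsum θ n (fun x => f (z + x)), stepOp_eq_tsum, ENNReal.tsum_comm]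
  refine tsum_congr fun y => ?_
  rw [walkOp, ← ENNReal.tsum_mul_right]
  refine tsum_congr fun x => ?_
  rw [show z + (x + y) = z + y + x by abel]
  ring

lemma tsum_walkOp {d : ℕ} (θ : PMF (Fin d → ℤ)) (f : (Fin d → ℤ) → ℝ≥0∞) (z : Fin d → ℤ) :
    ∑' n, walkOp θ n f z = ∑' x, f (z + x) * green θ x := by
  simp only [walkOp, green, ← ENNReal.tsum_mul_left]
  exact ENNReal.tsum_comm

section moments

variable {d : ℕ} (μ : PMF ℕ) (θ : PMF (Fin d → ℤ)) (g : (Fin d → ℤ) → ℝ≥0∞)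

/-- The `m`-th moment of the truncated sum. -/
def moment (h m : ℕ) (z : Fin d → ℤ) : ℝ≥0∞ :=
  ∫⁻ ω, truncSum g h z ω ^ m ∂(brwMeasure μ θ)

/-- The contribution of the `j`-th subtree of the root. -/
def branch (h : ℕ) (z : Fin d → ℤ) (j : ℕ) (ws : ℕ → Config d) : ℝ≥0∞ :=
  truncSum g h (z + (ws (j + 1) []).2) (ws (j + 1))

lemma truncSum_graft (h : ℕ) (z : Fin d → ℤ) (p : (ℕ × (Fin d → ℤ)) × (ℕ → Config d)) :
    truncSum g (h + 1) z (graft p) = g z + ∑ j ∈ Finset.range p.1.1, branch g h z j p.2 := rfl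

/-- The displacement stored at the root is never read by `truncSum`. When the configuration is
itself a branch, that displacement is the edge leading to it, and it is therefore independent of the
sum inside the branch. -/
lemma truncSum_graft_indep (h : ℕ) (z : Fin d → ℤ) (n : ℕ) (ξ ξ' : Fin d → ℤ)
    (ws : ℕ → Config d) :
    truncSum g h z (graft ((n, ξ), ws)) = truncSum g h z (graft ((n, ξ'), ws)) := by
  cases h with
  | zero => rfl
  | succ h => rfl

lemma measurable_truncSum_add (h : ℕ) (z : Fin d → ℤ) :
    Measurable fun ω : Config d => truncSum g h (z + (ω []).2) ω := by
  have : Measurable fun ω : Config d => ((z + (ω []).2, ω) : (Fin d → ℤ) × Config d) :=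
    (measurable_const.add (measurable_pi_apply []).snd).prodMk measurable_id
  exact (measurable_truncSum g h).comp this

lemma measurable_branch (h : ℕ) (z : Fin d → ℤ) (j : ℕ) : Measurable (branch g h z j) :=
  (measurable_truncSum_add g h z).comp (measurable_pi_apply (j + 1))

lemma moment_eq (h m : ℕ) (z : Fin d → ℤ) :
    moment μ θ g h m z = ∫⁻ n, ∫⁻ ws, truncSum g h z (graft ((n, 0), ws)) ^ m
      ∂(Measure.infinitePi fun _ : ℕ => brwMeasure μ θ) ∂μ.toMeasure := by
  have hm : Measurable fun ω : Config d => truncSum g h z ω ^ m :=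
    ((measurable_truncSum g h).comp measurable_prodMk_left).pow_const m
  rw [moment, lintegral_brwMeasure μ θ hm]
  refine lintegral_congr fun n => ?_
  simp [fun ξ ws => truncSum_graft_indep g h z n ξ 0 ws]

/-- A branch is a fresh copy of the tree started from a point displaced by an independent step of
law `θ`; averaging over that step is the transition operator. -/
lemma lintegral_branch_pow (h m : ℕ) (z : Fin d → ℤ) (j : ℕ) :
    ∫⁻ ws, branch g h z j ws ^ m ∂(Measure.infinitePi fun _ : ℕ => brwMeasure μ θ)
      = stepOp θ (moment μ θ g h m) z := by
  have hm : Measurable fun ω : Config d => truncSum g h (z + (ω []).2) ω ^ m :=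
    (measurable_truncSum_add g h z).pow_const m
  have h1 := (measurePreserving_eval_infinitePi (fun _ : ℕ => brwMeasure μ θ) (j + 1)).lintegral_comp hm
  simp only [Function.eval] at h1
  unfold branch
  rw [h1, lintegral_brwMeasure μ θ hm, stepOp]
  simp only [moment_eq]
  rw [lintegral_lintegral_swap]
  · refine lintegral_congr fun ξ => lintegral_congr fun n => lintegral_congr fun ws => ?_
    simp only [graft]
    rw [truncSum_graft_indep g h (z + ξ) n ξ 0 ws]
  · exact (measurable_of_countable _).aemeasurable

lemma iIndepFun_branch (h : ℕ) (z : Fin d → ℤ) :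
    iIndepFun (branch g h z) (Measure.infinitePi fun _ : ℕ => brwMeasure μ θ) := by
  have h1 : iIndepFun (fun (j : ℕ) (ws : ℕ → Config d) =>
      (fun ω : Config d => truncSum g h (z + (ω []).2) ω) (ws j))
      (Measure.infinitePi fun _ : ℕ => brwMeasure μ θ) :=
    iIndepFun_infinitePi fun j => measurable_truncSum_add g h z
  exact h1.precomp (g := fun j => j + 1) (add_left_injective 1)

variable {μ θ g}

lemma moment_one_zero (m : ℕ) (z : Fin d → ℤ) : moment μ θ g 0 m z = g z ^ m := by
  simp [moment, truncSum]

lemma lintegral_natCast_pow (m : ℕ) :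
    ∫⁻ n, (n : ℝ≥0∞) ^ m ∂μ.toMeasure = ∑' k : ℕ, μ k * (k : ℝ≥0∞) ^ m := by
  rw [lintegral_countable']
  refine tsum_congr fun x => ?_
  rw [PMF.toMeasure_apply_singleton _ _ (measurableSet_singleton x), mul_comm]

lemma moment_one_succ (hμ : ∑' k : ℕ, μ k * (k : ℝ≥0∞) = 1) (h : ℕ) (z : Fin d → ℤ) :
    moment μ θ g (h + 1) 1 z = g z + stepOp θ (moment μ θ g h 1) z := by
  rw [moment_eq]
  simp only [truncSum_graft, pow_one]
  have hb := lintegral_branch_pow μ θ g h 1 z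
  simp only [pow_one] at hb
  have : ∀ n : ℕ, ∫⁻ ws, (g z + ∑ j ∈ Finset.range n, branch g h z j ws)
      ∂(Measure.infinitePi fun _ : ℕ => brwMeasure μ θ)
      = g z + n * stepOp θ (moment μ θ g h 1) z := by
    intro n
    rw [lintegral_add_left measurable_const, lintegral_finsetSum _ fun j _ => measurable_branch g h z j]
    simp [hb]
  simp only [this]
  have h1 := lintegral_natCast_pow (μ := μ) 1
  simp only [pow_one] at h1
  rw [lintegral_add_left measurable_const, lintegral_mul_const _ (measurable_of_countable _), h1, hμ]
  simp

/-- The many-to-one formula: with offspring mean 1, each generation contributes on average what a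
single walker would. -/
lemma moment_one (hμ : ∑' k : ℕ, μ k * (k : ℝ≥0∞) = 1) (h : ℕ) (z : Fin d → ℤ) :
    moment μ θ g h 1 z = ∑ n ∈ Finset.range (h + 1), walkOp θ n g z := by
  induction h generalizing z with
  | zero => simp [moment_one_zero, walkOp_zero]
  | succ h ih =>
    rw [moment_one_succ hμ, Finset.sum_range_succ', walkOp_zero, add_comm]
    congr 1
    simp only [walkOp_succ]
    rw [show moment μ θ g h 1 = fun z => ∑ n ∈ Finset.range (h + 1), walkOp θ n g z from
      funext ih]
    simp only [stepOp]
    rw [lintegral_finsetSum _ fun n _ => measurable_of_countable _]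

end moments

/-- The expected sum of the Green's function over the tree is the convolution of the two Green's
functions. -/
lemma lintegral_greenSum {d : ℕ} {μ : PMF ℕ} (hμ : ∑' k : ℕ, μ k * (k : ℝ≥0∞) = 1)
    (θ η : PMF (Fin d → ℤ)) (z : Fin d → ℤ) :
    ∫⁻ ω, greenSum η z ω ∂(brwMeasure μ θ) = ∑' x, green η (z + x) * green θ x := by
  have h1 := lintegral_greenSum_pow η (brwMeasure μ θ) z 1
  simp only [pow_one] at h1
  have h2 : ∀ h, ∫⁻ ω, truncSum (green η) h z ω ∂(brwMeasure μ θ)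
      = ∑ n ∈ Finset.range (h + 1), walkOp θ n (green η) z := by
    intro h
    rw [← moment_one hμ]
    simp [moment]
  rw [h1, ← tsum_walkOp, ENNReal.tsum_eq_iSup_nat' (tendsto_add_atTop_nat 1)]
  exact iSup_congr h2

end

/-! ### Uniform bounds for the higher moments of the truncated sums -/

section

lemma natCast_pow_le_pow {l m : ℕ} (hl : 1 ≤ l) (hlm : l ≤ m) (n : ℕ) :
    (n : ℝ≥0∞) ^ l ≤ (n : ℝ≥0∞) ^ m := by
  rcases Nat.eq_zero_or_pos n with rfl | hn
  · simp [show l ≠ 0 by omega]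
  · exact pow_le_pow_right₀ (by exact_mod_cast hn) hlm

/-- In each binomial term other than `S ^ m` one factor `g` is kept and the others are bounded by `1
+ B`. The correction is thus linear in `g`, and inherits its decay. -/
lemma add_pow_le_of_le {m : ℕ} {S g B : ℝ≥0∞} (hg : g ≤ B) :
    (S + g) ^ m ≤ S ^ m + ∑ j ∈ Finset.range m, g * ((1 + B) ^ m * 2 ^ m) * S ^ j := by
  rw [add_pow, Finset.sum_range_succ, add_comm]
  refine add_le_add (by simp) (Finset.sum_le_sum fun j hj => ?_)
  have hj' := Finset.mem_range.1 hj
  have h1 : g ^ (m - j) ≤ g * (1 + B) ^ m := by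
    obtain ⟨k, hk⟩ : ∃ k, m - j = k + 1 := ⟨m - j - 1, by omega⟩
    rw [hk, pow_succ']
    refine mul_le_mul' le_rfl ?_
    calc g ^ k ≤ (1 + B) ^ k := by gcongr; exact hg.trans le_add_self
      _ ≤ (1 + B) ^ m := pow_le_pow_right₀ le_self_add (by omega)
  have h2 : (m.choose j : ℝ≥0∞) ≤ 2 ^ m := by
    have := Nat.choose_le_two_pow m j
    exact_mod_cast this
  calc S ^ j * g ^ (m - j) * (m.choose j : ℝ≥0∞) ≤ S ^ j * (g * (1 + B) ^ m) * 2 ^ m := by gcongr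
    _ = _ := by ring

section moments

variable {d : ℕ} {μ : PMF ℕ} {θ : PMF (Fin d → ℤ)} {g H : (Fin d → ℤ) → ℝ≥0∞}

lemma stepOp_const_mul (c : ℝ≥0∞) (f : (Fin d → ℤ) → ℝ≥0∞) (z : Fin d → ℤ) :
    stepOp θ (fun z => c * f z) z = c * stepOp θ f z :=
  lintegral_const_mul _ (measurable_of_countable _)

/-- The recursion at the root. The coefficient `n` of the pure powers integrates to 1, which leaves
the `m`-th moment after one step with constant exactly 1. All other terms carry `H ^ 2`, coming from
two independent branches or from the value `g z` at the root itself. -/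
lemma moment_succ_le (hμ : ∑' k : ℕ, μ k * (k : ℝ≥0∞) = 1) {B K : ℝ≥0∞} {m : ℕ} (hm : 1 ≤ m)
    {h : ℕ} {z : Fin d → ℤ} (hH1 : H z ≤ 1) (hg : g z ≤ B * H z ^ 2)
    (hK : ∀ l, 1 ≤ l → l < m → stepOp θ (moment μ θ g h l) z ≤ K * H z) :
    moment μ θ g (h + 1) m z ≤ stepOp θ (moment μ θ g h m) z +
      (2 ^ m * (∑' k : ℕ, μ k * (k : ℝ≥0∞) ^ m) * K ^ 2 + m * (B * ((1 + B) ^ m * 2 ^ m) *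
        (1 + (∑' k : ℕ, μ k * (k : ℝ≥0∞) ^ m) * K))) * H z ^ 2 := by
  set v := stepOp θ (moment μ θ g h m) z
  set Q := Measure.infinitePi fun _ : ℕ => brwMeasure μ θ
  have hHsq : H z ^ 2 ≤ 1 := pow_le_one' hH1 2
  have hgB : g z ≤ B := hg.trans (by simpa using mul_le_mul_right hHsq B)
  have hmS : ∀ n l, Measurable fun ws => (∑ j ∈ Finset.range n, branch g h z j ws) ^ l :=
    fun n l => (Finset.measurable_sum _ fun j _ => measurable_branch g h z j).pow_const l
  have hterm : ∀ n : ℕ, ∫⁻ ws, truncSum g (h + 1) z (graft ((n, 0), ws)) ^ m ∂Q ≤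
      (n * v + 2 ^ m * n ^ m * (K * H z) ^ 2) +
        m * (B * H z ^ 2 * ((1 + B) ^ m * 2 ^ m) * (1 + n ^ m * K)) := by
    intro n
    simp only [truncSum_graft]
    calc ∫⁻ ws, (g z + ∑ j ∈ Finset.range n, branch g h z j ws) ^ m ∂Q
        ≤ ∫⁻ ws, ((∑ j ∈ Finset.range n, branch g h z j ws) ^ m + ∑ l ∈ Finset.range m,
            g z * ((1 + B) ^ m * 2 ^ m) * (∑ j ∈ Finset.range n, branch g h z j ws) ^ l) ∂Q := by
          refine lintegral_mono fun ws => ?_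
          rw [add_comm (g z)]
          exact add_pow_le_of_le hgB
      _ = ∫⁻ ws, (∑ j ∈ Finset.range n, branch g h z j ws) ^ m ∂Q + ∑ l ∈ Finset.range m,
            g z * ((1 + B) ^ m * 2 ^ m) *
              ∫⁻ ws, (∑ j ∈ Finset.range n, branch g h z j ws) ^ l ∂Q := by
          rw [lintegral_add_left (hmS n m), lintegral_finsetSum _ fun l _ => (hmS n l).const_mul _]
          simp only [lintegral_const_mul _ (hmS n _)]
      _ ≤ _ := by
          refine add_le_add ?_ ?_
          · exact lintegral_pow_sum_le_of_iIndepFun (measurable_branch g h z)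
              (iIndepFun_branch μ θ g h z) hm (fun i => (lintegral_branch_pow μ θ g h m z i).le)
              (fun l h1 h2 i => (lintegral_branch_pow μ θ g h l z i).trans_le (hK l h1 h2)) n
          · refine (Finset.sum_le_card_nsmul _ _
              (B * H z ^ 2 * ((1 + B) ^ m * 2 ^ m) * (1 + n ^ m * K)) fun l hl => ?_).trans
              (by simp)
            have hl' := Finset.mem_range.1 hl
            refine mul_le_mul' (mul_le_mul' hg le_rfl) ?_
            rcases Nat.eq_zero_or_pos l with rfl | hl0
            · simp
            · have h1 := lintegral_pow_sum_le (P := Q) (measurable_branch g h z) hl0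
                (fun i => (lintegral_branch_pow μ θ g h l z i).trans_le (hK l hl0 hl'))
                (Finset.range n)
              rw [Finset.card_range] at h1
              refine h1.trans (le_trans ?_ le_add_self)
              have h2 : (n : ℝ≥0∞) ^ l ≤ n ^ m := natCast_pow_le_pow hl0 hl'.le n
              refine mul_le_mul' h2 ?_
              simpa using mul_le_mul_right hH1 K
  rw [moment_eq]
  refine (lintegral_mono hterm).trans (le_of_eq ?_)
  have hN1 := lintegral_natCast_pow (μ := μ) 1
  simp only [pow_one, hμ] at hN1
  rw [← lintegral_natCast_pow, lintegral_add_left (measurable_of_countable _),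
    lintegral_add_left (measurable_of_countable _), lintegral_mul_const _ (measurable_of_countable _),
    hN1, lintegral_mul_const _ (measurable_of_countable _),
    lintegral_const_mul _ (measurable_of_countable _),
    lintegral_const_mul _ (measurable_of_countable _),
    lintegral_const_mul _ (measurable_of_countable _), lintegral_add_left measurable_const,
    lintegral_mul_const _ (measurable_of_countable _)]
  simp only [lintegral_const, measure_univ, mul_one, one_mul]
  ring

/-- If `g` and the convolution of `H ^ 2` with the Green's function of `θ` are dominated by `H ^ 2`
and `H`, then so are all moments. -/
lemma moment_le (hμ : ∑' k : ℕ, μ k * (k : ℝ≥0∞) = 1) {B : ℝ≥0∞} (hB : B ≠ ∞)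
    (hH1 : ∀ z, H z ≤ 1) (hg : ∀ z, g z ≤ B * H z ^ 2) (hstep : ∀ z, stepOp θ H z ≤ B * H z)
    (hconv : ∀ z, ∑' x, H (z + x) ^ 2 * green θ x ≤ B * H z) (m : ℕ) (hm : 1 ≤ m)
    (hmom : ∑' k : ℕ, μ k * (k : ℝ≥0∞) ^ m ≠ ∞) :
    ∃ C : ℝ≥0∞, C ≠ ∞ ∧ ∀ h z, moment μ θ g h m z ≤ C * H z := by
  induction m using Nat.strong_induction_on with
  | _ m ih =>
  have hlow : ∀ l, ∃ C : ℝ≥0∞, C ≠ ∞ ∧ (1 ≤ l → l < m → ∀ h z, moment μ θ g h l z ≤ C * H z) := by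
    intro l
    by_cases hl : 1 ≤ l ∧ l < m
    · have : ∑' k : ℕ, μ k * (k : ℝ≥0∞) ^ l ≠ ∞ := by
        refine ne_top_of_le_ne_top hmom (ENNReal.tsum_le_tsum fun k => ?_)
        exact mul_le_mul' le_rfl (natCast_pow_le_pow hl.1 hl.2.le k)
      obtain ⟨C, hC, h⟩ := ih l hl.2 hl.1 this
      exact ⟨C, hC, fun _ _ => h⟩
    · exact ⟨0, by simp, fun h1 h2 => absurd ⟨h1, h2⟩ hl⟩
  choose c hc hlow using hlow
  set K := (∑ l ∈ Finset.range m, c l) * B with hKdef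
  have hKtop : K ≠ ∞ := ENNReal.mul_ne_top (ENNReal.sum_ne_top.2 fun l _ => hc l) hB
  have hK : ∀ h z l, 1 ≤ l → l < m → stepOp θ (moment μ θ g h l) z ≤ K * H z := by
    intro h z l h1 h2
    calc stepOp θ (moment μ θ g h l) z ≤ stepOp θ (fun z => c l * H z) z :=
          stepOp_mono (fun z => hlow l h1 h2 h z) z
      _ = c l * stepOp θ H z := stepOp_const_mul _ _ _
      _ ≤ (∑ l ∈ Finset.range m, c l) * (B * H z) := by
          gcongr
          · exact Finset.single_le_sum (f := c) (fun _ _ => zero_le) (Finset.mem_range.2 h2)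
          · exact hstep z
      _ = K * H z := by rw [hKdef, mul_assoc]
  set N := ∑' k : ℕ, μ k * (k : ℝ≥0∞) ^ m
  set R := 2 ^ m * N * K ^ 2 + m * (B * ((1 + B) ^ m * 2 ^ m) * (1 + N * K)) with hR
  have hRtop : R ≠ ∞ := by
    have h2 : (2 : ℝ≥0∞) ^ m ≠ ∞ := by simp
    have h3 : (1 + B) ^ m ≠ ∞ := ENNReal.pow_ne_top (by simp [hB])
    refine ENNReal.add_ne_top.2 ⟨ENNReal.mul_ne_top (ENNReal.mul_ne_top h2 hmom)
      (ENNReal.pow_ne_top hKtop), ENNReal.mul_ne_top (by simp) (ENNReal.mul_ne_top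
      (ENNReal.mul_ne_top hB (ENNReal.mul_ne_top h3 h2)) (ENNReal.add_ne_top.2 ⟨by simp,
        ENNReal.mul_ne_top hmom hKtop⟩))⟩
  have hbase : ∀ z, g z ^ m ≤ B ^ m * H z ^ 2 := by
    intro z
    calc g z ^ m ≤ (B * H z ^ 2) ^ m := by gcongr; exact hg z
      _ = B ^ m * (H z ^ 2) ^ m := mul_pow _ _ _
      _ ≤ B ^ m * H z ^ 2 := by
          refine mul_le_mul' le_rfl ?_
          exact pow_le_of_le_one zero_le (pow_le_one' (hH1 z) 2) (Nat.one_le_iff_ne_zero.1 hm)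
  -- `R` is the source added at each application of the recursion and `B ^ m` covers height 0. The
  -- estimate `key` iterates the recursion: the sources `R' * H ^ 2` add up along the walk, and as
  -- `h` grows the sum is dominated by the convolution of `H ^ 2` with the Green's function of `θ`.
  set R' := R + B ^ m with hR'
  have key : ∀ h z, moment μ θ g h m z ≤
      R' * ∑ n ∈ Finset.range (h + 1), walkOp θ n (fun z => H z ^ 2) z := by
    intro h
    induction h with
    | zero =>
      intro z
      rw [moment_one_zero]
      simp only [zero_add, Finset.range_one, Finset.sum_singleton, walkOp_zero]
      exact (hbase z).trans (mul_le_mul' le_add_self le_rfl)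
    | succ h ihh =>
      intro z
      refine (moment_succ_le hμ hm (hH1 z) (hg z) (hK h z)).trans ?_
      rw [Finset.sum_range_succ', walkOp_zero, mul_add R']
      refine add_le_add ((stepOp_mono ihh z).trans (le_of_eq ?_)) (mul_le_mul' le_self_add le_rfl)
      rw [stepOp_const_mul]
      congr 1
      simp only [walkOp_succ, stepOp]
      rw [lintegral_finsetSum _ fun n _ => measurable_of_countable _]
  refine ⟨R' * B, ENNReal.mul_ne_top (ENNReal.add_ne_top.2 ⟨hRtop, ENNReal.pow_ne_top hB⟩) hB,
    fun h z => (key h z).trans ?_⟩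
  rw [mul_assoc]
  gcongr
  refine (ENNReal.sum_le_tsum _).trans ?_
  rw [tsum_walkOp]
  exact hconv z

lemma lintegral_greenSum_pow_le (hμ : ∑' k : ℕ, μ k * (k : ℝ≥0∞) = 1) {η : PMF (Fin d → ℤ)}
    {B : ℝ≥0∞} (hB : B ≠ ∞) (hH1 : ∀ z, H z ≤ 1) (hg : ∀ z, green η z ≤ B * H z ^ 2)
    (hstep : ∀ z, stepOp θ H z ≤ B * H z)
    (hconv : ∀ z, ∑' x, H (z + x) ^ 2 * green θ x ≤ B * H z) {m : ℕ} (hm : 1 ≤ m)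
    (hmom : ∑' k : ℕ, μ k * (k : ℝ≥0∞) ^ m ≠ ∞) :
    ∃ C : ℝ≥0∞, C ≠ ∞ ∧ ∀ z, ∫⁻ ω, greenSum η z ω ^ m ∂(brwMeasure μ θ) ≤ C * H z := by
  obtain ⟨C, hC, h⟩ := moment_le hμ hB hH1 hg hstep hconv m hm hmom
  refine ⟨C, hC, fun z => ?_⟩
  rw [lintegral_greenSum_pow]
  exact iSup_le fun k => h k z

end moments

end

section

/-! ### Lattice sums -/

/-- The weight `(1 + |z|) ^ (-2)` on `ℤ^6`. -/
def weight (z : Fin 6 → ℤ) : ℝ≥0∞ := ENNReal.ofReal (((1 + ‖toE z‖) ^ 2)⁻¹)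

lemma toE_add {d : ℕ} (x y : Fin d → ℤ) : toE (x + y) = toE x + toE y := by
  ext i; simp [toE]

lemma toE_neg {d : ℕ} (x : Fin d → ℤ) : toE (-x) = -toE x := by
  ext i; simp [toE]

lemma toE_zero {d : ℕ} : toE (0 : Fin d → ℤ) = 0 := by
  ext i; simp [toE]

lemma toE_sub {d : ℕ} (x y : Fin d → ℤ) : toE (x - y) = toE x - toE y := by
  ext i; simp [toE]

lemma one_le_norm_toE {d : ℕ} {x : Fin d → ℤ} (hx : x ≠ 0) : 1 ≤ ‖toE x‖ := by
  obtain ⟨i, hi⟩ := Function.ne_iff.1 hx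
  have h1 : ‖(toE x) i‖ ≤ ‖toE x‖ := PiLp.norm_apply_le _ _
  refine le_trans ?_ h1
  have : (1 : ℤ) ≤ |x i| := Int.one_le_abs hi
  have h2 : (1 : ℝ) ≤ |(x i : ℝ)| := by exact_mod_cast this
  simpa [toE] using h2

lemma weight_le_one (z : Fin 6 → ℤ) : weight z ≤ 1 := by
  rw [weight, ENNReal.ofReal_le_one]
  have : (0 : ℝ) ≤ ‖toE z‖ := norm_nonneg _
  exact inv_le_one_of_one_le₀ (by nlinarith)

/-- From `1 + |z| ≤ (1 + |z + x|)(1 + |x|)`. It shows that a step distorts the weight by a factor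
that is integrable as soon as second moments are finite. -/
lemma weight_add_le (z x : Fin 6 → ℤ) :
    weight (z + x) ≤ ENNReal.ofReal ((1 + ‖toE x‖) ^ 2) * weight z := by
  rw [weight, weight, ← ENNReal.ofReal_mul (by positivity)]
  apply ENNReal.ofReal_le_ofReal
  have h1 : ‖toE z‖ ≤ ‖toE (z + x)‖ + ‖toE x‖ := by
    have := norm_sub_le (toE (z + x)) (toE x)
    rwa [toE_add, add_sub_cancel_right, ← toE_add] at this
  have h2 : 1 + ‖toE z‖ ≤ (1 + ‖toE (z + x)‖) * (1 + ‖toE x‖) := by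
    have := norm_nonneg (toE (z + x))
    have := norm_nonneg (toE x)
    nlinarith
  rw [← div_eq_mul_inv, inv_eq_one_div, div_le_div_iff₀ (by positivity) (by positivity), one_mul,
    ← mul_pow, mul_comm]
  exact pow_le_pow_left₀ (by positivity) h2 2

lemma stepOp_weight_le (θ : PMF (Fin 6 → ℤ)) (z : Fin 6 → ℤ) :
    stepOp θ weight z ≤
      (∑' x, θ x * ENNReal.ofReal ((1 + ‖toE x‖) ^ 2)) * weight z := by
  rw [stepOp_eq_tsum, ← ENNReal.tsum_mul_right]
  refine ENNReal.tsum_le_tsum fun x => ?_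
  calc weight (z + x) * θ x ≤ ENNReal.ofReal ((1 + ‖toE x‖) ^ 2) * weight z * θ x := by
        gcongr; exact weight_add_le z x
    _ = _ := by ring

/-- The maximum of the absolute values of the coordinates. -/
def supAbs (x : Fin 6 → ℤ) : ℕ := Finset.univ.sup fun i => (x i).natAbs

/-- The lattice points in the cube of radius `n`. -/
def cube (n : ℕ) : Finset (Fin 6 → ℤ) := Fintype.piFinset fun _ => Finset.Icc (-(n : ℤ)) n

lemma mem_cube {n : ℕ} {x : Fin 6 → ℤ} : x ∈ cube n ↔ supAbs x ≤ n := by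
  simp only [cube, Fintype.mem_piFinset, Finset.mem_Icc, supAbs, Finset.sup_le_iff,
    Finset.mem_univ, true_imp_iff]
  exact forall_congr' fun i => by omega

lemma card_cube (n : ℕ) : (cube n).card = (2 * n + 1) ^ 6 := by
  rw [cube, Fintype.card_piFinset]
  simp only [Int.card_Icc, Finset.prod_const, Finset.card_univ, Fintype.card_fin]
  congr 1
  omega

/-- The shell of radius `n + 1` has `(2n+3)^6 - (2n+1)^6 ≤ 12 (2n+3)^5` points, and `384 = 12 ·
2^5`. -/
lemma card_supAbs_eq (n : ℕ) : ∃ s : Finset (Fin 6 → ℤ), (∀ x, x ∈ s ↔ supAbs x = n) ∧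
    s.card ≤ 384 * (n + 1) ^ 5 := by
  classical
  cases n with
  | zero =>
    refine ⟨cube 0, fun x => by rw [mem_cube, Nat.le_zero], by rw [card_cube]; norm_num⟩
  | succ n =>
    refine ⟨cube (n + 1) \ cube n, fun x => by rw [Finset.mem_sdiff, mem_cube, mem_cube]; omega, ?_⟩
    have hsub : cube n ⊆ cube (n + 1) := fun x hx => by rw [mem_cube] at *; omega
    rw [Finset.card_sdiff_of_subset hsub, card_cube, card_cube, Nat.sub_le_iff_le_add]
    ring_nf
    nlinarith [Nat.zero_le (n ^ 5), Nat.zero_le (n ^ 4), Nat.zero_le (n ^ 3), Nat.zero_le (n ^ 2),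
      Nat.zero_le n]

lemma tsum_supAbs_le (f : ℕ → ℝ≥0∞) :
    ∑' x, f (supAbs x) ≤ ∑' n : ℕ, 384 * ((n : ℝ≥0∞) + 1) ^ 5 * f n := by
  classical
  have e : ∀ x, f (supAbs x) = ∑' n, if supAbs x = n then f n else 0 := fun x => by simp
  simp only [e]
  rw [ENNReal.tsum_comm]
  refine ENNReal.tsum_le_tsum fun n => ?_
  obtain ⟨s, hs, hc⟩ := card_supAbs_eq n
  rw [tsum_eq_sum (s := s) (fun x hx => if_neg (fun h => hx ((hs x).2 h)))]
  refine (Finset.sum_le_card_nsmul s _ (f n) fun x _ => by split_ifs <;> simp).trans ?_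
  rw [nsmul_eq_mul]
  gcongr
  exact_mod_cast hc

lemma supAbs_le_norm (x : Fin 6 → ℤ) : (supAbs x : ℝ) ≤ ‖toE x‖ := by
  obtain ⟨i, -, hi⟩ := Finset.exists_mem_eq_sup Finset.univ ⟨0, Finset.mem_univ _⟩
    fun i => (x i).natAbs
  rw [supAbs, hi]
  have h1 : ‖(toE x) i‖ ≤ ‖toE x‖ := PiLp.norm_apply_le _ _
  refine le_trans (le_of_eq ?_) h1
  simp [toE, Nat.cast_natAbs]

/-- Telescoping against `2 / x ^ 2`: its decrease over a unit step exceeds `1 / x ^ 3` when `x ≥ 1`.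
-/
lemma tsum_inv_cube_le {R : ℝ} (hR : 1 ≤ R) :
    ∑' n : ℕ, ENNReal.ofReal (((R + n) ^ 3)⁻¹) ≤ ENNReal.ofReal (2 * (R ^ 2)⁻¹) := by
  refine ENNReal.tsum_le_of_sum_range_le fun N => ?_
  rw [← ENNReal.ofReal_sum_of_nonneg fun n _ => by positivity]
  apply ENNReal.ofReal_le_ofReal
  have : ∀ N : ℕ, ∑ n ∈ Finset.range N, ((R + n) ^ 3)⁻¹
      ≤ 2 * (R ^ 2)⁻¹ - 2 * ((R + N) ^ 2)⁻¹ := by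
    intro N
    induction N with
    | zero => simp
    | succ N ih =>
      rw [Finset.sum_range_succ]
      have h1 : ((R + N) ^ 3)⁻¹ ≤ 2 * ((R + N) ^ 2)⁻¹ - 2 * ((R + (N + 1 : ℕ)) ^ 2)⁻¹ := by
        push_cast
        have hx : 1 ≤ R + N := by have := Nat.cast_nonneg (α := ℝ) N; linarith
        rw [← add_assoc]
        set x := R + N
        have e : 2 * (x ^ 2)⁻¹ - 2 * ((x + 1) ^ 2)⁻¹ - (x ^ 3)⁻¹
            = (3 * x ^ 2 - 1) / (x ^ 3 * (x + 1) ^ 2) := by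
          field_simp; ring
        have : 0 ≤ (3 * x ^ 2 - 1) / (x ^ 3 * (x + 1) ^ 2) := by
          apply div_nonneg <;> nlinarith [pow_pos (by linarith : 0 < x) 3]
        linarith
      linarith
  refine (this N).trans ?_
  have : 0 ≤ 2 * ((R + N) ^ 2)⁻¹ := by positivity
  linarith

/-- Summing over shells, the count `384 (n+1)^5` against `(1+n)^(-4)` leaves one power of `1 + n ≤ R
+ n`. What remains is `∑ (R+n)^(-3)`, and `768 = 2 · 384`. -/
lemma tsum_weight_sq_mul_le {R : ℝ} (hR : 1 ≤ R) :
    ∑' x : Fin 6 → ℤ, ENNReal.ofReal (((1 + ‖toE x‖) ^ 4)⁻¹ * ((R + ‖toE x‖) ^ 4)⁻¹)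
      ≤ ENNReal.ofReal (768 * (R ^ 2)⁻¹) := by
  calc _ ≤ ∑' x : Fin 6 → ℤ,
        ENNReal.ofReal (((1 + (supAbs x : ℝ)) ^ 4)⁻¹ * ((R + (supAbs x : ℝ)) ^ 4)⁻¹) := by
        refine ENNReal.tsum_le_tsum fun x => ENNReal.ofReal_le_ofReal ?_
        have := supAbs_le_norm x
        gcongr
    _ ≤ _ := tsum_supAbs_le fun n => ENNReal.ofReal (((1 + (n : ℝ)) ^ 4)⁻¹ * ((R + (n : ℝ)) ^ 4)⁻¹)
    _ ≤ ∑' n : ℕ, 384 * ENNReal.ofReal (((R + n) ^ 3)⁻¹) := by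
        refine ENNReal.tsum_le_tsum fun n => ?_
        rw [mul_assoc]
        gcongr
        have e : ((n : ℝ≥0∞) + 1) ^ 5 = ENNReal.ofReal ((1 + (n : ℝ)) ^ 5) := by
          rw [ENNReal.ofReal_pow (by positivity), ENNReal.ofReal_add (by norm_num) (by positivity)]
          simp [add_comm]
        rw [e, ← ENNReal.ofReal_mul (by positivity)]
        apply ENNReal.ofReal_le_ofReal
        have hn := Nat.cast_nonneg (α := ℝ) n
        have e2 : (1 + (n : ℝ)) ^ 5 * (((1 + (n : ℝ)) ^ 4)⁻¹ * ((R + (n : ℝ)) ^ 4)⁻¹)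
            = (1 + n) * ((R + (n : ℝ)) ^ 4)⁻¹ := by
          field_simp
        have e3 : ((R + (n : ℝ)) ^ 3)⁻¹ = (R + n) * ((R + (n : ℝ)) ^ 4)⁻¹ := by
          field_simp
        rw [e2, e3]
        gcongr
    _ ≤ 384 * ENNReal.ofReal (2 * (R ^ 2)⁻¹) := by
        rw [ENNReal.tsum_mul_left]
        gcongr
        exact tsum_inv_cube_le hR
    _ = _ := by
        rw [show (384 : ℝ≥0∞) = ENNReal.ofReal 384 by simp, ← ENNReal.ofReal_mul (by norm_num)]
        congr 1; ring

lemma weight_sq (z : Fin 6 → ℤ) : weight z ^ 2 = ENNReal.ofReal (((1 + ‖toE z‖) ^ 4)⁻¹) := by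
  rw [weight, ← ENNReal.ofReal_pow (by positivity)]
  congr 1
  rw [inv_pow, ← pow_mul]

/-- The larger of `a` and `b` is at least `R / 2`. If it is `b`, then `R + a ≤ 2R + b ≤ 5b`, and
`625 = 5^4`. -/
lemma inv_pow_mul_inv_pow_le {a b R : ℝ} (ha : 0 < a) (hb : 0 < b) (hR : 0 < R)
    (h1 : R ≤ a + b) (h2 : a ≤ R + b) (h3 : b ≤ R + a) :
    (a ^ 4)⁻¹ * (b ^ 4)⁻¹ ≤ 625 * ((a ^ 4)⁻¹ * ((R + a) ^ 4)⁻¹)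
      + 625 * ((b ^ 4)⁻¹ * ((R + b) ^ 4)⁻¹) := by
  have key : ∀ a b : ℝ, 0 < a → 0 < b → R ≤ 2 * b → a ≤ R + b →
      (a ^ 4)⁻¹ * (b ^ 4)⁻¹ ≤ 625 * ((a ^ 4)⁻¹ * ((R + a) ^ 4)⁻¹) := by
    intro a b ha hb h h'
    rw [mul_left_comm]
    gcongr
    rw [← div_eq_mul_inv, inv_eq_one_div, div_le_div_iff₀ (by positivity) (by positivity), one_mul]
    calc (R + a) ^ 4 ≤ (5 * b) ^ 4 := by gcongr; linarith
      _ = 625 * b ^ 4 := by ring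
  rcases le_total a b with hab | hab
  · have := key a b ha hb (by linarith) h2
    have h0 : 0 ≤ 625 * ((b ^ 4)⁻¹ * ((R + b) ^ 4)⁻¹) := by positivity
    linarith
  · have := key b a hb ha (by linarith) h3
    have h0 : 0 ≤ 625 * ((a ^ 4)⁻¹ * ((R + a) ^ 4)⁻¹) := by positivity
    rw [mul_comm]
    linarith

/-- The lattice form of `|·|^(-4) * |·|^(-4) ≈ |·|^(-2)` in dimension 6. Each term is dominated by a
function centred at `0` and a translate of the same function centred at `-z`. -/
lemma tsum_weight_sq_weight_sq_le (z : Fin 6 → ℤ) :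
    ∑' x, weight (z + x) ^ 2 * weight x ^ 2 ≤ ENNReal.ofReal (2 * 625 * 768) * weight z := by
  set R := 1 + ‖toE z‖ with hRdef
  have hR : 1 ≤ R := by simp [hRdef]
  set f : (Fin 6 → ℤ) → ℝ≥0∞ := fun x =>
    ENNReal.ofReal (((1 + ‖toE x‖) ^ 4)⁻¹ * ((R + ‖toE x‖) ^ 4)⁻¹) with hf
  have hfs := tsum_weight_sq_mul_le hR
  have hle : ∀ x, weight (z + x) ^ 2 * weight x ^ 2
      ≤ ENNReal.ofReal 625 * f (z + x) + ENNReal.ofReal 625 * f x := by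
    intro x
    simp only [weight_sq, hf]
    rw [← ENNReal.ofReal_mul (by positivity), ← ENNReal.ofReal_mul (by norm_num),
      ← ENNReal.ofReal_mul (by norm_num), ← ENNReal.ofReal_add (by positivity) (by positivity)]
    apply ENNReal.ofReal_le_ofReal
    have n1 : ‖toE z‖ ≤ ‖toE (z + x)‖ + ‖toE x‖ := by
      have := norm_sub_le (toE (z + x)) (toE x)
      rwa [toE_add, add_sub_cancel_right, ← toE_add] at this
    have n2 : ‖toE (z + x)‖ ≤ ‖toE z‖ + ‖toE x‖ := by rw [toE_add]; exact norm_add_le _ _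
    have n3 : ‖toE x‖ ≤ ‖toE z‖ + ‖toE (z + x)‖ := by
      have := norm_sub_le (toE (z + x)) (toE z)
      rw [toE_add, add_sub_cancel_left, ← toE_add] at this
      linarith
    have p1 := norm_nonneg (toE (z + x))
    have p2 := norm_nonneg (toE x)
    refine (inv_pow_mul_inv_pow_le (R := R) (by linarith) (by linarith) (by linarith)
      (by linarith) (by linarith) (by linarith)).trans ?_
    have hg : ∀ t : ℝ, 0 ≤ t → ((1 + t) ^ 4)⁻¹ * ((R + (1 + t)) ^ 4)⁻¹
        ≤ ((1 + t) ^ 4)⁻¹ * ((R + t) ^ 4)⁻¹ := by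
      intro t ht
      gcongr
      linarith
    have g1 := hg _ p1
    have g2 := hg _ p2
    linarith
  calc _ ≤ ∑' x, (ENNReal.ofReal 625 * f (z + x) + ENNReal.ofReal 625 * f x) :=
        ENNReal.tsum_le_tsum hle
    _ = ENNReal.ofReal 625 * ∑' x, f (z + x) + ENNReal.ofReal 625 * ∑' x, f x := by
        rw [ENNReal.tsum_add, ENNReal.tsum_mul_left, ENNReal.tsum_mul_left]
    _ = ENNReal.ofReal 625 * ∑' x, f x + ENNReal.ofReal 625 * ∑' x, f x := by
        rw [(Equiv.addLeft z).tsum_eq f |>.symm]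
        rfl
    _ ≤ ENNReal.ofReal 625 * ENNReal.ofReal (768 * (R ^ 2)⁻¹)
        + ENNReal.ofReal 625 * ENNReal.ofReal (768 * (R ^ 2)⁻¹) := by gcongr
    _ = _ := by
        rw [weight, ← ENNReal.ofReal_mul (by norm_num), ← ENNReal.ofReal_mul (by norm_num),
          ← ENNReal.ofReal_add (by positivity) (by positivity)]
        congr 1; ring

end

section

/-! ### A calculus of symbols

Functions `f v k` of a direction `v` and a point `k`, differentiated in `k` along `v`. -/

section symbols

variable {E : Type*} [NormedAddCommGroup E] [NormedSpace ℝ E]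

/-- The derivative of `f v` at `k` in direction `v`. -/
def dirD (f : E → E → ℂ) (v k : E) : ℂ := deriv (fun s : ℝ => f v (k + s • v)) 0

/-- `f = O(|k| ^ a)` on `U`, uniformly over directions in the unit ball. -/
def SymBound (U : Set E) (a : ℤ) (f : E → E → ℂ) : Prop :=
  ∃ C : ℝ, ∀ v, ‖v‖ ≤ 1 → ∀ k ∈ U, ‖f v k‖ ≤ C * ‖k‖ ^ a

/-- Differentiability along the directions in the unit ball. -/
def DirDiff (U : Set E) (f : E → E → ℂ) : Prop :=
  ∀ v, ‖v‖ ≤ 1 → ∀ k ∈ U, DifferentiableAt ℝ (fun s : ℝ => f v (k + s • v)) 0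

/-- Symbols of degree `a` on `U`: the directional derivatives of order `j ≤ M` are
`O(|k| ^ (a - j))`. -/
def Sym (U : Set E) : ℕ → ℤ → (E → E → ℂ) → Prop
  | 0, a, f => SymBound U a f
  | M + 1, a, f => SymBound U a f ∧ DirDiff U f ∧ Sym U M (a - 1) (dirD f)

variable {U V : Set E} {M : ℕ} {a b : ℤ} {f g : E → E → ℂ}

lemma Sym.bound (h : Sym U M a f) : SymBound U a f := by
  cases M with
  | zero => exact h
  | succ M => exact h.1

lemma eventually_mem_line (hU : IsOpen U) {k : E} (hk : k ∈ U) (v : E) :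
    ∀ᶠ s : ℝ in 𝓝 0, k + s • v ∈ U := by
  have h : Continuous fun s : ℝ => k + s • v := by fun_prop
  have := h.tendsto 0
  rw [zero_smul, add_zero] at this
  exact this (hU.mem_nhds hk)

lemma SymBound.congr (h : ∀ v, ‖v‖ ≤ 1 → ∀ k ∈ U, f v k = g v k) (hf : SymBound U a f) :
    SymBound U a g := by
  obtain ⟨C, hC⟩ := hf
  exact ⟨C, fun v hv k hk => h v hv k hk ▸ hC v hv k hk⟩

/-- Openness enters because equality on `U` must persist along a short segment for the derivatives
to agree. -/
lemma Sym.congr (hU : IsOpen U) (h : ∀ v, ‖v‖ ≤ 1 → ∀ k ∈ U, f v k = g v k) (hf : Sym U M a f) :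
    Sym U M a g := by
  induction M generalizing a f g with
  | zero => exact SymBound.congr h hf
  | succ M ih =>
    obtain ⟨h1, h2, h3⟩ := hf
    have heq : ∀ v, ‖v‖ ≤ 1 → ∀ k ∈ U,
        (fun s : ℝ => f v (k + s • v)) =ᶠ[𝓝 0] fun s : ℝ => g v (k + s • v) := fun v hv k hk => by
      filter_upwards [eventually_mem_line hU hk v] with s hs using h v hv _ hs
    exact ⟨h1.congr h, fun v hv k hk => (heq v hv k hk).differentiableAt_iff.1 (h2 v hv k hk),
      ih (fun v hv k hk => (heq v hv k hk).deriv_eq) h3⟩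

/-- The working form of the inductive step: the derivative is given by an explicit formula, to which
the closure properties apply again. -/
lemma Sym.intro (hU : IsOpen U) {f' : E → E → ℂ} (hb : SymBound U a f)
    (hd : ∀ v, ‖v‖ ≤ 1 → ∀ k ∈ U, HasDerivAt (fun s : ℝ => f v (k + s • v)) (f' v k) 0)
    (h : Sym U M (a - 1) f') : Sym U (M + 1) a f :=
  ⟨hb, fun v hv k hk => (hd v hv k hk).differentiableAt,
    h.congr hU fun v hv k hk => (hd v hv k hk).deriv.symm⟩

lemma DirDiff.hasDerivAt (h : DirDiff U f) {v : E} (hv : ‖v‖ ≤ 1) {k : E} (hk : k ∈ U) :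
    HasDerivAt (fun s : ℝ => f v (k + s • v)) (dirD f v k) 0 :=
  (h v hv k hk).hasDerivAt

lemma Sym.of_succ (h : Sym U (M + 1) a f) : Sym U M a f := by
  induction M generalizing a f with
  | zero => exact h.1
  | succ M ih => exact ⟨h.1, h.2.1, ih h.2.2⟩

lemma Sym.mono (hUV : V ⊆ U) (h : Sym U M a f) : Sym V M a f := by
  induction M generalizing a f with
  | zero => exact h.imp fun C hC v hv k hk => hC v hv k (hUV hk)
  | succ M ih =>
    exact ⟨h.1.imp fun C hC v hv k hk => hC v hv k (hUV hk),
      fun v hv k hk => h.2.1 v hv k (hUV hk), ih h.2.2⟩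

lemma SymBound.union (hf : SymBound U a f) (hg : SymBound V a f) : SymBound (U ∪ V) a f := by
  obtain ⟨C, hC⟩ := hf
  obtain ⟨C', hC'⟩ := hg
  refine ⟨max C C', fun v hv k hk => ?_⟩
  have h0 : 0 ≤ ‖k‖ ^ a := by positivity
  rcases hk with hk | hk
  · exact (hC v hv k hk).trans (mul_le_mul_of_nonneg_right (le_max_left _ _) h0)
  · exact (hC' v hv k hk).trans (mul_le_mul_of_nonneg_right (le_max_right _ _) h0)

lemma Sym.union (hf : Sym U M a f) (hg : Sym V M a f) : Sym (U ∪ V) M a f := by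
  induction M generalizing a f with
  | zero => exact SymBound.union hf hg
  | succ M ih =>
    refine ⟨hf.1.union hg.1, fun v hv k hk => ?_, ih hf.2.2 hg.2.2⟩
    rcases hk with hk | hk
    · exact hf.2.1 v hv k hk
    · exact hg.2.1 v hv k hk

/-- Change of the degree on sets where the corresponding weights compare. -/
lemma Sym.of_weight_le (h0 : (0 : E) ∉ U) {c : ℝ} (hc : ∀ k ∈ U, ‖k‖ ^ a ≤ c * ‖k‖ ^ b)
    (h : Sym U M a f) : Sym U M b f := by
  have hbd : ∀ {a b : ℤ} {f : E → E → ℂ}, (∀ k ∈ U, ‖k‖ ^ a ≤ c * ‖k‖ ^ b) → SymBound U a f →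
      SymBound U b f := by
    rintro a b f hc ⟨C, hC⟩
    refine ⟨|C| * c, fun v hv k hk => (hC v hv k hk).trans ?_⟩
    have hp : 0 ≤ ‖k‖ ^ a := by positivity
    calc C * ‖k‖ ^ a ≤ |C| * ‖k‖ ^ a := mul_le_mul_of_nonneg_right (le_abs_self C) hp
      _ ≤ |C| * (c * ‖k‖ ^ b) := mul_le_mul_of_nonneg_left (hc k hk) (abs_nonneg _)
      _ = _ := by ring
  induction M generalizing a b f with
  | zero => exact hbd hc h
  | succ M ih =>
    refine ⟨hbd hc h.1, h.2.1, ih (fun k hk => ?_) h.2.2⟩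
    have hk0 : ‖k‖ ≠ 0 := fun hk' => h0 (norm_eq_zero.1 hk' ▸ hk)
    rw [zpow_sub_one₀ hk0, zpow_sub_one₀ hk0, ← mul_assoc]
    exact mul_le_mul_of_nonneg_right (hc k hk) (by positivity)

lemma SymBound.add (hf : SymBound U a f) (hg : SymBound U a g) :
    SymBound U a fun v k => f v k + g v k := by
  obtain ⟨C, hC⟩ := hf
  obtain ⟨C', hC'⟩ := hg
  refine ⟨C + C', fun v hv k hk => (norm_add_le _ _).trans ?_⟩
  rw [add_mul]
  exact add_le_add (hC v hv k hk) (hC' v hv k hk)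

lemma Sym.add (hU : IsOpen U) (hf : Sym U M a f) (hg : Sym U M a g) :
    Sym U M a fun v k => f v k + g v k := by
  induction M generalizing a f g with
  | zero => exact SymBound.add hf hg
  | succ M ih =>
    exact Sym.intro hU (hf.1.add hg.1)
      (fun v hv k hk => (hf.2.1.hasDerivAt hv hk).add (hg.2.1.hasDerivAt hv hk)) (ih hf.2.2 hg.2.2)

lemma Sym.const_mul (hU : IsOpen U) (c : ℂ) (hf : Sym U M a f) :
    Sym U M a fun v k => c * f v k := by
  have hb : ∀ {a : ℤ} {f : E → E → ℂ}, SymBound U a f → SymBound U a fun v k => c * f v k := by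
    rintro a f ⟨C, hC⟩
    refine ⟨‖c‖ * C, fun v hv k hk => ?_⟩
    rw [norm_mul, mul_assoc]
    exact mul_le_mul_of_nonneg_left (hC v hv k hk) (norm_nonneg _)
  induction M generalizing a f with
  | zero => exact hb hf
  | succ M ih =>
    exact Sym.intro hU (hb hf.1) (fun v hv k hk => (hf.2.1.hasDerivAt hv hk).const_mul c) (ih hf.2.2)

lemma Sym.neg (hU : IsOpen U) (hf : Sym U M a f) : Sym U M a fun v k => -f v k :=
  (hf.const_mul hU (-1)).congr hU fun v _ k _ => by ring

lemma Sym.sub (hU : IsOpen U) (hf : Sym U M a f) (hg : Sym U M a g) :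
    Sym U M a fun v k => f v k - g v k :=
  (hf.add hU (hg.neg hU)).congr hU fun v _ k _ => by ring

lemma SymBound.mul (h0 : (0 : E) ∉ U) (hf : SymBound U a f) (hg : SymBound U b g) :
    SymBound U (a + b) fun v k => f v k * g v k := by
  obtain ⟨C, hC⟩ := hf
  obtain ⟨C', hC'⟩ := hg
  refine ⟨C * C', fun v hv k hk => ?_⟩
  have hk0 : ‖k‖ ≠ 0 := fun hk' => h0 (norm_eq_zero.1 hk' ▸ hk)
  rw [norm_mul, zpow_add₀ hk0]
  calc ‖f v k‖ * ‖g v k‖ ≤ (C * ‖k‖ ^ a) * (C' * ‖k‖ ^ b) :=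
        mul_le_mul (hC v hv k hk) (hC' v hv k hk) (norm_nonneg _)
          ((norm_nonneg _).trans (hC v hv k hk))
    _ = _ := by ring

lemma Sym.mul (hU : IsOpen U) (h0 : (0 : E) ∉ U) (hf : Sym U M a f) (hg : Sym U M b g) :
    Sym U M (a + b) fun v k => f v k * g v k := by
  induction M generalizing a b f g with
  | zero => exact SymBound.mul h0 hf hg
  | succ M ih =>
    refine Sym.intro hU (hf.1.mul h0 hg.1)
      (f' := fun v k => dirD f v k * g v k + f v k * dirD g v k) (fun v hv k hk => ?_) ?_
    · have h1 := (hf.2.1.hasDerivAt hv hk).mul (hg.2.1.hasDerivAt hv hk)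
      simp only [zero_smul, add_zero] at h1
      exact h1
    · have h1 := ih hf.2.2 hg.of_succ
      have h2 := ih hf.of_succ hg.2.2
      rw [show a - 1 + b = a + b - 1 by ring] at h1
      rw [show a + (b - 1) = a + b - 1 by ring] at h2
      exact h1.add hU h2

/-- The derivative `-f' f⁻²` has degree `(a - 1) - 2a = -a - 1`, and only uses the inverse with one
derivative fewer. -/
lemma Sym.inv (hU : IsOpen U) (h0 : (0 : E) ∉ U) {c : ℝ} (hc : 0 < c)
    (hlow : ∀ v, ‖v‖ ≤ 1 → ∀ k ∈ U, c * ‖k‖ ^ a ≤ ‖f v k‖) (hf : Sym U M a f) :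
    Sym U M (-a) fun v k => (f v k)⁻¹ := by
  have hpos : ∀ k ∈ U, 0 < ‖k‖ := fun k hk => norm_pos_iff.2 fun h => h0 (h ▸ hk)
  have hb : SymBound U (-a) fun v k => (f v k)⁻¹ := by
    refine ⟨c⁻¹, fun v hv k hk => ?_⟩
    rw [norm_inv, zpow_neg, ← mul_inv]
    have := hpos k hk
    exact inv_anti₀ (by positivity) (hlow v hv k hk)
  induction M with
  | zero => exact hb
  | succ M ih =>
    have hi := ih hf.of_succ
    refine Sym.intro hU hb
      (f' := fun v k => -(dirD f v k * ((f v k)⁻¹ * (f v k)⁻¹))) (fun v hv k hk => ?_) ?_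
    · have hne : f v k ≠ 0 := by
        have := hpos k hk
        have h1 : 0 < c * ‖k‖ ^ a := by positivity
        exact norm_pos_iff.1 (h1.trans_le (hlow v hv k hk))
      have h1 := (hf.2.1.hasDerivAt hv hk).inv (by simpa using hne)
      simp only [zero_smul, add_zero] at h1
      refine h1.congr_deriv ?_
      field_simp
    · have h1 := (hf.2.2.mul hU h0 (hi.mul hU h0 hi)).neg hU
      rwa [show a - 1 + (-a + -a) = -a - 1 by ring] at h1

/-- The derivative brings down `q'`, of degree 1. The exponential is small to every nonpositive
degree, so it can be taken with degree `a - 2` to compensate. -/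
lemma Sym.cexp_neg (hU : IsOpen U) (h0 : (0 : E) ∉ U) {q : E → E → ℂ}
    (hq : ∀ M, Sym U M 2 q)
    (hb : ∀ a : ℤ, a ≤ 0 → SymBound U a fun v k => Complex.exp (-q v k)) (ha : a ≤ 0) :
    Sym U M a fun v k => Complex.exp (-q v k) := by
  induction M generalizing a with
  | zero => exact hb a ha
  | succ M ih =>
    refine Sym.intro hU (hb a ha)
      (f' := fun v k => -(dirD q v k * Complex.exp (-q v k))) (fun v hv k hk => ?_) ?_
    · have h1 := ((hq 1).2.1.hasDerivAt hv hk).neg.cexp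
      refine h1.congr_deriv ?_
      simp only [Pi.neg_apply, zero_smul, add_zero]
      ring
    · have h1 := ((hq (M + 1)).2.2.mul hU h0 (ih (a := a - 2) (by omega))).neg hU
      rwa [show (2 : ℤ) - 1 + (a - 2) = a - 1 by ring] at h1

/-- Smooth functions that vanish for large `k` are symbols of every degree `a ≤ 0`. -/
lemma Sym.of_contDiff [FiniteDimensional ℝ E] {W : E × E → ℂ} (hU : IsOpen U) (h0 : (0 : E) ∉ U)
    (hW : ContDiff ℝ ((⊤ : ℕ∞) : WithTop ℕ∞) W) {R : ℝ} (hR : ∀ v k, R < ‖k‖ → W (v, k) = 0)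
    (ha : a ≤ 0) : Sym U M a fun v k => W (v, k) := by
  have hbd : ∀ {W : E × E → ℂ}, ContDiff ℝ ((⊤ : ℕ∞) : WithTop ℕ∞) W →
      (∀ v k, R < ‖k‖ → W (v, k) = 0) → ∀ {a : ℤ}, a ≤ 0 → SymBound U a fun v k => W (v, k) := by
    intro W hW hR a ha
    obtain ⟨C, hC⟩ := ((isCompact_closedBall (0 : E) 1).prod
      (isCompact_closedBall (0 : E) R)).exists_bound_of_continuousOn hW.continuous.continuousOn
    refine ⟨|C| * (max R 1) ^ (-a), fun v hv k hk => ?_⟩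
    have hk0 : 0 < ‖k‖ := norm_pos_iff.2 fun h => h0 (h ▸ hk)
    rcases lt_or_ge R ‖k‖ with hRk | hRk
    · simp only [hR v k hRk, norm_zero]
      positivity
    · have h1 := hC (v, k) ⟨by simpa using hv, by simpa using hRk⟩
      have h2 : 1 ≤ (max R 1) ^ (-a) * ‖k‖ ^ a := by
        obtain ⟨n, rfl⟩ : ∃ n : ℕ, a = -n := ⟨a.toNat + (-a).toNat, by omega⟩
        rw [neg_neg, zpow_neg, zpow_natCast, zpow_natCast, ← div_eq_mul_inv, ← div_pow]
        exact one_le_pow₀ ((one_le_div hk0).2 (hRk.trans (le_max_left _ _)))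
      calc ‖W (v, k)‖ ≤ |C| * 1 := by rw [mul_one]; exact h1.trans (le_abs_self C)
        _ ≤ |C| * ((max R 1) ^ (-a) * ‖k‖ ^ a) := by gcongr
        _ = _ := by ring
  induction M generalizing a W with
  | zero => exact hbd hW hR ha
  | succ M ih =>
    -- Treating `W` as a function of the pair makes the directional derivative another smooth
    -- function of `(v, k)` that vanishes for large `k`, so the induction applies to it.
    refine Sym.intro hU (hbd hW hR ha) (f' := fun v k => fderiv ℝ W (v, k) (0, v))
      (fun v hv k hk => ?_) (ih (W := fun p => fderiv ℝ W p (0, p.1)) ?_ ?_ (by omega))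
    · have h1 : HasFDerivAt W (fderiv ℝ W (v, k)) (v, k + (0 : ℝ) • v) := by
        rw [zero_smul, add_zero]
        exact (hW.differentiable (by simp)).differentiableAt.hasFDerivAt
      have h2 : HasDerivAt (fun s : ℝ => (v, k + s • v)) ((0 : E), v) 0 := by
        have h3 : HasDerivAt (fun s : ℝ => k + s • v) v 0 := by
          simpa using ((hasDerivAt_id (0 : ℝ)).smul_const v).const_add k
        exact (hasDerivAt_const (0 : ℝ) v).prodMk h3
      exact h1.comp_hasDerivAt (0 : ℝ) h2
    · have h1 : ContDiff ℝ ((⊤ : ℕ∞) : WithTop ℕ∞) (fderiv ℝ W) :=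
        hW.fderiv_right (by simp)
      exact h1.clm_apply (contDiff_const.prodMk contDiff_fst)
    · intro v k hk
      have h1 : W =ᶠ[𝓝 (v, k)] fun _ => 0 := by
        have ho : IsOpen {p : E × E | R < ‖p.2‖} :=
          isOpen_lt continuous_const continuous_snd.norm
        filter_upwards [ho.mem_nhds (show (v, k) ∈ {p : E × E | R < ‖p.2‖} from hk)] with p hp
        exact hR p.1 p.2 hp
      simp only
      rw [h1.fderiv_eq]
      simp

end symbols

end

section

/-! ### Finite differences -/

section differences

variable {E : Type*} [NormedAddCommGroup E] [NormedSpace ℝ E]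

/-- The forward difference with step `t`. -/
def fdiff (t : E) (f : E → ℂ) (k : E) : ℂ := f (k + t) - f k

lemma hasDerivAt_fdiff_iterate {v t : E} {M : ℕ} {f f' : E → ℂ} {k : E}
    (h : ∀ j ≤ M, HasDerivAt (fun s : ℝ => f (k + j • t + s • v)) (f' (k + j • t)) 0) :
    HasDerivAt (fun s : ℝ => (fdiff t)^[M] f (k + s • v)) ((fdiff t)^[M] f' k) 0 := by
  induction M generalizing k with
  | zero => simpa using h 0 le_rfl
  | succ M ih =>
    have h1 := ih (k := k + t) (fun j hj => by
      have := h (j + 1) (by omega)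
      rwa [add_smul, one_smul, add_comm (j • t), ← add_assoc] at this)
    have h2 := ih (k := k) (fun j hj => h j (by omega))
    simp only [Function.iterate_succ', Function.comp_apply]
    refine (h1.sub h2).congr_of_eventuallyEq (Eventually.of_forall fun s => ?_)
    simp only [fdiff, Pi.sub_apply]
    rw [show k + s • v + t = k + t + s • v by abel]

/-- The mean value inequality applied `M` times, differences commuting with the derivative along
`v`. Used away from the singularity at the origin. -/
lemma norm_fdiff_iterate_le {U : Set E} {M : ℕ} {a : ℤ} {f : E → E → ℂ} (hf : Sym U M a f)
    {v k : E} (hv : ‖v‖ ≤ 1) {τ B : ℝ} (hτ : 0 ≤ τ)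
    (hseg : ∀ s ∈ Set.Icc 0 (M * τ), k + s • v ∈ U)
    (hB : ∀ s ∈ Set.Icc 0 (M * τ), ‖dirD^[M] f v (k + s • v)‖ ≤ B) :
    ‖(fdiff (τ • v))^[M] (f v) k‖ ≤ τ ^ M * B := by
  induction M generalizing a f k with
  | zero => simpa using hB 0 (by simp)
  | succ M ih =>
    have hMτ : 0 ≤ (M : ℝ) * τ := by positivity
    have hder : ∀ s ∈ Set.Icc 0 τ, HasDerivAt
        (fun s : ℝ => (fdiff (τ • v))^[M] (f v) (k + s • v))
        ((fdiff (τ • v))^[M] (dirD f v) (k + s • v)) s := by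
      intro s hs
      have h1 : HasDerivAt (fun r : ℝ => (fdiff (τ • v))^[M] (f v) ((k + s • v) + r • v))
          ((fdiff (τ • v))^[M] (dirD f v) (k + s • v)) (s - s) := by
        rw [sub_self]
        refine hasDerivAt_fdiff_iterate fun j hj => ?_
        refine hf.2.1.hasDerivAt hv ?_
        have hj' : (j : ℝ) ≤ M := by exact_mod_cast hj
        have := hseg (s + j * τ) ⟨by have := hs.1; positivity, by
          have := mul_le_mul_of_nonneg_right hj' hτ
          push_cast; linarith [hs.2]⟩
        convert this using 1
        rw [add_smul, mul_smul, ← Nat.cast_smul_eq_nsmul ℝ, add_assoc]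
      have h2 := h1.comp_sub_const s s
      refine h2.congr_of_eventuallyEq (Eventually.of_forall fun r => ?_)
      simp only
      rw [add_assoc, ← add_smul, add_sub_cancel]
    have hbd : ∀ s ∈ Set.Ico 0 τ, ‖(fdiff (τ • v))^[M] (dirD f v) (k + s • v)‖ ≤ τ ^ M * B := by
      intro s hs
      refine ih hf.2.2 (fun r hr => ?_) (fun r hr => ?_)
      · rw [add_assoc, ← add_smul]
        exact hseg _ ⟨by linarith [hs.1, hr.1], by push_cast; linarith [hs.2, hr.2]⟩
      · rw [add_assoc, ← add_smul]
        exact hB _ ⟨by linarith [hs.1, hr.1], by push_cast; linarith [hs.2, hr.2]⟩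
    have := norm_image_sub_le_of_norm_deriv_le_segment'
      (fun s hs => (hder s hs).hasDerivWithinAt) hbd τ ⟨hτ, le_rfl⟩
    simp only [zero_smul, add_zero, sub_zero] at this
    rw [Function.iterate_succ', Function.comp_apply]
    refine this.trans (le_of_eq ?_)
    ring

lemma Sym.iterate {U : Set E} {M : ℕ} {a : ℤ} {f : E → E → ℂ} (hf : Sym U M a f) :
    SymBound U (a - M) (dirD^[M] f) := by
  induction M generalizing a f with
  | zero => simpa using hf.bound
  | succ M ih =>
    have := ih hf.2.2
    rw [Function.iterate_succ, Function.comp_apply]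
    convert this using 1
    push_cast; ring

variable [MeasurableSpace E] [BorelSpace E] {P : Measure E} [P.IsAddRightInvariant]

/-- The crude bound for use near the singularity, where no derivative is controlled: the `2 ^ M`
translated terms all live in the ball enlarged by `M ‖t‖`. -/
lemma lintegral_ball_fdiff_iterate_le (t : E) (M : ℕ) (f : E → ℂ) (hf : AEStronglyMeasurable f P)
    (r : ℝ) : ∫⁻ k in Metric.ball 0 r, ‖(fdiff t)^[M] f k‖ₑ ∂P ≤
      2 ^ M * ∫⁻ k in Metric.ball 0 (r + M * ‖t‖), ‖f k‖ₑ ∂P := by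
  induction M generalizing f r with
  | zero => simp
  | succ M ih =>
    have hft : AEStronglyMeasurable (fun k => f (k + t)) P :=
      hf.comp_measurePreserving (measurePreserving_add_right P t)
    have h1 := ih (fdiff t f) (hft.sub hf) r
    rw [Function.iterate_succ, Function.comp_apply]
    refine h1.trans ?_
    rw [pow_succ, mul_assoc]
    refine mul_le_mul' le_rfl ?_
    set B := Metric.ball (0 : E) (r + M * ‖t‖)
    set B' := Metric.ball (0 : E) (r + (M + 1 : ℕ) * ‖t‖)
    have hB' : MeasurableSet B' := Metric.isOpen_ball.measurableSet
    have hB : MeasurableSet B := Metric.isOpen_ball.measurableSet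
    have hBB' : B ⊆ B' := Metric.ball_subset_ball (by
      push_cast; nlinarith [norm_nonneg t])
    calc ∫⁻ k in B, ‖fdiff t f k‖ₑ ∂P ≤ ∫⁻ k in B, (‖f (k + t)‖ₑ + ‖f k‖ₑ) ∂P :=
          lintegral_mono fun k => enorm_sub_le
      _ = ∫⁻ k in B, ‖f (k + t)‖ₑ ∂P + ∫⁻ k in B, ‖f k‖ₑ ∂P :=
          lintegral_add_left' hft.enorm.restrict _
      _ ≤ ∫⁻ k in B', ‖f k‖ₑ ∂P + ∫⁻ k in B', ‖f k‖ₑ ∂P := by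
          refine add_le_add ?_ (lintegral_mono_set hBB')
          calc ∫⁻ k in B, ‖f (k + t)‖ₑ ∂P
              ≤ ∫⁻ k, B'.indicator (fun k => ‖f k‖ₑ) (k + t) ∂P := by
                rw [← lintegral_indicator hB]
                refine lintegral_mono fun k => ?_
                by_cases hk : k ∈ B
                · have hk' : k + t ∈ B' := by
                    simp only [B, B', Metric.mem_ball, dist_zero_right] at hk ⊢
                    push_cast
                    linarith [norm_add_le k t]
                  simp [hk, hk']
                · simp [hk]
            _ = ∫⁻ k, B'.indicator (fun k => ‖f k‖ₑ) k ∂P :=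
                lintegral_add_right_eq_self (fun k => B'.indicator (fun k => ‖f k‖ₑ) k) t
            _ = _ := lintegral_indicator hB' _
      _ = _ := by rw [two_mul]

end differences

/-! ### Radial integrals on `ℝ^6` -/

/-- The Euclidean space `ℝ^6`. -/
abbrev E6 : Type := EuclideanSpace ℝ (Fin 6)

lemma zpow_eq_rpow_mul {y : ℝ} (hy : 0 < y) (a : ℤ) : y ^ 5 * y ^ a = y ^ ((5 : ℝ) + a) := by
  rw [Real.rpow_add hy, Real.rpow_intCast]
  norm_cast

lemma lintegral_ball_norm_zpow {a : ℤ} (ha : -6 < a) : ∃ C : ℝ, 0 ≤ C ∧ ∀ r : ℝ, 0 ≤ r →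
    ∫⁻ k in Metric.ball (0 : E6) r, ENNReal.ofReal (‖k‖ ^ a) ≤ ENNReal.ofReal (C * r ^ (6 + a)) := by
  have ha' : (-6 : ℝ) + 1 ≤ a := by exact_mod_cast ha
  refine ⟨6 * volume.real (Metric.ball (0 : E6) 1) * (1 / (6 + a)), ?_, fun r hr => ?_⟩
  · have : (0 : ℝ) < 6 + a := by linarith
    positivity
  have hfr : Module.finrank ℝ E6 = 6 := by simp
  have hint : IntegrableOn (fun y : ℝ => y ^ ((5 : ℝ) + a)) (Set.Ioo 0 r) := by
    have := intervalIntegral.intervalIntegrable_rpow' (a := 0) (b := r) (r := 5 + a) (by linarith)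
    rw [intervalIntegrable_iff_integrableOn_Ioo_of_le hr] at this
    exact this
  have hi : IntegrableOn (fun x : E6 => ‖x‖ ^ a) (Metric.ball 0 r) := by
    rw [integrableOn_fun_norm_addHaar volume (f := fun y : ℝ => y ^ a), hfr]
    refine hint.congr_fun (fun y hy => ?_) measurableSet_Ioo
    simp only [smul_eq_mul, ← zpow_eq_rpow_mul hy.1 a]
  have hv : ∫ x in Metric.ball (0 : E6) r, ‖x‖ ^ a =
      6 * volume.real (Metric.ball (0 : E6) 1) * (1 / (6 + a)) * r ^ (6 + a) := by
    have h1 : ∫ x in Metric.ball (0 : E6) r, ‖x‖ ^ a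
        = ∫ x : E6, (Set.Iio r).indicator (fun y : ℝ => y ^ a) ‖x‖ := by
      rw [← integral_indicator Metric.isOpen_ball.measurableSet]
      congr 1
      funext x
      simp [Set.indicator, Metric.mem_ball]
    rw [h1, integral_fun_norm_addHaar, hfr]
    have h2 : ∫ y in Set.Ioi (0 : ℝ), y ^ (6 - 1) • (Set.Iio r).indicator (fun y : ℝ => y ^ a) y
        = ∫ y in (0)..r, y ^ ((5 : ℝ) + a) := by
      rw [intervalIntegral.integral_of_le hr, integral_Ioc_eq_integral_Ioo,
        ← integral_indicator measurableSet_Ioi, ← integral_indicator measurableSet_Ioo]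
      congr 1
      funext y
      by_cases hy : 0 < y
      · by_cases hy2 : y < r
        · simp [hy, hy2, ← zpow_eq_rpow_mul hy a]
        · simp [hy, hy2]
      · simp [hy]
    rw [h2, integral_rpow (Or.inl (by linarith)), Real.zero_rpow (by linarith)]
    have h3 : r ^ ((5 : ℝ) + a + 1) = r ^ (6 + a) := by
      rw [show (5 : ℝ) + a + 1 = ((6 + a : ℤ) : ℝ) by push_cast; ring, Real.rpow_intCast]
    rw [h3, show (5 : ℝ) + a + 1 = 6 + a by ring]
    simp only [nsmul_eq_mul, smul_eq_mul]
    push_cast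
    ring
  rw [← hv, ofReal_integral_eq_lintegral_ofReal hi (Eventually.of_forall fun x => by positivity)]

lemma lintegral_compl_ball_norm_zpow {a : ℤ} (ha : a < -6) : ∃ C : ℝ, 0 ≤ C ∧ ∀ r : ℝ, 0 < r →
    ∫⁻ k in (Metric.ball (0 : E6) r)ᶜ, ENNReal.ofReal (‖k‖ ^ a)
      ≤ ENNReal.ofReal (C * r ^ (6 + a)) := by
  have ha' : (a : ℝ) ≤ -6 - 1 := by exact_mod_cast (by omega : a ≤ -6 - 1)
  refine ⟨6 * volume.real (Metric.ball (0 : E6) 1) * (1 / (-(6 + a))), ?_, fun r hr => ?_⟩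
  · have : (0 : ℝ) < -(6 + a) := by linarith
    positivity
  have hfr : Module.finrank ℝ E6 = 6 := by simp
  have hint : IntegrableOn (fun y : ℝ => y ^ ((5 : ℝ) + a)) (Set.Ioi r) :=
    integrableOn_Ioi_rpow_of_lt (by linarith) hr
  have h1 : ∀ x : E6, (Metric.ball (0 : E6) r)ᶜ.indicator (fun x => ‖x‖ ^ a) x
      = (Set.Ici r).indicator (fun y : ℝ => y ^ a) ‖x‖ := by
    intro x
    simp [Set.indicator, Metric.mem_ball]
  have hmb : MeasurableSet (Metric.ball (0 : E6) r)ᶜ := Metric.isOpen_ball.measurableSet.compl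
  have h2 : ∀ y : ℝ, (Set.Ioi (0 : ℝ)).indicator
      (fun y => y ^ (6 - 1) • (Set.Ici r).indicator (fun y : ℝ => y ^ a) y) y
      = (Set.Ici r).indicator (fun y : ℝ => y ^ ((5 : ℝ) + a)) y := by
    intro y
    by_cases hy2 : r ≤ y
    · have hy : 0 < y := hr.trans_le hy2
      simp [hy, hy2, ← zpow_eq_rpow_mul hy a]
    · simp [Set.indicator, hy2]
  have hi : IntegrableOn (fun x : E6 => ‖x‖ ^ a) (Metric.ball 0 r)ᶜ := by
    rw [← integrable_indicator_iff hmb]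
    simp only [funext h1]
    rw [integrable_fun_norm_addHaar, hfr, ← integrable_indicator_iff measurableSet_Ioi]
    simp only [funext h2]
    rw [integrable_indicator_iff measurableSet_Ici, integrableOn_Ici_iff_integrableOn_Ioi]
    exact hint
  have hv : ∫ x in (Metric.ball (0 : E6) r)ᶜ, ‖x‖ ^ a =
      6 * volume.real (Metric.ball (0 : E6) 1) * (1 / (-(6 + a))) * r ^ (6 + a) := by
    rw [← integral_indicator hmb]
    simp only [funext h1]
    rw [integral_fun_norm_addHaar, hfr, ← integral_indicator measurableSet_Ioi]
    simp only [funext h2]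
    rw [integral_indicator measurableSet_Ici, integral_Ici_eq_integral_Ioi,
      integral_Ioi_rpow_of_lt (by linarith) hr]
    have h3 : r ^ ((5 : ℝ) + a + 1) = r ^ (6 + a) := by
      rw [show (5 : ℝ) + a + 1 = ((6 + a : ℤ) : ℝ) by push_cast; ring, Real.rpow_intCast]
    rw [h3, show (5 : ℝ) + a + 1 = 6 + a by ring]
    simp only [nsmul_eq_mul, smul_eq_mul]
    push_cast
    rw [one_div, inv_neg]
    ring
  rw [← hv, ofReal_integral_eq_lintegral_ofReal hi (Eventually.of_forall fun x => by positivity)]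

end

section

/-! ### Decay of Fourier integrals of symbols -/

/-- The character `k ↦ exp (-i k · z)`. -/
def chr (z k : E6) : ℂ := Complex.exp (-(inner ℝ k z : ℝ) * Complex.I)

lemma norm_chr (z k : E6) : ‖chr z k‖ = 1 := by
  rw [chr, ← Complex.ofReal_neg, Complex.norm_exp_ofReal_mul_I]

lemma continuous_chr (z : E6) : Continuous (chr z) := by
  unfold chr
  fun_prop

lemma chr_add_right (z k t : E6) : chr z (k + t) = chr z k * chr z t := by
  simp only [chr, ← Complex.exp_add, inner_add_left]
  push_cast; ring_nf

lemma Integrable.mul_chr {f : E6 → ℂ} (hf : Integrable f) (z : E6) :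
    Integrable fun k => f k * chr z k :=
  hf.mul_bdd (c := 1) (continuous_chr z).aestronglyMeasurable
    (Eventually.of_forall fun k => (norm_chr z k).le)

lemma integrable_fdiff_iterate {f : E6 → ℂ} (hf : Integrable f) (t : E6) (M : ℕ) :
    Integrable ((fdiff t)^[M] f) := by
  induction M generalizing f with
  | zero => simpa using hf
  | succ M ih =>
    rw [Function.iterate_succ, Function.comp_apply]
    exact ih ((hf.comp_add_right t).sub hf)

/-- Translation by `t` turns the character into its negative, so each difference multiplies the
integral by `-2`. This takes the place of integration by parts and needs only integrability of `f`.
-/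
lemma integral_fdiff_iterate_mul_chr {f : E6 → ℂ} (hf : Integrable f) {t z : E6}
    (ht : inner ℝ t z = Real.pi) (M : ℕ) :
    ∫ k, (fdiff t)^[M] f k * chr z k = (-2) ^ M * ∫ k, f k * chr z k := by
  have hone : ∀ g : E6 → ℂ, Integrable g →
      ∫ k, fdiff t g k * chr z k = (-2) * ∫ k, g k * chr z k := by
    intro g hg
    have hc : chr z t = -1 := by
      rw [chr, ht, neg_mul, Complex.exp_neg, Complex.exp_pi_mul_I]; norm_num
    have h1 : ∀ k, g (k + t) * chr z k = -(g (k + t) * chr z (k + t)) := by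
      intro k
      rw [chr_add_right, hc]; ring
    have h2 : ∫ k, g (k + t) * chr z k = -∫ k, g k * chr z k := by
      simp only [h1, integral_neg]
      rw [integral_add_right_eq_self (fun k => g k * chr z k) t]
    simp only [fdiff, sub_mul]
    rw [integral_sub (Integrable.mul_chr (hg.comp_add_right t) z) (Integrable.mul_chr hg z), h2]
    ring
  induction M with
  | zero => simp
  | succ M ih =>
    rw [Function.iterate_succ', Function.comp_apply, hone _ (integrable_fdiff_iterate hf t M), ih]
    ring

lemma zpow_le_zpow_of_nonpos_exp {x y : ℝ} (hx : 0 < x) (hxy : x ≤ y) {n : ℤ} (hn : n ≤ 0) :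
    y ^ n ≤ x ^ n := by
  obtain ⟨m, rfl⟩ : ∃ m : ℕ, n = -m := ⟨(-n).toNat, by omega⟩
  rw [zpow_neg, zpow_neg, zpow_natCast, zpow_natCast]
  exact inv_anti₀ (by positivity) (pow_le_pow_left₀ hx.le hxy m)

lemma ae_ne_zero_E6 : ∀ᵐ k : E6, k ≠ 0 := by
  have := Measure.ae_ne (volume : Measure E6) 0
  exact this

/-- Space is split at `|k| = 2Mτ`. Inside, the mass of `|k|^a` is of order `τ^(6+a)`, as `a > -6`.
Outside, the differences are at most of order `τ^M |k|^(a-M)`, integrable at infinity as `a - M <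
-6`, and the tail is again of order `τ^(6+a)`. -/
lemma lintegral_fdiff_iterate_le {f : E6 → ℂ} {a : ℤ} {M : ℕ} (ha : -6 < a) (haM : a - M < -6)
    (hf : Integrable f) (hs : Sym {0}ᶜ M a fun _ k => f k) : ∃ C : ℝ, 0 ≤ C ∧
    ∀ (v : E6) (τ : ℝ), ‖v‖ ≤ 1 → 0 < τ →
      ∫⁻ k, ‖(fdiff (τ • v))^[M] f k‖ₑ ≤ ENNReal.ofReal (C * τ ^ (6 + a)) := by
  obtain ⟨C0, hC0⟩ := hs.bound
  obtain ⟨C2, hC2⟩ := hs.iterate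
  obtain ⟨C1, hC1n, hC1⟩ := lintegral_ball_norm_zpow ha
  obtain ⟨C3, hC3n, hC3⟩ := lintegral_compl_ball_norm_zpow haM
  have hM : 0 < (M : ℝ) := by exact_mod_cast (by omega : (0 : ℤ) < M)
  refine ⟨2 ^ M * (|C0| * (C1 * (3 * M) ^ (6 + a))) +
    |C2| * ((1 / 2) ^ (a - M) * (C3 * (2 * M) ^ (6 + (a - M)))), by positivity,
    fun v τ hv hτ => ?_⟩
  have hnt : ‖τ • v‖ ≤ τ := by
    rw [norm_smul, Real.norm_of_nonneg hτ.le]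
    exact mul_le_of_le_one_right hτ.le hv
  have hnear : ∫⁻ k in Metric.ball 0 (2 * M * τ), ‖(fdiff (τ • v))^[M] f k‖ₑ
      ≤ ENNReal.ofReal (2 ^ M * (|C0| * (C1 * (3 * M) ^ (6 + a))) * τ ^ (6 + a)) := by
    calc _ ≤ 2 ^ M * ∫⁻ k in Metric.ball 0 (2 * M * τ + M * ‖τ • v‖), ‖f k‖ₑ :=
          lintegral_ball_fdiff_iterate_le _ _ _ hf.aestronglyMeasurable _
      _ ≤ 2 ^ M * ∫⁻ k in Metric.ball (0 : E6) (3 * M * τ),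
            ENNReal.ofReal |C0| * ENNReal.ofReal (‖k‖ ^ a) := by
          refine mul_le_mul' le_rfl ((lintegral_mono_set (Metric.ball_subset_ball ?_)).trans
            (lintegral_mono_ae ?_))
          · have := mul_le_mul_of_nonneg_left hnt hM.le
            linarith
          · filter_upwards [ae_restrict_of_ae ae_ne_zero_E6] with k hk
            rw [← ENNReal.ofReal_mul (abs_nonneg _), ← ofReal_norm]
            refine ENNReal.ofReal_le_ofReal ((hC0 0 (by simp) k hk).trans ?_)
            exact mul_le_mul_of_nonneg_right (le_abs_self _) (by positivity)
      _ ≤ 2 ^ M * (ENNReal.ofReal |C0| * ENNReal.ofReal (C1 * (3 * M * τ) ^ (6 + a))) := by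
          rw [lintegral_const_mul' _ _ ENNReal.ofReal_ne_top]
          gcongr
          exact hC1 _ (by positivity)
      _ = _ := by
          rw [← ENNReal.ofReal_mul (abs_nonneg _),
            show (2 : ℝ≥0∞) ^ M = ENNReal.ofReal (2 ^ M) by simp [ENNReal.ofReal_pow],
            ← ENNReal.ofReal_mul (by positivity), mul_zpow (3 * (M : ℝ)) τ]
          congr 1; ring
  have hfar : ∫⁻ k in (Metric.ball 0 (2 * M * τ))ᶜ, ‖(fdiff (τ • v))^[M] f k‖ₑ
      ≤ ENNReal.ofReal (|C2| * ((1 / 2) ^ (a - M) * (C3 * (2 * M) ^ (6 + (a - M)))) *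
        τ ^ (6 + a)) := by
    have hpt : ∀ k ∈ (Metric.ball (0 : E6) (2 * M * τ))ᶜ, ‖(fdiff (τ • v))^[M] f k‖ₑ ≤
        ENNReal.ofReal (τ ^ M * |C2| * (1 / 2) ^ (a - M)) * ENNReal.ofReal (‖k‖ ^ (a - M)) := by
      intro k hk
      have hk' : 2 * M * τ ≤ ‖k‖ := by simpa using hk
      have hkp : 0 < ‖k‖ := lt_of_lt_of_le (by positivity) hk'
      -- The segment has length at most `Mτ ≤ ‖k‖ / 2`, so it avoids the origin and the weight is
      -- comparable along it.
      have hlow : ∀ s ∈ Set.Icc 0 (M * τ), ‖k‖ / 2 ≤ ‖k + s • v‖ := by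
        intro s hs
        have h1 : ‖s • v‖ ≤ M * τ := by
          rw [norm_smul, Real.norm_of_nonneg hs.1]
          exact (mul_le_of_le_one_right hs.1 hv).trans hs.2
        have h2 := norm_sub_le (k + s • v) (s • v)
        rw [add_sub_cancel_right] at h2
        linarith
      rw [← ofReal_norm, ← ENNReal.ofReal_mul (by positivity)]
      apply ENNReal.ofReal_le_ofReal
      have := norm_fdiff_iterate_le hs hv hτ.le (k := k) (B := |C2| * (‖k‖ / 2) ^ (a - M))
        (fun s hs h => by
          have := hlow s hs
          rw [Set.mem_singleton_iff.1 h, norm_zero] at this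
          linarith)
        (fun s hs => by
          have h1 := hlow s hs
          have h2 : k + s • v ∈ ({0}ᶜ : Set E6) := fun h => by
            rw [Set.mem_singleton_iff.1 h, norm_zero] at h1
            linarith
          refine (hC2 v hv _ h2).trans (mul_le_mul (le_abs_self _) ?_ (by positivity) (abs_nonneg _))
          exact zpow_le_zpow_of_nonpos_exp (by positivity) h1 (by omega))
      refine this.trans (le_of_eq ?_)
      rw [div_eq_mul_one_div ‖k‖, mul_zpow]
      ring
    calc _ ≤ ∫⁻ k in (Metric.ball (0 : E6) (2 * M * τ))ᶜ,
          ENNReal.ofReal (τ ^ M * |C2| * (1 / 2) ^ (a - M)) * ENNReal.ofReal (‖k‖ ^ (a - M)) :=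
          setLIntegral_mono' Metric.isOpen_ball.measurableSet.compl hpt
      _ ≤ ENNReal.ofReal (τ ^ M * |C2| * (1 / 2) ^ (a - M)) *
          ENNReal.ofReal (C3 * (2 * M * τ) ^ (6 + (a - M))) := by
          rw [lintegral_const_mul' _ _ ENNReal.ofReal_ne_top]
          gcongr
          exact hC3 _ (by positivity)
      _ = _ := by
          rw [← ENNReal.ofReal_mul (by positivity), mul_zpow (2 * (M : ℝ)) τ]
          congr 1
          have : τ ^ M * τ ^ (6 + (a - M)) = τ ^ (6 + a) := by
            rw [← zpow_natCast, ← zpow_add₀ hτ.ne']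
            congr 1; ring
          rw [← this]; ring
  rw [← lintegral_add_compl _ (Metric.isOpen_ball (x := (0 : E6)) (ε := 2 * M * τ)).measurableSet,
    add_mul, ENNReal.ofReal_add (by positivity) (by positivity)]
  exact add_le_add hnear hfar

/-- The Fourier integral of an integrable symbol of degree `a` on `ℝ^6` is `O(|z| ^ (-6 - a))`. -/
lemma norm_integral_mul_chr_le {f : E6 → ℂ} {a : ℤ} {M : ℕ} (ha : -6 < a) (haM : a - M < -6)
    (hf : Integrable f) (hs : Sym {0}ᶜ M a fun _ k => f k) : ∃ C : ℝ, 0 ≤ C ∧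
    ∀ z : E6, z ≠ 0 → ‖∫ k, f k * chr z k‖ ≤ C * ‖z‖ ^ (-(6 + a)) := by
  obtain ⟨C, hC, h⟩ := lintegral_fdiff_iterate_le ha haM hf hs
  refine ⟨C * Real.pi ^ (6 + a), by positivity, fun z hz => ?_⟩
  have hz' : 0 < ‖z‖ := norm_pos_iff.2 hz
  -- With `v` the unit vector of `z`, the translation `τ • v` has inner product `π` with `z`.
  set τ := Real.pi / ‖z‖ with hτ
  have hτp : 0 < τ := div_pos Real.pi_pos hz'
  set v := ‖z‖⁻¹ • z with hv
  have hv1 : ‖v‖ ≤ 1 := by rw [hv, norm_smul, norm_inv, norm_norm, inv_mul_cancel₀ hz'.ne']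
  have hin : inner ℝ (τ • v) z = Real.pi := by
    rw [hv, inner_smul_left, inner_smul_left, real_inner_self_eq_norm_sq]
    simp only [hτ, conj_trivial]
    field_simp
  have h1 := integral_fdiff_iterate_mul_chr hf hin M
  have h2 : ‖∫ k, (fdiff (τ • v))^[M] f k * chr z k‖ ≤ C * τ ^ (6 + a) := by
    rw [← ENNReal.ofReal_le_ofReal_iff (by positivity), ofReal_norm]
    refine (enorm_integral_le_lintegral_enorm _).trans (le_trans (le_of_eq ?_) (h v τ hv1 hτp))
    refine lintegral_congr fun k => ?_
    rw [enorm_mul, ← ofReal_norm (chr z k), norm_chr]; simp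
  rw [h1, norm_mul, norm_pow, norm_neg] at h2
  have h3 : (1 : ℝ) ≤ ‖(2 : ℂ)‖ ^ M := one_le_pow₀ (by norm_num)
  calc ‖∫ k, f k * chr z k‖ ≤ ‖(2 : ℂ)‖ ^ M * ‖∫ k, f k * chr z k‖ :=
        le_mul_of_one_le_left (norm_nonneg _) h3
    _ ≤ C * τ ^ (6 + a) := h2
    _ = _ := by rw [hτ, div_zpow, zpow_neg]; ring

end

section

/-! ### Taylor remainders of the characteristic function -/

/-- The Taylor remainder of order `n` of `y ↦ exp (i y)`. -/
def expRem (n : ℕ) (y : ℝ) : ℂ :=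
  Complex.exp (y * Complex.I) - ∑ j ∈ Finset.range n, (y * Complex.I) ^ j / (j.factorial : ℂ)

/-- The truncated subtraction is right at `n = 0`: the remainder of order 0 is the exponential
itself. -/
lemma hasDerivAt_expRem (n : ℕ) (y : ℝ) :
    HasDerivAt (expRem n) (Complex.I * expRem (n - 1) y) y := by
  have hlin : HasDerivAt (fun y : ℝ => (y : ℂ) * Complex.I) Complex.I y := by
    simpa using (Complex.ofRealCLM.hasDerivAt (x := y)).mul_const Complex.I
  have hexp := hlin.cexp
  have hpow : HasDerivAt
      (fun y : ℝ => ∑ j ∈ Finset.range n, ((y : ℂ) * Complex.I) ^ j / (j.factorial : ℂ))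
      (∑ j ∈ Finset.range n, (j * ((y : ℂ) * Complex.I) ^ (j - 1) * Complex.I) / (j.factorial : ℂ))
      y :=
    HasDerivAt.fun_sum fun j _ => (hlin.pow j).div_const _
  refine (hexp.sub hpow).congr_deriv ?_
  rw [expRem, mul_sub, mul_comm]
  congr 1
  cases n with
  | zero => simp
  | succ n =>
    rw [Finset.sum_range_succ', Finset.mul_sum]
    simp only [Nat.cast_zero, zero_mul, zero_div, add_zero, Nat.add_sub_cancel]
    refine Finset.sum_congr rfl fun j _ => ?_
    rw [Nat.factorial_succ]
    have h1 : (j.factorial : ℂ) ≠ 0 := by exact_mod_cast j.factorial_ne_zero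
    have h2 : ((j : ℂ) + 1) ≠ 0 := by exact_mod_cast Nat.succ_ne_zero j
    push_cast
    field_simp

lemma norm_expRem_le (n : ℕ) (y : ℝ) : ‖expRem n y‖ ≤ |y| ^ n := by
  induction n generalizing y with
  | zero => simp [expRem, Complex.norm_exp_ofReal_mul_I]
  | succ n ih =>
    have h0 : expRem (n + 1) 0 = 0 := by
      rw [expRem, Finset.sum_range_succ']
      simp
    have := (convex_uIcc (0 : ℝ) y).norm_image_sub_le_of_norm_hasDerivWithin_le (C := |y| ^ n)
      (fun t _ => (hasDerivAt_expRem (n + 1) t).hasDerivWithinAt) (fun t ht => ?_)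
      Set.left_mem_uIcc Set.right_mem_uIcc
    · rw [h0, sub_zero, sub_zero, Real.norm_eq_abs] at this
      rwa [pow_succ]
    · rw [norm_mul, Complex.norm_I, one_mul, Nat.add_sub_cancel]
      refine (ih t).trans (pow_le_pow_left₀ (abs_nonneg _) ?_ n)
      have := Set.abs_sub_left_of_mem_uIcc ht
      simpa using this

/-- The characteristic function of a law on `ℤ^6`. -/
def charfn (ν : PMF (Fin 6 → ℤ)) (k : E6) : ℂ :=
  ∫ x, Complex.exp ((inner ℝ k (toE x) : ℝ) * Complex.I) ∂ν.toMeasure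

/-- The expectation of `(i v · x) ^ j` times the Taylor remainder of `exp (i k · x)`. -/
def charRem (ν : PMF (Fin 6 → ℤ)) (n j : ℕ) (v k : E6) : ℂ :=
  ∫ x, (Complex.I * (inner ℝ v (toE x) : ℝ)) ^ j * expRem n (inner ℝ k (toE x)) ∂ν.toMeasure

/-- Finite sixth moment. -/
def SixthMoment (ν : PMF (Fin 6 → ℤ)) : Prop :=
  Integrable (fun x => ‖toE x‖ ^ 6) ν.toMeasure

variable {ν : PMF (Fin 6 → ℤ)}

lemma aesm_of_countable {F : Type*} [NormedAddCommGroup F] [MeasurableSpace F] [BorelSpace F]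
    [SecondCountableTopology F] (f : (Fin 6 → ℤ) → F) : AEStronglyMeasurable f ν.toMeasure :=
  (measurable_of_countable f).aestronglyMeasurable

lemma SixthMoment.pow (h : SixthMoment ν) {p : ℕ} (hp : p ≤ 6) :
    Integrable (fun x => ‖toE x‖ ^ p) ν.toMeasure := by
  refine (h.add (integrable_const 1)).mono' (aesm_of_countable _) (Eventually.of_forall fun x => ?_)
  have h0 := norm_nonneg (toE x)
  simp only [Pi.add_apply, norm_pow, norm_norm]
  rcases le_total ‖toE x‖ 1 with h1 | h1
  · have := pow_le_one₀ (n := p) h0 h1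
    have : 0 ≤ ‖toE x‖ ^ 6 := by positivity
    linarith
  · have := pow_le_pow_right₀ h1 hp
    linarith

lemma norm_charRem_integrand_le (n j : ℕ) {v : E6} (hv : ‖v‖ ≤ 1) (k : E6) (x : Fin 6 → ℤ) :
    ‖(Complex.I * (inner ℝ v (toE x) : ℝ)) ^ j * expRem n (inner ℝ k (toE x))‖
      ≤ ‖k‖ ^ n * ‖toE x‖ ^ (j + n) := by
  have h1 : |inner ℝ v (toE x)| ≤ ‖toE x‖ :=
    (abs_real_inner_le_norm _ _).trans (mul_le_of_le_one_left (norm_nonneg _) hv)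
  have h2 := abs_real_inner_le_norm k (toE x)
  rw [norm_mul, norm_pow, norm_mul, Complex.norm_I, one_mul, Complex.norm_real, Real.norm_eq_abs]
  calc _ ≤ ‖toE x‖ ^ j * (‖k‖ * ‖toE x‖) ^ n := by
        gcongr
        exact (norm_expRem_le n _).trans (pow_le_pow_left₀ (abs_nonneg _) h2 n)
    _ = _ := by rw [mul_pow, pow_add]; ring

lemma integrable_charRem (h : SixthMoment ν) {n j : ℕ} (hnj : j + n ≤ 6) {v : E6} (hv : ‖v‖ ≤ 1)
    (k : E6) : Integrable (fun x => (Complex.I * (inner ℝ v (toE x) : ℝ)) ^ j *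
      expRem n (inner ℝ k (toE x))) ν.toMeasure :=
  ((h.pow hnj).const_mul (‖k‖ ^ n)).mono' (aesm_of_countable _)
    (Eventually.of_forall fun x => norm_charRem_integrand_le n j hv k x)

lemma norm_charRem_le (h : SixthMoment ν) {n j : ℕ} (hnj : j + n ≤ 6) {v : E6} (hv : ‖v‖ ≤ 1)
    (k : E6) : ‖charRem ν n j v k‖ ≤ (∫ x, ‖toE x‖ ^ (j + n) ∂ν.toMeasure) * ‖k‖ ^ n := by
  rw [mul_comm, ← integral_const_mul]
  exact norm_integral_le_of_norm_le ((h.pow hnj).const_mul _)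
    (Eventually.of_forall fun x => norm_charRem_integrand_le n j hv k x)

lemma hasDerivAt_charRem_integrand (n j : ℕ) (v k w : E6) (s : ℝ) :
    HasDerivAt (fun s : ℝ => (Complex.I * (inner ℝ v w : ℝ)) ^ j * expRem n (inner ℝ (k + s • v) w))
      ((Complex.I * (inner ℝ v w : ℝ)) ^ (j + 1) * expRem (n - 1) (inner ℝ (k + s • v) w)) s := by
  have hin : HasDerivAt (fun s : ℝ => inner ℝ (k + s • v) w) (inner ℝ v w) s := by
    have h1 : (fun s : ℝ => inner ℝ (k + s • v) w) = fun s => inner ℝ k w + s * inner ℝ v w := by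
      funext s
      rw [inner_add_left, real_inner_smul_left]
    rw [h1]
    simpa using ((hasDerivAt_id s).mul_const (inner ℝ v w)).const_add (inner ℝ k w)
  have h1 := ((hasDerivAt_expRem n _).scomp s hin).const_mul ((Complex.I * (inner ℝ v w : ℝ)) ^ j)
  refine h1.congr_deriv ?_
  rw [Complex.real_smul, pow_succ]
  ring

/-- The family `charRem` is closed under differentiation: the order of the remainder drops and one
more factor `i v · x` appears. The two bounds by 6 give `(j + 1) + (n - 1) ≤ 6` also when `n = 0`,
so the sixth moment dominates. -/
lemma hasDerivAt_charRem (h : SixthMoment ν) {n j : ℕ} (hnj : j + n ≤ 6) (hj : j + 1 ≤ 6)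
    {v : E6} (hv : ‖v‖ ≤ 1) (k : E6) :
    HasDerivAt (fun s : ℝ => charRem ν n j v (k + s • v)) (charRem ν (n - 1) (j + 1) v k) 0 := by
  have hnj' : j + 1 + (n - 1) ≤ 6 := by omega
  set F : ℝ → (Fin 6 → ℤ) → ℂ := fun s x => (Complex.I * (inner ℝ v (toE x) : ℝ)) ^ j *
    expRem n (inner ℝ (k + s • v) (toE x)) with hF
  set F' : ℝ → (Fin 6 → ℤ) → ℂ := fun s x => (Complex.I * (inner ℝ v (toE x) : ℝ)) ^ (j + 1) *
    expRem (n - 1) (inner ℝ (k + s • v) (toE x)) with hF'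
  have hint : Integrable (F 0) ν.toMeasure := integrable_charRem h hnj hv _
  have hbound : ∀ x, ∀ s ∈ Metric.ball (0 : ℝ) 1,
      ‖F' s x‖ ≤ (‖k‖ + 1) ^ (n - 1) * ‖toE x‖ ^ (j + 1 + (n - 1)) := by
    intro x s hs
    refine (norm_charRem_integrand_le _ _ hv _ x).trans ?_
    have h1 : ‖k + s • v‖ ≤ ‖k‖ + 1 := by
      refine (norm_add_le _ _).trans ?_
      have h2 : ‖s‖ ≤ 1 := by simpa using (Metric.mem_ball.1 hs).le
      have h3 : ‖s • v‖ ≤ 1 := by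
        rw [norm_smul]
        exact mul_le_one₀ h2 (norm_nonneg _) hv
      linarith
    exact mul_le_mul_of_nonneg_right (pow_le_pow_left₀ (norm_nonneg _) h1 _) (by positivity)
  have hder : ∀ x, ∀ s ∈ Metric.ball (0 : ℝ) 1, HasDerivAt (F · x) (F' s x) s := fun x s _ =>
    hasDerivAt_charRem_integrand n j v k (toE x) s
  have key := (hasDerivAt_integral_of_dominated_loc_of_deriv_le
    (Metric.ball_mem_nhds (0 : ℝ) one_pos) (Eventually.of_forall fun s => aesm_of_countable (F s))
    hint (aesm_of_countable (F' 0)) (Eventually.of_forall hbound) ((h.pow hnj').const_mul _)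
    (Eventually.of_forall hder)).2
  have e : charRem ν (n - 1) (j + 1) v k = ∫ x, F' 0 x ∂ν.toMeasure := by
    rw [hF', charRem]
    simp only [zero_smul, add_zero]
  rw [e]
  exact key

section

variable {U : Set E6} {R : ℝ}

lemma zpow_le_mul_zpow_of_le {r R : ℝ} (hr : 0 < r) (hrR : r ≤ R) {a b : ℤ} (hab : b ≤ a) :
    r ^ a ≤ R ^ (a - b) * r ^ b := by
  have : r ^ a = r ^ (a - b) * r ^ b := by rw [← zpow_add₀ hr.ne']; congr 1; ring
  rw [this]
  obtain ⟨n, hn⟩ : ∃ n : ℕ, a - b = n := ⟨(a - b).toNat, by omega⟩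
  rw [hn, zpow_natCast, zpow_natCast]
  gcongr

lemma Sym.of_le_of_bounded {M : ℕ} {a b : ℤ} {f : E6 → E6 → ℂ} (h0 : (0 : E6) ∉ U)
    (hR : ∀ k ∈ U, ‖k‖ ≤ R) (hab : b ≤ a) (h : Sym U M a f) : Sym U M b f :=
  h.of_weight_le h0 (c := R ^ (a - b)) fun k hk => zpow_le_mul_zpow_of_le
    (norm_pos_iff.2 fun h => h0 (h ▸ hk)) (hR k hk) hab

/-- A sixth moment allows six derivatives in total. After `n` of them the remainder has order 0 and
is merely bounded, while the required degree keeps falling; on a bounded set a lower power of `|k|`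
is a weaker requirement, so nothing is lost. -/
lemma sym_charRem (hU : IsOpen U) (h0 : (0 : E6) ∉ U) (hR : ∀ k ∈ U, ‖k‖ ≤ R)
    (h : SixthMoment ν) {M n j : ℕ} {a : ℤ} (hnj : j + n ≤ 6) (hM : j + M ≤ 6) (ha : a ≤ n) :
    Sym U M a (charRem ν n j) := by
  have hb : ∀ {n j : ℕ} {a : ℤ}, j + n ≤ 6 → a ≤ n → SymBound U a (charRem ν n j) := by
    intro n j a hnj ha
    have : Sym U 0 n (charRem ν n j) := by
      refine ⟨∫ x, ‖toE x‖ ^ (j + n) ∂ν.toMeasure, fun v hv k hk => ?_⟩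
      rw [zpow_natCast]
      exact norm_charRem_le h hnj hv k
    exact this.of_le_of_bounded h0 hR ha
  induction M generalizing n j a with
  | zero => exact hb hnj ha
  | succ M ih =>
    exact Sym.intro hU (hb hnj ha) (fun v hv k hk => hasDerivAt_charRem h hnj (by omega) hv k)
      (ih (by omega) (by omega) (by omega))

end

end

section

/-! ### The covariance form -/

/-- The second moment form `k ↦ E (k · X) ^ 2`. -/
def covQ (ν : PMF (Fin 6 → ℤ)) (k : E6) : ℝ := ∫ x, inner ℝ k (toE x) ^ 2 ∂ν.toMeasure

/-- The polarisation of `covQ`. -/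
def covB (ν : PMF (Fin 6 → ℤ)) (v k : E6) : ℝ :=
  ∫ x, inner ℝ v (toE x) * inner ℝ k (toE x) ∂ν.toMeasure

variable {ν : PMF (Fin 6 → ℤ)}

lemma integrable_inner_mul_inner (h : SixthMoment ν) (v k : E6) :
    Integrable (fun x => inner ℝ v (toE x) * inner ℝ k (toE x)) ν.toMeasure := by
  refine ((h.pow (p := 2) (by norm_num)).const_mul (‖v‖ * ‖k‖)).mono' (aesm_of_countable _)
    (Eventually.of_forall fun x => ?_)
  rw [norm_mul]
  calc _ ≤ (‖v‖ * ‖toE x‖) * (‖k‖ * ‖toE x‖) :=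
        mul_le_mul (norm_inner_le_norm _ _) (norm_inner_le_norm _ _) (norm_nonneg _) (by positivity)
    _ = _ := by ring

lemma integrable_inner_sq (h : SixthMoment ν) (k : E6) :
    Integrable (fun x => inner ℝ k (toE x) ^ 2) ν.toMeasure := by
  have := integrable_inner_mul_inner h k k
  simpa only [← sq] using this

lemma integrable_inner (h : SixthMoment ν) (v : E6) :
    Integrable (fun x => inner ℝ v (toE x)) ν.toMeasure := by
  refine ((h.pow (p := 1) (by norm_num)).const_mul ‖v‖).mono' (aesm_of_countable _)
    (Eventually.of_forall fun x => ?_)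
  rw [pow_one]
  exact norm_inner_le_norm _ _

lemma covB_self (v : E6) : covB ν v v = covQ ν v := by simp [covB, covQ, sq]

lemma covB_add_smul (h : SixthMoment ν) (v k : E6) (s : ℝ) :
    covB ν v (k + s • v) = covB ν v k + s * covQ ν v := by
  rw [← covB_self]
  simp only [covB]
  rw [← integral_const_mul, ← integral_add (integrable_inner_mul_inner h v k)
    ((integrable_inner_mul_inner h v v).const_mul s)]
  refine integral_congr_ae (Eventually.of_forall fun x => ?_)
  simp only [inner_add_left, real_inner_smul_left]
  ring

lemma covQ_add_smul (h : SixthMoment ν) (v k : E6) (s : ℝ) :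
    covQ ν (k + s • v) = covQ ν k + s * (2 * covB ν v k) + s ^ 2 * covQ ν v := by
  have h1 := integrable_inner_sq h k
  have h2 := (integrable_inner_mul_inner h v k).const_mul (s * 2)
  have h3 := (integrable_inner_sq h v).const_mul (s ^ 2)
  have h12 : Integrable (fun x => inner ℝ k (toE x) ^ 2 +
      s * 2 * (inner ℝ v (toE x) * inner ℝ k (toE x))) ν.toMeasure := h1.add h2
  simp only [covB, covQ]
  rw [← mul_assoc, ← integral_const_mul, ← integral_const_mul, ← integral_add h1 h2,
    ← integral_add h12 h3]
  refine integral_congr_ae (Eventually.of_forall fun x => ?_)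
  simp only [inner_add_left, real_inner_smul_left]
  ring

lemma covQ_smul (s : ℝ) (v : E6) : covQ ν (s • v) = s ^ 2 * covQ ν v := by
  simp only [covQ]
  rw [← integral_const_mul]
  refine integral_congr_ae (Eventually.of_forall fun x => ?_)
  simp only [real_inner_smul_left]
  ring

lemma covQ_nonneg (v : E6) : 0 ≤ covQ ν v := integral_nonneg fun _ => sq_nonneg _

lemma abs_covB_le (h : SixthMoment ν) (v k : E6) :
    |covB ν v k| ≤ (∫ x, ‖toE x‖ ^ 2 ∂ν.toMeasure) * (‖v‖ * ‖k‖) := by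
  rw [mul_comm, ← integral_const_mul, ← Real.norm_eq_abs]
  refine norm_integral_le_of_norm_le ((h.pow (p := 2) (by norm_num)).const_mul _)
    (Eventually.of_forall fun x => ?_)
  rw [norm_mul]
  calc _ ≤ (‖v‖ * ‖toE x‖) * (‖k‖ * ‖toE x‖) :=
        mul_le_mul (norm_inner_le_norm _ _) (norm_inner_le_norm _ _) (norm_nonneg _) (by positivity)
    _ = _ := by ring

lemma covQ_le (h : SixthMoment ν) (k : E6) :
    covQ ν k ≤ (∫ x, ‖toE x‖ ^ 2 ∂ν.toMeasure) * ‖k‖ ^ 2 := by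
  have := abs_covB_le h k k
  rw [covB_self] at this
  rw [sq]
  exact (le_abs_self _).trans this

lemma continuous_covQ (h : SixthMoment ν) : Continuous (covQ ν) := by
  rw [continuous_iff_continuousAt]
  intro k
  have hc : Tendsto (fun k' : E6 => covQ ν k + 2 * ((∫ x, ‖toE x‖ ^ 2 ∂ν.toMeasure) *
      (‖k' - k‖ * ‖k‖)) + (∫ x, ‖toE x‖ ^ 2 ∂ν.toMeasure) * ‖k' - k‖ ^ 2) (𝓝 k) (𝓝 (covQ ν k)) := by
    have : Continuous fun k' : E6 => covQ ν k + 2 * ((∫ x, ‖toE x‖ ^ 2 ∂ν.toMeasure) *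
      (‖k' - k‖ * ‖k‖)) + (∫ x, ‖toE x‖ ^ 2 ∂ν.toMeasure) * ‖k' - k‖ ^ 2 := by fun_prop
    simpa using this.tendsto k
  have hc' : Tendsto (fun k' : E6 => covQ ν k - 2 * ((∫ x, ‖toE x‖ ^ 2 ∂ν.toMeasure) *
      (‖k' - k‖ * ‖k‖))) (𝓝 k) (𝓝 (covQ ν k)) := by
    have : Continuous fun k' : E6 => covQ ν k - 2 * ((∫ x, ‖toE x‖ ^ 2 ∂ν.toMeasure) *
      (‖k' - k‖ * ‖k‖)) := by fun_prop
    simpa using this.tendsto k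
  have e : ∀ k', covQ ν k' = covQ ν k + 2 * covB ν (k' - k) k + covQ ν (k' - k) := fun k' => by
    have := covQ_add_smul h (k' - k) k 1
    simpa using this
  refine tendsto_of_tendsto_of_tendsto_of_le_of_le hc' hc (fun k' => ?_) (fun k' => ?_)
  · have h1 := abs_le.1 (abs_covB_le h (k' - k) k)
    have h2 := covQ_nonneg (ν := ν) (k' - k)
    simp only [e k']
    linarith [h1.1]
  · have h1 := abs_le.1 (abs_covB_le h (k' - k) k)
    have h2 := covQ_le h (k' - k)
    simp only [e k']
    linarith [h1.2]

lemma sym_zero {U : Set E6} (hU : IsOpen U) (M : ℕ) (a : ℤ) :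
    Sym U M a fun _ _ => (0 : ℂ) := by
  have hb : ∀ a : ℤ, SymBound U a fun _ _ => (0 : ℂ) := fun a => ⟨0, by simp⟩
  induction M generalizing a with
  | zero => exact hb a
  | succ M ih =>
    exact Sym.intro hU (hb a) (f' := fun _ _ => 0) (fun v _ k _ => hasDerivAt_const _ _) (ih _)

lemma sym_const {U : Set E6} (hU : IsOpen U) (M : ℕ) (c : ℂ) : Sym U M 0 fun _ _ => c := by
  cases M with
  | zero => exact ⟨‖c‖, by simp⟩
  | succ M =>
    exact Sym.intro hU ⟨‖c‖, by simp⟩ (fun v _ k _ => hasDerivAt_const _ _) (sym_zero hU M _)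

/-- The successive derivatives along `v` are `2 B(v, k)`, `2 Q(v)` and `0`, of degrees 1 and 0 and
of every degree. -/
lemma sym_covQ {U : Set E6} (hU : IsOpen U) (h : SixthMoment ν) (M : ℕ) :
    Sym U M 2 fun _ k => (covQ ν k : ℂ) := by
  set C := ∫ x, ‖toE x‖ ^ 2 ∂ν.toMeasure with hC
  have hC0 : 0 ≤ C := integral_nonneg fun x => by positivity
  have hlin : ∀ a b : ℝ, HasDerivAt (fun s : ℝ => ((a + s * b : ℝ) : ℂ)) b 0 := fun a b => by
    have : HasDerivAt (fun s : ℝ => a + s * b) b 0 := by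
      simpa using ((hasDerivAt_id (0 : ℝ)).mul_const b).const_add a
    exact this.ofReal_comp
  have h2 : Sym U (M + 1) 0 fun v _ => ((2 * covQ ν v : ℝ) : ℂ) := by
    refine Sym.intro hU ⟨2 * C, fun v hv k _ => ?_⟩ (f' := fun _ _ => 0)
      (fun v _ k _ => hasDerivAt_const _ _) (sym_zero hU M _)
    rw [Complex.norm_real, zpow_zero, mul_one, Real.norm_of_nonneg (by
      have := covQ_nonneg (ν := ν) v; positivity)]
    have h1 := covQ_le h v
    have h2 : C * ‖v‖ ^ 2 ≤ C * 1 := by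
      gcongr
      exact pow_le_one₀ (norm_nonneg _) hv
    linarith
  have h1 : Sym U (M + 1 + 1) 1 fun v k => ((2 * covB ν v k : ℝ) : ℂ) := by
    refine Sym.intro hU ⟨2 * C, fun v hv k _ => ?_⟩ (f' := fun v _ => ((2 * covQ ν v : ℝ) : ℂ))
      (fun v _ k _ => ?_) h2
    · rw [Complex.norm_real, zpow_one, norm_mul, Real.norm_eq_abs, Real.norm_eq_abs, abs_two,
        mul_assoc]
      refine mul_le_mul_of_nonneg_left ((abs_covB_le h v k).trans ?_) zero_le_two
      gcongr
      exact mul_le_of_le_one_left (norm_nonneg _) hv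
    · convert hlin (2 * covB ν v k) (2 * covQ ν v) using 1
      funext s
      rw [covB_add_smul h]
      congr 1; ring
  have h0 : Sym U (M + 1 + 1 + 1) 2 fun _ k => (covQ ν k : ℂ) := by
    refine Sym.intro hU ⟨C, fun v _ k _ => ?_⟩ (f' := fun v k => ((2 * covB ν v k : ℝ) : ℂ))
      (fun v _ k _ => ?_) h1
    · rw [Complex.norm_real, Real.norm_of_nonneg (covQ_nonneg _)]
      exact_mod_cast covQ_le h k
    · have hq : HasDerivAt (fun s : ℝ => covQ ν k + s * (2 * covB ν v k) + s ^ 2 * covQ ν v)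
          (2 * covB ν v k) 0 := by
        have a1 := ((hasDerivAt_id (0 : ℝ)).mul_const (2 * covB ν v k)).const_add (covQ ν k)
        have a2 := ((hasDerivAt_id (0 : ℝ)).pow 2).mul_const (covQ ν v)
        refine (a1.add a2).congr_deriv ?_
        simp
      simp only [covQ_add_smul h]
      exact hq.ofReal_comp
  exact h0.of_succ.of_succ.of_succ

/-! ### Irreducibility -/

lemma walkLaw_mem_of_add_mem {d : ℕ} {ν : PMF (Fin d → ℤ)} {S : Set (Fin d → ℤ)} (h0 : 0 ∈ S)
    (hadd : ∀ x ∈ S, ∀ y, ν y ≠ 0 → x + y ∈ S) (n : ℕ) {x : Fin d → ℤ} (hx : walkLaw ν n x ≠ 0) :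
    x ∈ S := by
  classical
  induction n generalizing x with
  | zero =>
    rw [walkLaw, PMF.pure_apply] at hx
    have : x = 0 := by by_contra h; simp [h] at hx
    rwa [this]
  | succ n ih =>
    rw [walkLaw, ← PMF.mem_support_iff, PMF.mem_support_bind_iff] at hx
    obtain ⟨y, hy, hxy⟩ := hx
    rw [PMF.mem_support_map_iff] at hxy
    obtain ⟨w, hw, rfl⟩ := hxy
    exact hadd y (ih hy) w hw

/-- The form in which irreducibility is used: a set that contains `0` and is stable under the steps
charged by `ν` is the whole lattice. -/
lemma WalkIrreducible.mem {d : ℕ} {ν : PMF (Fin d → ℤ)} (hirr : WalkIrreducible ν)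
    {S : Set (Fin d → ℤ)} (h0 : 0 ∈ S) (hadd : ∀ x ∈ S, ∀ y, ν y ≠ 0 → x + y ∈ S)
    (x : Fin d → ℤ) : x ∈ S := by
  obtain ⟨n, hn⟩ := hirr x
  exact walkLaw_mem_of_add_mem h0 hadd n hn.ne'

lemma of_ae_toMeasure {d : ℕ} {ν : PMF (Fin d → ℤ)} {p : (Fin d → ℤ) → Prop}
    (h : ∀ᵐ x ∂ν.toMeasure, p x) {x : Fin d → ℤ} (hx : ν x ≠ 0) : p x := by
  by_contra hp
  apply hx
  rw [← PMF.toMeasure_apply_singleton ν x (measurableSet_singleton x)]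
  exact measure_mono_null (by simpa using hp) (ae_iff.1 h)

lemma inner_toE_single (k : E6) (i : Fin 6) : inner ℝ k (toE (Pi.single i 1)) = k i := by
  have : toE (Pi.single i (1 : ℤ) : Fin 6 → ℤ) = EuclideanSpace.single i (1 : ℝ) := by
    ext j
    by_cases hj : j = i
    · subst hj; simp [toE]
    · simp [toE, hj]
  rw [this, EuclideanSpace.inner_single_right]
  simp

/-- If the form vanished at `k`, all steps would be orthogonal to `k`, hence so would every lattice
point, including the basis vectors. -/
lemma covQ_pos (h : SixthMoment ν) (hirr : WalkIrreducible ν) {k : E6} (hk : k ≠ 0) :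
    0 < covQ ν k := by
  refine lt_of_le_of_ne (covQ_nonneg k) fun h0 => hk ?_
  have h1 : ∀ᵐ x ∂ν.toMeasure, inner ℝ k (toE x) ^ 2 = 0 := by
    exact (integral_eq_zero_iff_of_nonneg (fun x => sq_nonneg _) (integrable_inner_sq h k)).1 h0.symm
  have h2 := hirr.mem (S := {x | inner ℝ k (toE x) = 0}) (by simp [toE_zero])
    (fun x hx y hy => by
      have := of_ae_toMeasure h1 hy
      simp only [Set.mem_ofPred_eq] at *
      rw [toE_add, inner_add_right, hx, zero_add]
      exact pow_eq_zero_iff (two_ne_zero) |>.1 this)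
  ext i
  rw [← inner_toE_single]
  exact h2 _

lemma exists_covQ_ge (h : SixthMoment ν) (hirr : WalkIrreducible ν) :
    ∃ c : ℝ, 0 < c ∧ ∀ k, c * ‖k‖ ^ 2 ≤ covQ ν k := by
  obtain ⟨k0, hk0, hmin⟩ := (isCompact_sphere (0 : E6) 1).exists_isMinOn
    (NormedSpace.sphere_nonempty.2 zero_le_one) (continuous_covQ h).continuousOn
  have hk0' : k0 ≠ 0 := by
    rintro rfl
    simp at hk0
  refine ⟨covQ ν k0, covQ_pos h hirr hk0', fun k => ?_⟩
  rcases eq_or_ne k 0 with rfl | hk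
  · simpa using covQ_nonneg _
  have hk' : 0 < ‖k‖ := norm_pos_iff.2 hk
  have h1 : covQ ν k0 ≤ covQ ν (‖k‖⁻¹ • k) := hmin (by
    simp [norm_smul, hk'.ne'])
  rw [covQ_smul] at h1
  calc covQ ν k0 * ‖k‖ ^ 2 ≤ ‖k‖⁻¹ ^ 2 * covQ ν k * ‖k‖ ^ 2 := by gcongr
    _ = _ := by field_simp

/-! ### The characteristic function near and away from the origin -/

/-- The law has mean `0`. -/
def MeanZero (ν : PMF (Fin 6 → ℤ)) : Prop := ∀ i : Fin 6, ∫ x : Fin 6 → ℤ, (x i : ℝ) ∂ν.toMeasure = 0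

lemma integrable_coord (h : SixthMoment ν) (i : Fin 6) :
    Integrable (fun x : Fin 6 → ℤ => (x i : ℝ)) ν.toMeasure := by
  refine (h.pow (p := 1) (by norm_num)).mono' (aesm_of_countable _)
    (Eventually.of_forall fun x => ?_)
  rw [pow_one]
  exact PiLp.norm_apply_le (toE x) i

lemma inner_toE (k : E6) (x : Fin 6 → ℤ) : inner ℝ k (toE x) = ∑ i, k i * (x i : ℝ) := by
  rw [EuclideanSpace.inner_eq_star_dotProduct]
  simp [toE, dotProduct, mul_comm]

lemma integral_inner (h : SixthMoment ν) (h0 : MeanZero ν) (k : E6) :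
    ∫ x, inner ℝ k (toE x) ∂ν.toMeasure = 0 := by
  simp only [inner_toE]
  rw [integral_finsetSum _ fun i _ => (integrable_coord h i).const_mul _]
  simp [integral_const_mul, h0 _]

lemma integrable_exp_inner (k : E6) :
    Integrable (fun x => Complex.exp ((inner ℝ k (toE x) : ℝ) * Complex.I)) ν.toMeasure :=
  (integrable_const (1 : ℝ)).mono' (aesm_of_countable _)
    (Eventually.of_forall fun _ => (Complex.norm_exp_ofReal_mul_I _).le)

lemma charRem_two (h : SixthMoment ν) (h0 : MeanZero ν) (v k : E6) :
    charRem ν 2 0 v k = charfn ν k - 1 := by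
  have e : ∀ x : Fin 6 → ℤ, (Complex.I * (inner ℝ v (toE x) : ℝ)) ^ 0 *
      expRem 2 (inner ℝ k (toE x)) = Complex.exp ((inner ℝ k (toE x) : ℝ) * Complex.I) -
        (1 + (inner ℝ k (toE x) : ℝ) * Complex.I) := by
    intro x
    simp [expRem, Finset.sum_range_succ]
  have hi : Integrable (fun x => ((inner ℝ k (toE x) : ℝ) : ℂ) * Complex.I) ν.toMeasure :=
    (integrable_inner h k).ofReal.mul_const _
  have hi1 : Integrable (fun x => (1 : ℂ) + (inner ℝ k (toE x) : ℝ) * Complex.I) ν.toMeasure :=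
    (integrable_const _).add hi
  rw [charRem, integral_congr_ae (Eventually.of_forall e),
    integral_sub (integrable_exp_inner k) hi1,
    integral_add (integrable_const _) hi, integral_mul_const, integral_complex_ofReal,
    integral_inner h h0]
  simp [charfn]

/-- Identifies the error of the Gaussian approximation of `φ` with a third-order Taylor remainder,
the linear term being removed by the zero mean. This makes the error a symbol of degree 3. -/
lemma charRem_three (h : SixthMoment ν) (h0 : MeanZero ν) (v k : E6) :
    charRem ν 3 0 v k = charfn ν k - 1 + (covQ ν k : ℂ) / 2 := by
  have e : ∀ x : Fin 6 → ℤ, (Complex.I * (inner ℝ v (toE x) : ℝ)) ^ 0 *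
      expRem 3 (inner ℝ k (toE x)) = (Complex.I * (inner ℝ v (toE x) : ℝ)) ^ 0 *
      expRem 2 (inner ℝ k (toE x)) + ((inner ℝ k (toE x) ^ 2 : ℝ) : ℂ) / 2 := by
    intro x
    simp only [expRem, Finset.sum_range_succ, Finset.range_zero, Finset.sum_empty]
    simp only [mul_pow, Complex.I_sq, Nat.factorial]
    push_cast
    ring
  have hi : Integrable (fun x => ((inner ℝ k (toE x) ^ 2 : ℝ) : ℂ) / 2) ν.toMeasure := by
    exact (integrable_inner_sq h k).ofReal.div_const _
  have hj : Integrable (fun x => (Complex.I * (inner ℝ v (toE x) : ℝ)) ^ 0 *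
      expRem 2 (inner ℝ k (toE x))) ν.toMeasure := by
    simp only [pow_zero, one_mul]
    simpa using integrable_charRem h (n := 2) (j := 0) (by norm_num) (v := 0) (by simp) k
  rw [charRem, integral_congr_ae (Eventually.of_forall e), integral_add hj hi, ← charRem,
    charRem_two h h0, integral_div, integral_complex_ofReal]
  rfl

lemma norm_charfn_le_one (k : E6) : ‖charfn ν k‖ ≤ 1 := by
  have := norm_integral_le_of_norm_le (integrable_const (1 : ℝ)) (μ := ν.toMeasure)
    (f := fun x => Complex.exp ((inner ℝ k (toE x) : ℝ) * Complex.I))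
    (Eventually.of_forall fun _ => (Complex.norm_exp_ofReal_mul_I _).le)
  simpa [charfn] using this

lemma continuous_charfn : Continuous (charfn ν) := by
  refine continuous_of_dominated (bound := fun _ => 1) (fun k => aesm_of_countable _)
    (fun k => Eventually.of_forall fun x => (Complex.norm_exp_ofReal_mul_I _).le)
    (integrable_const _) (Eventually.of_forall fun x => ?_)
  fun_prop

/-- If `φ(k) = 1`, then `cos (k · x) = 1` for every step `x`, so `k · x ∈ 2πℤ` for all lattice
points. Basis vectors give `k i ∈ 2πℤ`, and the size restriction forces `k = 0`. -/
lemma charfn_ne_one (hirr : WalkIrreducible ν) {k : E6} (hk : k ≠ 0)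
    (hk2 : ∀ i, |k i| < 2 * Real.pi) : charfn ν k ≠ 1 := by
  intro h1
  apply hk
  have hre : ∫ x, (1 - Real.cos (inner ℝ k (toE x))) ∂ν.toMeasure = 0 := by
    have h2 := congrArg Complex.re h1
    have h3 := integral_re (integrable_exp_inner (ν := ν) k)
    simp only [RCLike.re_to_complex, Complex.exp_ofReal_mul_I_re] at h3
    rw [charfn, ← h3, Complex.one_re] at h2
    have hi : Integrable (fun x => Real.cos (inner ℝ k (toE x))) ν.toMeasure :=
      (integrable_const (1 : ℝ)).mono' (aesm_of_countable _)
        (Eventually.of_forall fun x => Real.abs_cos_le_one _)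
    rw [integral_sub (integrable_const _) hi, h2]
    simp
  have hae : ∀ᵐ x ∂ν.toMeasure, 1 - Real.cos (inner ℝ k (toE x)) = 0 := by
    refine (integral_eq_zero_iff_of_nonneg (fun x => ?_) ?_).1 hre
    · exact sub_nonneg.2 (Real.cos_le_one _)
    · exact (integrable_const (2 : ℝ)).mono' (aesm_of_countable _) (Eventually.of_forall fun x => by
        rw [Real.norm_eq_abs, abs_le]
        have h1 := Real.cos_le_one (inner ℝ k (toE x))
        have h2 := Real.neg_one_le_cos (inner ℝ k (toE x))
        constructor <;> linarith)
  have hall := hirr.mem (S := {x | ∃ n : ℤ, (n : ℝ) * (2 * Real.pi) = inner ℝ k (toE x)})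
    ⟨0, by simp [toE_zero]⟩ (by
      rintro x ⟨n, hn⟩ y hy
      have h2 := of_ae_toMeasure hae hy
      obtain ⟨m, hm⟩ := (Real.cos_eq_one_iff _).1 (sub_eq_zero.1 h2).symm
      refine ⟨n + m, ?_⟩
      rw [toE_add, inner_add_right, ← hn, ← hm]
      push_cast; ring)
  ext i
  obtain ⟨n, hn⟩ := hall (Pi.single i 1)
  rw [inner_toE_single] at hn
  have h3 := hk2 i
  rw [← hn, abs_mul, abs_of_pos Real.two_pi_pos] at h3
  have h4 : |(n : ℝ)| < 1 := by
    by_contra hge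
    push Not at hge
    nlinarith [Real.two_pi_pos]
  have h5 : n = 0 := by
    have : |n| < 1 := by exact_mod_cast h4
    exact Int.abs_lt_one_iff.1 this
  rw [← hn, h5]; simp

/-- A punctured cube that contains no point of the dual lattice `2 π ℤ^6`. -/
def pbox : Set E6 := {k | k ≠ 0 ∧ ∀ i, |k i| < 5 * Real.pi / 3}

lemma isOpen_pbox : IsOpen pbox := by
  have : pbox = {0}ᶜ ∩ ⋂ i, {k : E6 | |k i| < 5 * Real.pi / 3} := by
    ext k; simp [pbox]
  rw [this]
  refine isOpen_compl_singleton.inter (isOpen_iInter_of_finite fun i => ?_)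
  exact isOpen_lt (by fun_prop) continuous_const

lemma zero_notMem_pbox : (0 : E6) ∉ pbox := fun h => h.1 rfl

/-- The factor 3 is an upper bound for `√6`. -/
lemma norm_le_of_abs_le {k : E6} {r : ℝ} (hr : 0 ≤ r) (h : ∀ i, |k i| ≤ r) : ‖k‖ ≤ 3 * r := by
  rw [EuclideanSpace.norm_eq, Real.sqrt_le_left (by positivity)]
  calc ∑ i, ‖k i‖ ^ 2 ≤ ∑ _i : Fin 6, r ^ 2 :=
        Finset.sum_le_sum fun i _ => pow_le_pow_left₀ (norm_nonneg _) (h i) 2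
    _ ≤ _ := by simp; nlinarith

lemma norm_le_of_mem_pbox {k : E6} (hk : k ∈ pbox) : ‖k‖ ≤ 5 * Real.pi := by
  have := norm_le_of_abs_le (r := 5 * Real.pi / 3) (by positivity) fun i => (hk.2 i).le
  linarith

/-- On the punctured cube, `1 - φ` is bounded below by a multiple of `|k| ^ 2`. -/
lemma exists_norm_one_sub_charfn_ge (h : SixthMoment ν) (h0 : MeanZero ν)
    (hirr : WalkIrreducible ν) : ∃ c : ℝ, 0 < c ∧ ∀ k ∈ pbox, c * ‖k‖ ^ 2 ≤ ‖1 - charfn ν k‖ := by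
  obtain ⟨c, hc, hQ⟩ := exists_covQ_ge h hirr
  set C := ∫ x, ‖toE x‖ ^ (0 + 3) ∂ν.toMeasure with hC
  have hC0 : 0 ≤ C := integral_nonneg fun x => by positivity
  -- For `‖k‖ ≤ δ` the cubic remainder `C ‖k‖³` is at most `(c/4) ‖k‖²`, half of the lower bound for
  -- `Q/2`.
  set δ := c / (4 * (C + 1)) with hδ
  have hδp : 0 < δ := by positivity
  have hnear : ∀ k : E6, ‖k‖ ≤ δ → c / 4 * ‖k‖ ^ 2 ≤ ‖1 - charfn ν k‖ := by
    intro k hk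
    have h1 := norm_charRem_le h (n := 3) (j := 0) (by norm_num) (v := 0) (by simp) k
    rw [charRem_three h h0] at h1
    have h2 : ‖(covQ ν k : ℂ) / 2‖ ≤ ‖1 - charfn ν k‖ +
        ‖charfn ν k - 1 + (covQ ν k : ℂ) / 2‖ := by
      refine le_trans (le_of_eq ?_) (norm_add_le _ _)
      congr 1; ring
    have h3 : ‖(covQ ν k : ℂ) / 2‖ = covQ ν k / 2 := by
      rw [norm_div, Complex.norm_real, Real.norm_of_nonneg (covQ_nonneg _)]
      norm_num
    have h4 : C * ‖k‖ ^ 3 ≤ c / 4 * ‖k‖ ^ 2 := by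
      have h5 : (C + 1) * ‖k‖ ≤ c / 4 := by
        calc (C + 1) * ‖k‖ ≤ (C + 1) * δ := by gcongr
          _ = c / 4 := by rw [hδ]; field_simp
      have h6 : C * ‖k‖ ≤ c / 4 := by nlinarith [norm_nonneg k]
      calc C * ‖k‖ ^ 3 = (C * ‖k‖) * ‖k‖ ^ 2 := by ring
        _ ≤ _ := by gcongr
    have h5 := hQ k
    linarith
  -- Away from the origin compactness suffices: `5π/3 < 2π`, so `1 - φ` has no zero on `K`.
  set K : Set E6 := {k | (∀ i, |k i| ≤ 5 * Real.pi / 3) ∧ δ ≤ ‖k‖} with hK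
  have hKc : IsCompact K := by
    refine (isCompact_closedBall (0 : E6) (5 * Real.pi)).of_isClosed_subset ?_ ?_
    · have : K = (⋂ i, {k : E6 | |k i| ≤ 5 * Real.pi / 3}) ∩ {k | δ ≤ ‖k‖} := by
        ext k; simp [hK]
      rw [this]
      refine (isClosed_iInter fun i => isClosed_le (by fun_prop) continuous_const).inter
        (isClosed_le continuous_const continuous_norm)
    · intro k hk
      have := norm_le_of_abs_le (r := 5 * Real.pi / 3) (by positivity) hk.1
      simp only [Metric.mem_closedBall, dist_zero_right]
      linarith
  have hfar : ∃ c' : ℝ, 0 < c' ∧ ∀ k ∈ K, c' ≤ ‖1 - charfn ν k‖ := by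
    rcases K.eq_empty_or_nonempty with he | hne
    · exact ⟨1, one_pos, by simp [he]⟩
    · obtain ⟨k0, hk0, hmin⟩ := hKc.exists_isMinOn hne
        (continuous_const.sub continuous_charfn : Continuous fun k => 1 - charfn ν k).norm.continuousOn
      refine ⟨‖1 - charfn ν k0‖, norm_pos_iff.2 (sub_ne_zero.2 (Ne.symm ?_)), fun k hk => hmin hk⟩
      refine charfn_ne_one hirr (fun h => ?_) fun i => ?_
      · have := hk0.2
        rw [h, norm_zero] at this
        linarith
      · have := hk0.1 i
        linarith [Real.pi_pos]
  obtain ⟨c', hc', hfar⟩ := hfar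
  refine ⟨min (c / 4) (c' / (5 * Real.pi) ^ 2), lt_min (by positivity) (by positivity),
    fun k hk => ?_⟩
  rcases le_total ‖k‖ δ with hle | hle
  · refine le_trans ?_ (hnear k hle)
    gcongr
    exact min_le_left _ _
  · refine le_trans ?_ (hfar k ⟨fun i => (hk.2 i).le, hle⟩)
    have h1 := norm_le_of_mem_pbox hk
    calc min (c / 4) (c' / (5 * Real.pi) ^ 2) * ‖k‖ ^ 2
        ≤ c' / (5 * Real.pi) ^ 2 * (5 * Real.pi) ^ 2 := by
          gcongr
          exact min_le_right _ _
      _ = c' := by field_simp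

end

section

/-! ### A smooth window and Fourier inversion -/

/-- A smooth function on `ℝ` supported in `[-3π/2, 3π/2]` whose translates by `2πℤ` sum to `1`. -/
def window1 (y : ℝ) : ℝ :=
  Real.smoothTransition (y / Real.pi + 3 / 2) - Real.smoothTransition (y / Real.pi - 1 / 2)

lemma contDiff_window1 : ContDiff ℝ ((⊤ : ℕ∞) : WithTop ℕ∞) window1 := by
  have h := Real.smoothTransition.contDiff (n := ⊤)
  exact (h.comp ((contDiff_id.div_const _).add contDiff_const)).sub
    (h.comp ((contDiff_id.div_const _).sub contDiff_const))

lemma window1_eq_zero {y : ℝ} (hy : 3 * Real.pi / 2 ≤ |y|) : window1 y = 0 := by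
  have hpi := Real.pi_pos
  rw [window1]
  rcases le_abs.1 hy with h | h
  · have h1 : 3 / 2 ≤ y / Real.pi := by rw [le_div_iff₀ hpi]; linarith
    rw [Real.smoothTransition.one_of_one_le (by linarith),
      Real.smoothTransition.one_of_one_le (by linarith), sub_self]
  · have h1 : y / Real.pi ≤ -(3 / 2) := by rw [div_le_iff₀ hpi]; linarith
    rw [Real.smoothTransition.zero_of_nonpos (by linarith),
      Real.smoothTransition.zero_of_nonpos (by linarith), sub_self]

lemma window1_eq_one {y : ℝ} (hy : |y| ≤ Real.pi / 2) : window1 y = 1 := by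
  have hpi := Real.pi_pos
  have h := abs_le.1 hy
  have h1 : -(1 / 2) ≤ y / Real.pi := by rw [le_div_iff₀ hpi]; linarith
  have h2 : y / Real.pi ≤ 1 / 2 := by rw [div_le_iff₀ hpi]; linarith
  rw [window1, Real.smoothTransition.one_of_one_le (by linarith),
    Real.smoothTransition.zero_of_nonpos (by linarith), sub_zero]

/-- The window is a smooth step minus its translate by `2π`. Against a `2π`-periodic exponential the
integral therefore telescopes to one full period where the step equals 1, minus one where it equals
0. -/
lemma integral_window1_mul_exp (n : ℤ) :
    ∫ y : ℝ, (window1 y : ℂ) * Complex.exp (y * n * Complex.I)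
      = if n = 0 then (2 * Real.pi : ℂ) else 0 := by
  have hpi := Real.pi_pos
  set A : ℝ → ℂ := fun y => (Real.smoothTransition (y / Real.pi - 1 / 2) : ℂ) *
    Complex.exp (y * n * Complex.I) with hA
  have hAc : Continuous A := by
    have := Real.smoothTransition.continuous
    fun_prop
  have hshift : ∀ y : ℝ, (window1 y : ℂ) * Complex.exp (y * n * Complex.I)
      = A (y + 2 * Real.pi) - A y := by
    intro y
    have e1 : Complex.exp (((y + 2 * Real.pi : ℝ) : ℂ) * n * Complex.I)
        = Complex.exp (y * n * Complex.I) := by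
      rw [show ((y + 2 * Real.pi : ℝ) : ℂ) * n * Complex.I
        = y * n * Complex.I + n * (2 * Real.pi * Complex.I) by push_cast; ring, Complex.exp_add,
        Complex.exp_int_mul_two_pi_mul_I, mul_one]
    have e2 : (y + 2 * Real.pi) / Real.pi - 1 / 2 = y / Real.pi + 3 / 2 := by
      field_simp; ring
    simp only [hA]
    rw [e1, e2, window1]
    push_cast; ring
  have hsupp : Function.support (fun y : ℝ => (window1 y : ℂ) * Complex.exp (y * n * Complex.I))
      ⊆ Set.Ioc (-(4 * Real.pi)) (4 * Real.pi) := by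
    intro y hy
    by_contra hn
    apply hy
    have h1 : 3 * Real.pi / 2 ≤ |y| := by
      rw [Set.mem_Ioc, not_and_or, not_lt, not_le] at hn
      rcases hn with h | h
      · exact le_trans (by linarith) (neg_le_abs y)
      · exact le_trans (by linarith) (le_abs_self y)
    simp [window1_eq_zero h1]
  have hi : ∀ a b, IntervalIntegrable A volume a b := fun a b => hAc.intervalIntegrable a b
  have hlow : ∫ y in (-(4 * Real.pi))..(-(2 * Real.pi)), A y = 0 := by
    rw [intervalIntegral.integral_congr (g := fun _ => 0)]
    · simp
    · intro y hy
      rw [Set.uIcc_of_le (by linarith)] at hy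
      have h1 : y / Real.pi - 1 / 2 ≤ 0 := by
        have : y / Real.pi ≤ 0 := div_nonpos_of_nonpos_of_nonneg (by linarith [hy.2]) hpi.le
        linarith
      simp only [hA, Real.smoothTransition.zero_of_nonpos h1, Complex.ofReal_zero, zero_mul]
  have hhigh : ∫ y in (4 * Real.pi)..(6 * Real.pi), A y
      = ∫ y in (4 * Real.pi)..(6 * Real.pi), Complex.exp (n * Complex.I * y) := by
    refine intervalIntegral.integral_congr fun y hy => ?_
    rw [Set.uIcc_of_le (by linarith)] at hy
    have h1 : 1 ≤ y / Real.pi - 1 / 2 := by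
      have : 4 ≤ y / Real.pi := by rw [le_div_iff₀ hpi]; exact hy.1
      linarith
    simp only [hA, Real.smoothTransition.one_of_one_le h1, Complex.ofReal_one, one_mul]
    congr 1; ring
  rw [← intervalIntegral.integral_eq_integral_of_support_subset hsupp]
  simp only [hshift]
  have hAs : Continuous fun y => A (y + 2 * Real.pi) := by fun_prop
  rw [intervalIntegral.integral_sub (hAs.intervalIntegrable _ _) (hi _ _),
    intervalIntegral.integral_comp_add_right (fun y => A y),
    show -(4 * Real.pi) + 2 * Real.pi = -(2 * Real.pi) by ring,
    show 4 * Real.pi + 2 * Real.pi = 6 * Real.pi by ring,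
    ← intervalIntegral.integral_add_adjacent_intervals (hi (-(2 * Real.pi)) (4 * Real.pi)) (hi _ _),
    ← intervalIntegral.integral_add_adjacent_intervals (hi (-(4 * Real.pi)) (-(2 * Real.pi))) (hi _ _),
    hlow, hhigh]
  rw [zero_add, add_sub_cancel_left]
  split_ifs with hn
  · subst hn
    simp
    ring
  · have hn' : (n : ℂ) * Complex.I ≠ 0 := mul_ne_zero (by exact_mod_cast hn) Complex.I_ne_zero
    rw [integral_exp_mul_complex hn']
    have e1 : Complex.exp (n * Complex.I * (6 * Real.pi : ℝ)) = 1 := by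
      rw [show (n : ℂ) * Complex.I * (6 * Real.pi : ℝ) = (3 * n : ℤ) * (2 * Real.pi * Complex.I) by
        push_cast; ring, Complex.exp_int_mul_two_pi_mul_I]
    have e2 : Complex.exp (n * Complex.I * (4 * Real.pi : ℝ)) = 1 := by
      rw [show (n : ℂ) * Complex.I * (4 * Real.pi : ℝ) = (2 * n : ℤ) * (2 * Real.pi * Complex.I) by
        push_cast; ring, Complex.exp_int_mul_two_pi_mul_I]
    rw [e1, e2, sub_self, zero_div]

/-- The product window on `ℝ^6`. -/
def window (k : E6) : ℂ := ∏ i, (window1 (k i) : ℂ)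

lemma contDiff_window : ContDiff ℝ ((⊤ : ℕ∞) : WithTop ℕ∞) window := by
  unfold window
  refine contDiff_prod fun i _ => ?_
  have h1 : ContDiff ℝ ((⊤ : ℕ∞) : WithTop ℕ∞) fun k : E6 => window1 (k i) :=
    contDiff_window1.comp (EuclideanSpace.proj i : E6 →L[ℝ] ℝ).contDiff
  exact Complex.ofRealCLM.contDiff.comp h1

lemma continuous_window : Continuous window := contDiff_window.continuous

lemma window_eq_zero {k : E6} {i : Fin 6} (hi : 3 * Real.pi / 2 ≤ |k i|) : window k = 0 :=
  Finset.prod_eq_zero (Finset.mem_univ i) (by simp [window1_eq_zero hi])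

lemma window_eq_one {k : E6} (hk : ‖k‖ ≤ Real.pi / 2) : window k = 1 :=
  Finset.prod_eq_one fun i _ => by
    rw [window1_eq_one ((PiLp.norm_apply_le k i).trans hk), Complex.ofReal_one]

lemma window_eq_zero_of_norm {k : E6} (hk : 5 * Real.pi < ‖k‖) : window k = 0 := by
  by_contra hne
  have : ∀ i, |k i| ≤ 3 * Real.pi / 2 := fun i => by
    by_contra h
    exact hne (window_eq_zero (not_le.1 h).le)
  have := norm_le_of_abs_le (by positivity) this
  linarith [Real.pi_pos]

lemma mem_pbox_of_window_ne_zero {k : E6} (hk : k ≠ 0) (hw : window k ≠ 0) : k ∈ pbox :=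
  ⟨hk, fun i => by
    by_contra h
    exact hw (window_eq_zero (i := i) (by linarith [not_lt.1 h, Real.pi_pos]))⟩

lemma integrable_window : Integrable window :=
  continuous_window.integrable_of_hasCompactSupport
    (HasCompactSupport.intro (isCompact_closedBall (0 : E6) (5 * Real.pi)) fun k hk =>
      window_eq_zero_of_norm (by simpa using hk))

lemma integral_window_mul_exp (n : Fin 6 → ℤ) :
    ∫ k : E6, window k * Complex.exp ((inner ℝ k (toE n) : ℝ) * Complex.I)
      = if n = 0 then ((2 * Real.pi) ^ 6 : ℂ) else 0 := by
  have h1 : ∀ k : E6, window k * Complex.exp ((inner ℝ k (toE n) : ℝ) * Complex.I)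
      = ∏ i, ((window1 (k i) : ℂ) * Complex.exp (k i * n i * Complex.I)) := by
    intro k
    rw [Finset.prod_mul_distrib, ← Complex.exp_sum, window, inner_toE]
    congr 2
    push_cast
    rw [Finset.sum_mul]
  simp only [h1]
  have h2 := (PiLp.volume_preserving_ofLp (Fin 6)).integral_comp
    (MeasurableEquiv.toLp 2 (Fin 6 → ℝ)).symm.measurableEmbedding
    (fun y : Fin 6 → ℝ => ∏ i, ((window1 (y i) : ℂ) * Complex.exp (y i * n i * Complex.I)))
  rw [h2, integral_fintype_prod_volume_eq_prod
    (fun i (y : ℝ) => (window1 y : ℂ) * Complex.exp (y * n i * Complex.I))]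
  simp only [integral_window1_mul_exp]
  split_ifs with hn
  · subst hn; simp
  · obtain ⟨i, hi⟩ := Function.ne_iff.1 hn
    exact Finset.prod_eq_zero (Finset.mem_univ i) (if_neg hi)

/-- Fourier inversion on the lattice, the integral over the torus being unfolded to `ℝ^6` by the
window. -/
lemma integral_window_mul_charfn (p : PMF (Fin 6 → ℤ)) (z : Fin 6 → ℤ) :
    ∫ k, window k * charfn p k * chr (toE z) k = (2 * Real.pi) ^ 6 * ((p z).toReal : ℂ) := by
  have e : ∀ k x, window k * Complex.exp ((inner ℝ k (toE x) : ℝ) * Complex.I) * chr (toE z) k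
      = window k * Complex.exp ((inner ℝ k (toE (x - z)) : ℝ) * Complex.I) := by
    intro k x
    rw [mul_assoc, chr, ← Complex.exp_add, toE_sub, inner_sub_right]
    congr 2
    push_cast; ring
  have h1 : ∀ k, window k * charfn p k * chr (toE z) k
      = ∫ x, window k * Complex.exp ((inner ℝ k (toE (x - z)) : ℝ) * Complex.I) ∂p.toMeasure := by
    intro k
    rw [charfn, ← integral_const_mul, ← integral_mul_const]
    simp only [e]
  simp only [h1]
  rw [integral_integral_swap]
  · simp only [integral_window_mul_exp, sub_eq_zero]
    have h2 : (fun x : Fin 6 → ℤ => if x = z then ((2 * Real.pi) ^ 6 : ℂ) else 0)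
        = Set.indicator {z} fun _ => ((2 * Real.pi) ^ 6 : ℂ) := by
      funext x
      simp [Set.indicator]
    rw [h2, integral_indicator (measurableSet_singleton z), setIntegral_const, measureReal_def,
      PMF.toMeasure_apply_singleton _ _ (measurableSet_singleton z), Complex.real_smul, mul_comm]
  · have hm : Measurable fun q : E6 × (Fin 6 → ℤ) =>
        Complex.exp ((inner ℝ q.1 (toE (q.2 - z)) : ℝ) * Complex.I) := by
      have hf : Measurable fun q : E6 × (Fin 6 → ℤ) => toE (q.2 - z) :=
        (measurable_of_countable fun x : Fin 6 → ℤ => toE (x - z)).comp measurable_snd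
      have : Measurable fun q : E6 × (Fin 6 → ℤ) => inner ℝ q.1 (toE (q.2 - z)) :=
        measurable_fst.inner hf
      fun_prop
    have hw : Integrable (fun q : E6 × (Fin 6 → ℤ) => window q.1) (volume.prod p.toMeasure) :=
      integrable_window.comp_fst _
    exact hw.mul_bdd (c := 1) hm.aestronglyMeasurable
      (Eventually.of_forall fun q => (Complex.norm_exp_ofReal_mul_I _).le)

/-- Abelian summation of Fourier inversion formulas. -/
lemma tsum_eq_integral_of_abel {ι : Type*} {p : ι → PMF (Fin 6 → ℤ)} {deg : ι → ℕ}
    {Ψr : ℝ → E6 → ℂ} {Ψ : E6 → ℂ} {G : E6 → ℝ} (hG : Integrable G)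
    [Countable ι] (hdeg : ∀ r ∈ Set.Ico (0 : ℝ) 1, Summable fun i => r ^ deg i)
    (hΨr : ∀ r ∈ Set.Ico (0 : ℝ) 1, ∀ k, HasSum (fun i => (r : ℂ) ^ deg i * charfn (p i) k) (Ψr r k))
    (hbd : ∀ r ∈ Set.Ico (0 : ℝ) 1, ∀ᵐ k, ‖window k * Ψr r k‖ ≤ G k)
    (hlim : ∀ᵐ k, window k ≠ 0 → Tendsto (fun r => Ψr r k) (𝓝[<] 1) (𝓝 (Ψ k)))
    (hmeas : ∀ r ∈ Set.Ico (0 : ℝ) 1, AEStronglyMeasurable (Ψr r) volume)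
    (z : Fin 6 → ℤ) :
    ∑' i, p i z ≠ ∞ ∧ ∫ k, window k * Ψ k * chr (toE z) k
      = (2 * Real.pi) ^ 6 * ((∑' i, p i z).toReal : ℂ) := by
  set b : ι → ℝ := fun i => (p i z).toReal with hb
  have hb0 : ∀ i, 0 ≤ b i := fun i => ENNReal.toReal_nonneg
  have hb1 : ∀ i, b i ≤ 1 := fun i => by
    have := ENNReal.toReal_mono (by simp) ((p i).coe_le_one z)
    simpa using this
  have hI : Set.Ico (0 : ℝ) 1 ∈ 𝓝[<] (1 : ℝ) := Ico_mem_nhdsLT zero_lt_one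
  set S : ℝ → ℝ := fun r => ∑' i, r ^ deg i * b i with hS
  have hsum : ∀ r ∈ Set.Ico (0 : ℝ) 1, Summable fun i => r ^ deg i * b i := fun r hr =>
    (hdeg r hr).of_nonneg_of_le (fun i => mul_nonneg (pow_nonneg hr.1 _) (hb0 i))
      fun i => mul_le_of_le_one_right (pow_nonneg hr.1 _) (hb1 i)
  have hformula : ∀ r ∈ Set.Ico (0 : ℝ) 1,
      ∫ k, window k * Ψr r k * chr (toE z) k = (2 * Real.pi) ^ 6 * (S r : ℂ) := by
    intro r hr
    have hint : ∀ i, Integrable fun k => window k * ((r : ℂ) ^ deg i * charfn (p i) k) * chr (toE z) k := by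
      intro i
      refine Integrable.mul_chr ?_ _
      refine integrable_window.mul_bdd (c := 1)
        (continuous_const.mul continuous_charfn).aestronglyMeasurable (Eventually.of_forall fun k => ?_)
      rw [norm_mul, norm_pow, Complex.norm_real, Real.norm_of_nonneg hr.1]
      exact mul_le_one₀ (pow_le_one₀ hr.1 hr.2.le) (norm_nonneg _) (norm_charfn_le_one k)
    have hnorm : Summable fun i =>
        ∫ k, ‖window k * ((r : ℂ) ^ deg i * charfn (p i) k) * chr (toE z) k‖ := by
      refine ((hdeg r hr).mul_right (∫ k, ‖window k‖)).of_nonneg_of_le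
        (fun i => integral_nonneg fun k => norm_nonneg _) fun i => ?_
      rw [← integral_const_mul]
      refine integral_mono (hint i).norm (integrable_window.norm.const_mul _) fun k => ?_
      simp only [norm_mul, norm_chr, mul_one, norm_pow, Complex.norm_real, Real.norm_of_nonneg hr.1]
      have h1 := norm_charfn_le_one (ν := p i) k
      have h2 : 0 ≤ r ^ deg i := pow_nonneg hr.1 _
      calc ‖window k‖ * (r ^ deg i * ‖charfn (p i) k‖) ≤ ‖window k‖ * (r ^ deg i * 1) := by gcongr
        _ = _ := by ring
    have h1 := hasSum_integral_of_summable_integral_norm hint hnorm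
    have h2 : ∀ k, ∑' i, window k * ((r : ℂ) ^ deg i * charfn (p i) k) * chr (toE z) k
        = window k * Ψr r k * chr (toE z) k := fun k =>
      (((hΨr r hr k).mul_left _).mul_right _).tsum_eq
    have h3 : ∀ i, ∫ k, window k * ((r : ℂ) ^ deg i * charfn (p i) k) * chr (toE z) k
        = (2 * Real.pi) ^ 6 * ((r ^ deg i * b i : ℝ) : ℂ) := by
      intro i
      have e : ∀ k, window k * ((r : ℂ) ^ deg i * charfn (p i) k) * chr (toE z) k
          = (r : ℂ) ^ deg i * (window k * charfn (p i) k * chr (toE z) k) := fun k => by ring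
      simp only [e]
      rw [integral_const_mul, integral_window_mul_charfn]
      push_cast; ring
    simp only [h2, h3] at h1
    rw [h1.tsum_eq.symm, tsum_mul_left]
    rw [hS, Complex.ofReal_tsum]
  -- Dominated convergence as `r` increases to 1; the dominating function `G` does not depend on
  -- `r`.
  have hT : Tendsto (fun r => ∫ k, window k * Ψr r k * chr (toE z) k) (𝓝[<] 1)
      (𝓝 (∫ k, window k * Ψ k * chr (toE z) k)) := by
    refine tendsto_integral_filter_of_dominated_convergence G ?_ ?_ hG ?_
    · filter_upwards [hI] with r hr
      exact (continuous_window.aestronglyMeasurable.mul (hmeas r hr)).mul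
        (continuous_chr _).aestronglyMeasurable
    · filter_upwards [hI] with r hr
      filter_upwards [hbd r hr] with k hk
      rw [norm_mul, norm_chr, mul_one]
      exact hk
    · filter_upwards [hlim] with k hk
      by_cases hw : window k = 0
      · simp [hw]
      · exact ((hk hw).const_mul _).mul_const _
  set L := ∫ k, window k * Ψ k * chr (toE z) k with hL
  have hpi : ((2 * Real.pi) ^ 6 : ℂ) ≠ 0 := by
    have := Real.pi_ne_zero
    simp [this]
  have hT2 : Tendsto (fun r => (S r : ℂ)) (𝓝[<] 1) (𝓝 (((2 * Real.pi) ^ 6 : ℂ)⁻¹ * L)) := by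
    refine (hT.const_mul (((2 * Real.pi) ^ 6 : ℂ)⁻¹)).congr' ?_
    filter_upwards [hI] with r hr
    rw [hformula r hr, inv_mul_cancel_left₀ hpi]
  set l := (((2 * Real.pi) ^ 6 : ℂ)⁻¹ * L).re with hl
  have hT3 : Tendsto S (𝓝[<] 1) (𝓝 l) := (Complex.continuous_re.tendsto _).comp hT2
  have hLl : L = (2 * Real.pi) ^ 6 * (l : ℂ) := by
    have h1 : Tendsto (fun r => (S r : ℂ)) (𝓝[<] 1) (𝓝 (l : ℂ)) :=
      (Complex.continuous_ofReal.tendsto _).comp hT3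
    rw [← tendsto_nhds_unique hT2 h1, mul_inv_cancel_left₀ hpi]
  -- The terms are nonnegative, so every finite sum lies below the Abel limit. Hence Abel
  -- summability gives summability with the same value.
  have hfin : ∀ s : Finset ι, ∑ i ∈ s, b i ≤ l := by
    intro s
    have h1 : Tendsto (fun r : ℝ => ∑ i ∈ s, r ^ deg i * b i) (𝓝[<] 1) (𝓝 (∑ i ∈ s, b i)) := by
      have : Continuous fun r : ℝ => ∑ i ∈ s, r ^ deg i * b i := by fun_prop
      have := (this.tendsto 1).mono_left (nhdsWithin_le_nhds (s := Set.Iio 1))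
      simpa using this
    refine le_of_tendsto_of_tendsto h1 hT3 ?_
    filter_upwards [hI] with r hr
    exact (hsum r hr).sum_le_tsum s fun i _ => mul_nonneg (pow_nonneg hr.1 _) (hb0 i)
  have hbs : Summable b := summable_of_sum_le hb0 hfin
  have hle : ∑' i, b i = l := by
    refine le_antisymm (hbs.tsum_le_of_sum_le hfin) (le_of_tendsto hT3 ?_)
    filter_upwards [hI] with r hr
    refine (hsum r hr).tsum_le_tsum (fun i => ?_) hbs
    exact mul_le_of_le_one_left (hb0 i) (pow_le_one₀ hr.1 hr.2.le)
  have hE : ∑' i, p i z = ENNReal.ofReal l := by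
    rw [← hle, ENNReal.ofReal_tsum_of_nonneg hb0 hbs]
    exact tsum_congr fun i => (ENNReal.ofReal_toReal ((p i).apply_ne_top z)).symm
  refine ⟨by rw [hE]; exact ENNReal.ofReal_ne_top, ?_⟩
  rw [hE, ENNReal.toReal_ofReal (by rw [← hle]; exact tsum_nonneg hb0), hLl]

end

section

/-! ### Fourier representation of Green's functions -/

/-- The law of `op X Y` for independent `X`, `Y`. -/
def combLaw (op : (Fin 6 → ℤ) → (Fin 6 → ℤ) → (Fin 6 → ℤ)) (p q : PMF (Fin 6 → ℤ)) :
    PMF (Fin 6 → ℤ) :=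
  p.bind fun x => q.map (op x)

lemma toMeasure_combLaw (op : (Fin 6 → ℤ) → (Fin 6 → ℤ) → (Fin 6 → ℤ)) (p q : PMF (Fin 6 → ℤ)) :
    (combLaw op p q).toMeasure = (p.toMeasure.prod q.toMeasure).map fun w => op w.1 w.2 := by
  have hop : Measurable fun w : (Fin 6 → ℤ) × (Fin 6 → ℤ) => op w.1 w.2 := measurable_of_countable _
  refine Measure.ext_of_singleton fun w => ?_
  have hw : MeasurableSet ({w} : Set (Fin 6 → ℤ)) := measurableSet_singleton w
  rw [PMF.toMeasure_apply_singleton _ _ hw, Measure.map_apply hop hw,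
    Measure.prod_apply (hop hw), lintegral_countable', combLaw, PMF.bind_apply]
  refine tsum_congr fun x => ?_
  rw [PMF.toMeasure_apply_singleton _ _ (measurableSet_singleton x), mul_comm,
    ← PMF.toMeasure_apply_singleton _ w hw,
    PMF.toMeasure_map_apply (op x) q {w} (measurable_of_countable _) hw]
  rfl

lemma charfn_combLaw_add (p q : PMF (Fin 6 → ℤ)) (k : E6) :
    charfn (combLaw (fun x y => x + y) p q) k = charfn p k * charfn q k := by
  simp only [charfn]
  rw [toMeasure_combLaw, integral_map (measurable_of_countable _).aemeasurable
    (measurable_of_countable _).aestronglyMeasurable, ← integral_prod_mul]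
  refine integral_congr_ae (Eventually.of_forall fun w => ?_)
  simp only [toE_add, inner_add_right, ← Complex.exp_add]
  congr 1
  push_cast; ring

lemma charfn_combLaw_sub (p q : PMF (Fin 6 → ℤ)) (k : E6) :
    charfn (combLaw (fun x y => x - y) p q) k = charfn p k * charfn q (-k) := by
  simp only [charfn]
  rw [toMeasure_combLaw, integral_map (measurable_of_countable _).aemeasurable
    (measurable_of_countable _).aestronglyMeasurable, ← integral_prod_mul]
  refine integral_congr_ae (Eventually.of_forall fun w => ?_)
  simp only [toE_sub, inner_sub_right, inner_neg_left, ← Complex.exp_add]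
  congr 1
  push_cast; ring

lemma charfn_walkLaw (ν : PMF (Fin 6 → ℤ)) (n : ℕ) (k : E6) :
    charfn (walkLaw ν n) k = charfn ν k ^ n := by
  induction n with
  | zero =>
    rw [pow_zero, charfn, walkLaw, PMF.toMeasure_pure, integral_dirac]
    simp [toE_zero]
  | succ n ih =>
    have : walkLaw ν (n + 1) = combLaw (fun x y => x + y) (walkLaw ν n) ν := rfl
    rw [this, charfn_combLaw_add, ih, pow_succ]

lemma integral_neg_of_symm {θ : PMF (Fin 6 → ℤ)} (hθ : ∀ x, θ (-x) = θ x) {F : Type*}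
    [NormedAddCommGroup F] [NormedSpace ℝ F] (f : (Fin 6 → ℤ) → F) :
    ∫ x, f (-x) ∂θ.toMeasure = ∫ x, f x ∂θ.toMeasure := by
  have hm : θ.toMeasure.map (fun x => -x) = θ.toMeasure := by
    refine Measure.ext_of_singleton fun w => ?_
    rw [Measure.map_apply (measurable_of_countable _) (measurableSet_singleton w)]
    have : (fun x : Fin 6 → ℤ => -x) ⁻¹' {w} = {-w} := by
      ext x; simp
    rw [this, PMF.toMeasure_apply_singleton _ _ (measurableSet_singleton _),
      PMF.toMeasure_apply_singleton _ _ (measurableSet_singleton _), hθ]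
  have he : MeasurableEmbedding fun x : Fin 6 → ℤ => -x :=
    (MeasurableEquiv.neg (Fin 6 → ℤ)).measurableEmbedding
  conv_rhs => rw [← hm]
  rw [he.integral_map]

lemma charfn_neg_of_symm {θ : PMF (Fin 6 → ℤ)} (hθ : ∀ x, θ (-x) = θ x) (k : E6) :
    charfn θ (-k) = charfn θ k := by
  rw [charfn, charfn, ← integral_neg_of_symm hθ]
  simp [toE_neg]

lemma meanZero_of_symm {θ : PMF (Fin 6 → ℤ)} (hθ : ∀ x, θ (-x) = θ x) : MeanZero θ := by
  intro i
  have := integral_neg_of_symm hθ fun x : Fin 6 → ℤ => (x i : ℝ)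
  simp only [Pi.neg_apply, Int.cast_neg, integral_neg] at this
  linarith

lemma combLaw_sub_apply (p q : PMF (Fin 6 → ℤ)) (z : Fin 6 → ℤ) :
    combLaw (fun x y => x - y) p q z = ∑' x, p (z + x) * q x := by
  classical
  simp only [combLaw, PMF.bind_apply, PMF.map_apply, ← ENNReal.tsum_mul_left]
  rw [ENNReal.tsum_comm]
  refine tsum_congr fun x => ?_
  rw [tsum_eq_single (z + x)]
  · simp
  · intro y hy
    rw [if_neg, mul_zero]
    rintro rfl
    simp at hy

/-- The convolution of the Green's functions is a sum of point probabilities of differences of two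
independent walks, which puts it in the form to which Abelian summation applies. -/
lemma tsum_combLaw (η θ : PMF (Fin 6 → ℤ)) (z : Fin 6 → ℤ) :
    ∑' i : ℕ × ℕ, combLaw (fun x y => x - y) (walkLaw η i.1) (walkLaw θ i.2) z
      = ∑' x, green η (z + x) * green θ x := by
  simp only [combLaw_sub_apply]
  rw [ENNReal.tsum_comm]
  refine tsum_congr fun x => ?_
  rw [ENNReal.tsum_prod (f := fun n m => walkLaw η n (z + x) * walkLaw θ m x), green, green,
    ← ENNReal.tsum_mul_right]
  exact tsum_congr fun n => ENNReal.tsum_mul_left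

lemma integrable_of_norm_le_zpow {F : Type*} [NormedAddCommGroup F] {f : E6 → F}
    (hf : AEStronglyMeasurable f) {a b : ℤ} (ha : -6 < a) (hb : b < -6) {C C' : ℝ}
    (h1 : ∀ᵐ k, ‖f k‖ ≤ C * ‖k‖ ^ a) (h2 : ∀ᵐ k, ‖f k‖ ≤ C' * ‖k‖ ^ b) : Integrable f := by
  refine ⟨hf, ?_⟩
  obtain ⟨C1, -, hC1⟩ := lintegral_ball_norm_zpow ha
  obtain ⟨C2, -, hC2⟩ := lintegral_compl_ball_norm_zpow hb
  have key : ∀ {C : ℝ} {a : ℤ} {k : E6}, ‖f k‖ ≤ C * ‖k‖ ^ a →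
      ‖f k‖ₑ ≤ ENNReal.ofReal |C| * ENNReal.ofReal (‖k‖ ^ a) := by
    intro C a k h
    rw [← ofReal_norm, ← ENNReal.ofReal_mul (abs_nonneg _)]
    refine ENNReal.ofReal_le_ofReal (h.trans ?_)
    exact mul_le_mul_of_nonneg_right (le_abs_self _) (by positivity)
  rw [HasFiniteIntegral, ← lintegral_add_compl _
    (Metric.isOpen_ball (x := (0 : E6)) (ε := 1)).measurableSet]
  refine ENNReal.add_lt_top.2 ⟨?_, ?_⟩
  · refine (lintegral_mono_ae (ae_restrict_of_ae (h1.mono fun k hk => key hk))).trans_lt ?_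
    rw [lintegral_const_mul' _ _ ENNReal.ofReal_ne_top]
    exact ENNReal.mul_lt_top ENNReal.ofReal_lt_top ((hC1 1 zero_le_one).trans_lt ENNReal.ofReal_lt_top)
  · refine (lintegral_mono_ae (ae_restrict_of_ae (h2.mono fun k hk => key hk))).trans_lt ?_
    rw [lintegral_const_mul' _ _ ENNReal.ofReal_ne_top]
    exact ENNReal.mul_lt_top ENNReal.ofReal_lt_top ((hC2 1 one_pos).trans_lt ENNReal.ofReal_lt_top)

lemma sym_window {U : Set E6} (hU : IsOpen U) (h0 : (0 : E6) ∉ U) (M : ℕ) {a : ℤ} (ha : a ≤ 0) :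
    Sym U M a fun _ k => window k :=
  Sym.of_contDiff (W := fun p : E6 × E6 => window p.2) hU h0 (contDiff_window.comp contDiff_snd)
    (R := 5 * Real.pi) (fun _ _ hk => window_eq_zero_of_norm hk) ha

lemma zero_notMem_compl : (0 : E6) ∉ ({0}ᶜ : Set E6) := fun h => h rfl

lemma exists_norm_window_le (a : ℤ) (ha : a ≤ 0) :
    ∃ C : ℝ, 0 ≤ C ∧ ∀ k : E6, k ≠ 0 → ‖window k‖ ≤ C * ‖k‖ ^ a := by
  obtain ⟨C, hC⟩ := sym_window isOpen_compl_singleton zero_notMem_compl 0 ha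
  refine ⟨|C|, abs_nonneg C, fun k hk => (hC 0 (by simp) k hk).trans ?_⟩
  exact mul_le_mul_of_nonneg_right (le_abs_self C) (by positivity)

lemma integrable_norm_window_mul_zpow {a : ℤ} (ha : -6 < a) (C : ℝ) :
    Integrable fun k : E6 => ‖window k‖ * (C * ‖k‖ ^ a) := by
  obtain ⟨C0, hC0, h0⟩ := exists_norm_window_le 0 le_rfl
  obtain ⟨C1, hC1, h1⟩ := exists_norm_window_le (-(|a| + 7)) (by have := abs_nonneg a; omega)
  refine integrable_of_norm_le_zpow (a := a) (b := -(|a| + 7) + a) (C := C0 * |C|) (C' := C1 * |C|)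
    ?_ ha (by have := le_abs_self a; omega) ?_ ?_
  · have : Measurable fun k : E6 => ‖k‖ ^ a := measurable_norm.pow_const a
    exact (continuous_window.norm.measurable.mul (this.const_mul C)).aestronglyMeasurable
  · filter_upwards [ae_ne_zero_E6] with k hk
    have hp : 0 ≤ ‖k‖ ^ a := by positivity
    have := h0 k hk
    rw [zpow_zero, mul_one] at this
    rw [norm_mul, norm_mul, norm_norm, Real.norm_eq_abs C, Real.norm_of_nonneg hp, ← mul_assoc]
    gcongr
  · filter_upwards [ae_ne_zero_E6] with k hk
    have hp : 0 ≤ ‖k‖ ^ a := by positivity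
    have := h1 k hk
    rw [norm_mul, norm_mul, norm_norm, Real.norm_eq_abs C, Real.norm_of_nonneg hp,
      zpow_add₀ (norm_ne_zero_iff.2 hk)]
    calc _ ≤ (C1 * ‖k‖ ^ (-(|a| + 7))) * (|C| * ‖k‖ ^ a) := by gcongr
      _ = _ := by ring

/-- The hypotheses on a step law used for the Fourier analysis. -/
structure StepLaw (ν : PMF (Fin 6 → ℤ)) : Prop where
  moment : SixthMoment ν
  mean : MeanZero ν
  irr : WalkIrreducible ν

variable {ν : PMF (Fin 6 → ℤ)}

/-- `|1 - φ| ≤ |1 - rφ| + (1 - r)`, and `1 - r ≤ |1 - rφ|`. This yields a bound on `(1 - rφ)⁻¹` that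
is uniform in `r`. -/
lemma norm_one_sub_mul_ge {r : ℝ} (hr : r ∈ Set.Ico (0 : ℝ) 1) {φ : ℂ} (hφ : ‖φ‖ ≤ 1) :
    ‖1 - φ‖ ≤ 2 * ‖1 - r * φ‖ := by
  have h1 : ‖1 - φ‖ ≤ ‖1 - r * φ‖ + ‖(1 - r : ℂ) * φ‖ := by
    refine le_trans (le_of_eq ?_) (norm_sub_le _ _)
    congr 1; ring
  have h2 : ‖(1 - r : ℂ) * φ‖ ≤ 1 - r := by
    rw [norm_mul, ← Complex.ofReal_one, ← Complex.ofReal_sub, Complex.norm_real,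
      Real.norm_of_nonneg (by linarith [hr.2])]
    exact mul_le_of_le_one_right (by linarith [hr.2]) hφ
  have h3 : 1 - r ≤ ‖1 - r * φ‖ := by
    have h4 := norm_sub_norm_le (1 : ℂ) (r * φ)
    rw [norm_one, norm_mul, Complex.norm_real, Real.norm_of_nonneg hr.1] at h4
    have : r * ‖φ‖ ≤ r * 1 := mul_le_mul_of_nonneg_left hφ hr.1
    linarith
  linarith

lemma StepLaw.exists_norm_inv_le (h : StepLaw ν) : ∃ C : ℝ, 0 < C ∧ ∀ r ∈ Set.Ico (0 : ℝ) 1,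
    ∀ k ∈ pbox, ‖(1 - r * charfn ν k)⁻¹‖ ≤ C * ‖k‖ ^ (-2 : ℤ) := by
  obtain ⟨c, hc, hlow⟩ := exists_norm_one_sub_charfn_ge h.moment h.mean h.irr
  refine ⟨2 / c, by positivity, fun r hr k hk => ?_⟩
  have hk0 : 0 < ‖k‖ := norm_pos_iff.2 hk.1
  have h1 := (hlow k hk).trans (norm_one_sub_mul_ge hr (norm_charfn_le_one k))
  have h2 : c / 2 * ‖k‖ ^ 2 ≤ ‖1 - r * charfn ν k‖ := by linarith
  rw [norm_inv]
  refine (inv_anti₀ (by positivity) h2).trans (le_of_eq ?_)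
  rw [zpow_neg, mul_inv, inv_div]
  norm_cast

lemma norm_mul_charfn_lt {r : ℝ} (hr : r ∈ Set.Ico (0 : ℝ) 1) (k : E6) :
    ‖(r : ℂ) * charfn ν k‖ < 1 := by
  rw [norm_mul, Complex.norm_real, Real.norm_of_nonneg hr.1]
  exact (mul_le_of_le_one_right hr.1 (norm_charfn_le_one k)).trans_lt hr.2

lemma StepLaw.charfn_ne_one (h : StepLaw ν) {k : E6} (hk : k ∈ pbox) : 1 - charfn ν k ≠ 0 := by
  rw [sub_ne_zero]
  refine (TreeWalk.charfn_ne_one h.irr hk.1 fun i => ?_).symm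
  have := hk.2 i
  linarith [Real.pi_pos]

lemma StepLaw.tendsto_inv (h : StepLaw ν) {k : E6} (hk : k ∈ pbox) :
    Tendsto (fun r : ℝ => (1 - r * charfn ν k)⁻¹) (𝓝[<] 1) (𝓝 (1 - charfn ν k)⁻¹) := by
  have hc : Continuous fun r : ℝ => 1 - r * charfn ν k := by fun_prop
  have := (hc.tendsto 1).mono_left (nhdsWithin_le_nhds (s := Set.Iio 1))
  simp only [Complex.ofReal_one, one_mul] at this
  exact this.inv₀ (h.charfn_ne_one hk)

lemma continuous_inv_one_sub {r : ℝ} (hr : r ∈ Set.Ico (0 : ℝ) 1) :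
    Continuous fun k => (1 - r * charfn ν k)⁻¹ := by
  refine Continuous.inv₀ (continuous_const.sub (continuous_const.mul continuous_charfn)) fun k hk => ?_
  have := norm_mul_charfn_lt (ν := ν) hr k
  rw [← sub_eq_zero.1 hk, norm_one] at this
  exact lt_irrefl _ this

lemma StepLaw.green_fourier (h : StepLaw ν) (z : Fin 6 → ℤ) :
    green ν z ≠ ∞ ∧ ∫ k, window k * (1 - charfn ν k)⁻¹ * chr (toE z) k
      = (2 * Real.pi) ^ 6 * ((green ν z).toReal : ℂ) := by
  obtain ⟨C, hC, hb⟩ := h.exists_norm_inv_le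
  refine tsum_eq_integral_of_abel (p := walkLaw ν) (deg := fun n => n)
    (Ψr := fun r k => (1 - r * charfn ν k)⁻¹) (Ψ := fun k => (1 - charfn ν k)⁻¹)
    (integrable_norm_window_mul_zpow (a := -2) (by norm_num) C)
    (fun r hr => summable_geometric_of_lt_one hr.1 hr.2) (fun r hr k => ?_) (fun r hr => ?_) ?_
    (fun r hr => (continuous_inv_one_sub hr).aestronglyMeasurable) z
  · simp only [charfn_walkLaw, ← mul_pow]
    exact hasSum_geometric_of_norm_lt_one (norm_mul_charfn_lt hr k)
  · filter_upwards [ae_ne_zero_E6] with k hk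
    by_cases hw : window k = 0
    · simp [hw]
    · rw [norm_mul]
      gcongr
      exact hb r hr k (mem_pbox_of_window_ne_zero hk hw)
  · filter_upwards [ae_ne_zero_E6] with k hk hw
    exact h.tendsto_inv (mem_pbox_of_window_ne_zero hk hw)

/-- For `r < 1` the double series is a product of two geometric series, the symmetry of `θ`
replacing `φ_θ(-k)` by `φ_θ(k)`. The dominating function is of order `|k|^(-4)`, still locally
integrable in dimension 6, which also gives finiteness. -/
lemma tsum_green_mul_green_fourier {η θ : PMF (Fin 6 → ℤ)} (hη : StepLaw η) (hθ : StepLaw θ)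
    (hs : ∀ x, θ (-x) = θ x) (z : Fin 6 → ℤ) :
    ∑' x, green η (z + x) * green θ x ≠ ∞ ∧
      ∫ k, window k * ((1 - charfn η k)⁻¹ * (1 - charfn θ k)⁻¹) * chr (toE z) k
        = (2 * Real.pi) ^ 6 * ((∑' x, green η (z + x) * green θ x).toReal : ℂ) := by
  obtain ⟨C, hC, hb⟩ := hη.exists_norm_inv_le
  obtain ⟨C', hC', hb'⟩ := hθ.exists_norm_inv_le
  rw [← tsum_combLaw]
  refine tsum_eq_integral_of_abel
    (p := fun i : ℕ × ℕ => combLaw (fun x y => x - y) (walkLaw η i.1) (walkLaw θ i.2))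
    (deg := fun i => i.1 + i.2)
    (Ψr := fun r k => (1 - r * charfn η k)⁻¹ * (1 - r * charfn θ k)⁻¹)
    (Ψ := fun k => (1 - charfn η k)⁻¹ * (1 - charfn θ k)⁻¹)
    (integrable_norm_window_mul_zpow (a := -4) (by norm_num) (C * C'))
    (fun r hr => ?_) (fun r hr k => ?_) (fun r hr => ?_) ?_
    (fun r hr => ((continuous_inv_one_sub hr).mul (continuous_inv_one_sub hr)).aestronglyMeasurable) z
  · simp only [pow_add]
    exact (summable_geometric_of_lt_one hr.1 hr.2).mul_of_nonneg
      (summable_geometric_of_lt_one hr.1 hr.2) (fun n => pow_nonneg hr.1 n) fun n => pow_nonneg hr.1 n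
  · simp only [charfn_combLaw_sub, charfn_walkLaw, charfn_neg_of_symm hs]
    have e : ∀ i : ℕ × ℕ, (r : ℂ) ^ (i.1 + i.2) * (charfn η k ^ i.1 * charfn θ k ^ i.2)
        = (r * charfn η k) ^ i.1 * (r * charfn θ k) ^ i.2 := fun i => by ring
    simp only [e]
    have s1 := norm_mul_charfn_lt (ν := η) hr k
    have s2 := norm_mul_charfn_lt (ν := θ) hr k
    have n1 : Summable fun n : ℕ => ‖(r * charfn η k) ^ n‖ := by
      simp only [norm_pow]; exact summable_geometric_of_lt_one (norm_nonneg _) s1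
    have n2 : Summable fun n : ℕ => ‖(r * charfn θ k) ^ n‖ := by
      simp only [norm_pow]; exact summable_geometric_of_lt_one (norm_nonneg _) s2
    have := (summable_mul_of_summable_norm n1 n2).hasSum
    rwa [← tsum_mul_tsum_of_summable_norm n1 n2, tsum_geometric_of_norm_lt_one s1,
      tsum_geometric_of_norm_lt_one s2] at this
  · filter_upwards [ae_ne_zero_E6] with k hk
    by_cases hw : window k = 0
    · simp [hw]
    · have hp := mem_pbox_of_window_ne_zero hk hw
      rw [norm_mul]
      refine mul_le_mul_of_nonneg_left ?_ (norm_nonneg _)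
      rw [norm_mul]
      calc _ ≤ (C * ‖k‖ ^ (-2 : ℤ)) * (C' * ‖k‖ ^ (-2 : ℤ)) :=
            mul_le_mul (hb r hr k hp) (hb' r hr k hp) (norm_nonneg _) (by positivity)
        _ = _ := by
            rw [show (-4 : ℤ) = -2 + -2 by norm_num, zpow_add₀ (norm_ne_zero_iff.2 hk)]; ring
  · filter_upwards [ae_ne_zero_E6] with k hk hw
    have hp := mem_pbox_of_window_ne_zero hk hw
    exact (hη.tendsto_inv hp).mul (hθ.tendsto_inv hp)

/-! ### Decay of the Green's function -/

lemma StepLaw.sym_one_sub (h : StepLaw ν) : Sym pbox 6 2 fun _ k => 1 - charfn ν k := by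
  have := (sym_charRem (U := pbox) isOpen_pbox zero_notMem_pbox (fun k => norm_le_of_mem_pbox)
    h.moment (M := 6) (n := 2) (j := 0) (a := 2) (by norm_num) (by norm_num) (by norm_num)).neg
    isOpen_pbox
  refine this.congr isOpen_pbox fun v _ k _ => ?_
  rw [charRem_two h.moment h.mean]; ring

lemma StepLaw.sym_inv (h : StepLaw ν) : Sym pbox 6 (-2) fun _ k => (1 - charfn ν k)⁻¹ := by
  obtain ⟨c, hc, hlow⟩ := exists_norm_one_sub_charfn_ge h.moment h.mean h.irr
  refine h.sym_one_sub.inv isOpen_pbox zero_notMem_pbox hc fun v _ k hk => ?_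
  exact_mod_cast hlow k hk

/-- The complement of the support of the window. -/
def farSet : Set E6 := {k | ∃ i, 3 * Real.pi / 2 < |k i|}

lemma isOpen_farSet : IsOpen farSet := by
  have : farSet = ⋃ i, {k : E6 | 3 * Real.pi / 2 < |k i|} := by
    ext k; simp [farSet]
  rw [this]
  exact isOpen_iUnion fun i => isOpen_lt continuous_const (by fun_prop)

lemma zero_notMem_farSet : (0 : E6) ∉ farSet := by
  rintro ⟨i, hi⟩
  simp at hi
  linarith [Real.pi_pos]

/-- The two open sets overlap because `3π/2 < 5π/3`, so symbol bounds may be checked on each of them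
and glued. -/
lemma compl_zero_subset : ({0}ᶜ : Set E6) ⊆ pbox ∪ farSet := by
  intro k hk
  by_cases h : k ∈ farSet
  · exact Or.inr h
  · refine Or.inl ⟨hk, fun i => ?_⟩
    simp only [farSet, Set.mem_ofPred_eq, not_exists, not_lt] at h
    linarith [h i, Real.pi_pos]

/-- On `farSet` the product vanishes identically, whatever `f` is there; in particular the other
points of the dual lattice, where `1 - φ` vanishes, do no harm. -/
lemma sym_window_mul {f : E6 → E6 → ℂ} {M : ℕ} {a : ℤ} (hf : Sym pbox M a f) :
    Sym {0}ᶜ M a fun v k => window k * f v k := by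
  have h1 := (sym_window isOpen_pbox zero_notMem_pbox M le_rfl).mul isOpen_pbox zero_notMem_pbox hf
  rw [zero_add] at h1
  have h2 : Sym farSet M a fun v k => window k * f v k :=
    (sym_zero isOpen_farSet M a).congr isOpen_farSet fun v _ k ⟨i, hi⟩ => by
      rw [window_eq_zero hi.le, zero_mul]
  exact (h1.union h2).mono compl_zero_subset

lemma StepLaw.measurable_inv : Measurable fun k => (1 - charfn ν k)⁻¹ :=
  (measurable_const.sub continuous_charfn.measurable).inv

/-- The symbol `1 / (1 - φ)` has degree `-2`, so its Fourier integral decays like `|z|^(-4)`. -/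
lemma StepLaw.exists_green_le (h : StepLaw ν) :
    ∃ B : ℝ≥0∞, B ≠ ∞ ∧ ∀ z, green ν z ≤ B * weight z ^ 2 := by
  obtain ⟨C0, hC0⟩ := h.sym_inv.bound
  have hint : Integrable fun k => window k * (1 - charfn ν k)⁻¹ := by
    refine (integrable_norm_window_mul_zpow (a := -2) (by norm_num) C0).mono'
      (continuous_window.measurable.mul StepLaw.measurable_inv).aestronglyMeasurable ?_
    filter_upwards [ae_ne_zero_E6] with k hk
    by_cases hw : window k = 0
    · simp [hw]
    · rw [norm_mul]
      gcongr
      exact hC0 0 (by simp) k (mem_pbox_of_window_ne_zero hk hw)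
  obtain ⟨C, hC, hb⟩ := norm_integral_mul_chr_le (a := -2) (M := 6) (by norm_num) (by norm_num)
    hint (sym_window_mul h.sym_inv)
  -- The first summand covers `z = 0`, where the weight is 1. The factor `16 = 2^4` comes from `1 +
  -- |z| ≤ 2 |z|` at the other lattice points.
  refine ⟨green ν 0 + ENNReal.ofReal (16 * C), ENNReal.add_ne_top.2
    ⟨(h.green_fourier 0).1, ENNReal.ofReal_ne_top⟩, fun z => ?_⟩
  rw [add_mul]
  rcases eq_or_ne z 0 with rfl | hz
  · refine le_trans (le_of_eq ?_) le_self_add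
    simp [weight, toE_zero]
  · refine le_trans ?_ le_add_self
    have hz1 := one_le_norm_toE hz
    have hz' : toE z ≠ 0 := norm_ne_zero_iff.1 (by linarith)
    obtain ⟨hfin, hf⟩ := h.green_fourier z
    have h1 := hb (toE z) hz'
    have hpi : (1 : ℝ) ≤ (2 * Real.pi) ^ 6 := one_le_pow₀ (by linarith [Real.pi_gt_three])
    have h2 : (green ν z).toReal ≤ C * ‖toE z‖ ^ (-4 : ℤ) := by
      rw [hf, norm_mul, Complex.norm_real, Real.norm_of_nonneg ENNReal.toReal_nonneg] at h1
      have e : ‖((2 * Real.pi) ^ 6 : ℂ)‖ = (2 * Real.pi) ^ 6 := by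
        rw [norm_pow, norm_mul, Complex.norm_real, Real.norm_of_nonneg Real.pi_pos.le]
        norm_num
      rw [e] at h1
      refine le_trans (le_mul_of_one_le_left ENNReal.toReal_nonneg hpi) ?_
      exact h1
    rw [← ENNReal.ofReal_toReal hfin, weight_sq, ← ENNReal.ofReal_mul (by positivity)]
    refine ENNReal.ofReal_le_ofReal (h2.trans ?_)
    rw [mul_comm 16 C, mul_assoc]
    gcongr
    rw [zpow_neg, ← div_eq_mul_inv, inv_eq_one_div, div_le_div_iff₀ (by positivity) (by positivity),
      one_mul]
    calc (1 + ‖toE z‖) ^ 4 ≤ (2 * ‖toE z‖) ^ 4 := by gcongr; linarith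
      _ = 16 * ‖toE z‖ ^ (4 : ℤ) := by
        rw [mul_pow]; norm_cast

end

section

/-! ### Comparison with the Gaussian symbol -/

lemma exists_exp_neg_sq_le {c : ℝ} (hc : 0 < c) {a : ℤ} (ha : a ≤ 0) :
    ∃ C : ℝ, 0 ≤ C ∧ ∀ r : ℝ, 0 < r → Real.exp (-(c * r ^ 2)) ≤ C * r ^ a := by
  obtain ⟨n, rfl⟩ : ∃ n : ℕ, a = -(n : ℤ) := ⟨a.natAbs, by omega⟩
  refine ⟨1 + n.factorial / c ^ n, by positivity, fun r hr => ?_⟩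
  have h1 : r ^ n ≤ 1 + r ^ (2 * n) := by
    rcases le_total r 1 with h | h
    · exact (pow_le_one₀ hr.le h).trans (by linarith [pow_pos hr (2 * n)])
    · exact (pow_le_pow_right₀ h (by omega : n ≤ 2 * n)).trans (by linarith)
  have h2 := Real.pow_div_factorial_le_exp (c * r ^ 2) (by positivity) n
  have h3 : r ^ (2 * n) ≤ n.factorial / c ^ n * Real.exp (c * r ^ 2) := by
    rw [div_le_iff₀ (by positivity), mul_pow, ← pow_mul] at h2
    rw [div_mul_eq_mul_div, le_div_iff₀ (by positivity)]
    linarith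
  have h4 : (1 : ℝ) ≤ Real.exp (c * r ^ 2) := Real.one_le_exp (by positivity)
  rw [Real.exp_neg, zpow_neg, zpow_natCast, ← div_eq_mul_inv, le_div_iff₀ (by positivity),
    inv_mul_le_iff₀ (Real.exp_pos _)]
  linarith

section
variable {η θ : PMF (Fin 6 → ℤ)}

/-- The factor `exp (-(Q_η + Q_θ) / 2)`. -/
def gaussExp (η θ : PMF (Fin 6 → ℤ)) (k : E6) : ℂ :=
  Complex.exp (-(((covQ η k + covQ θ k) / 2 : ℝ) : ℂ))

/-- The symbol whose inverse Fourier transform approximates the limit function. -/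
def gaussSymbol (η θ : PMF (Fin 6 → ℤ)) (k : E6) : ℂ :=
  gaussExp η θ k * ((2 * (covQ η k : ℂ)⁻¹) * (2 * (covQ θ k : ℂ)⁻¹))

lemma norm_gaussExp (k : E6) : ‖gaussExp η θ k‖ = Real.exp (-((covQ η k + covQ θ k) / 2)) := by
  rw [gaussExp, ← Complex.ofReal_neg, Complex.norm_exp, Complex.ofReal_re]

lemma sym_half_covQ {U : Set E6} (hU : IsOpen U) (hη : StepLaw η) (hθ : StepLaw θ) (M : ℕ) :
    Sym U M 2 fun _ k => (((covQ η k + covQ θ k) / 2 : ℝ) : ℂ) :=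
  (((sym_covQ hU hη.moment M).add hU (sym_covQ hU hθ.moment M)).const_mul hU (1 / 2)).congr hU
    fun v _ k _ => by push_cast; ring

lemma symBound_gaussExp {U : Set E6} (h0 : (0 : E6) ∉ U) (hη : StepLaw η) (_hθ : StepLaw θ)
    {a : ℤ} (ha : a ≤ 0) : SymBound U a fun _ k => gaussExp η θ k := by
  obtain ⟨c, hc, hQ⟩ := exists_covQ_ge hη.moment hη.irr
  obtain ⟨C, hC, hb⟩ := exists_exp_neg_sq_le (c := c / 2) (by positivity) ha
  refine ⟨C, fun v _ k hk => ?_⟩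
  have hk0 : 0 < ‖k‖ := norm_pos_iff.2 fun h => h0 (h ▸ hk)
  refine le_trans ?_ (hb ‖k‖ hk0)
  rw [norm_gaussExp]
  refine Real.exp_le_exp.2 ?_
  have := hQ k
  have := covQ_nonneg (ν := θ) k
  linarith

lemma sym_gaussExp {U : Set E6} (hU : IsOpen U) (h0 : (0 : E6) ∉ U) (hη : StepLaw η)
    (hθ : StepLaw θ) (M : ℕ) {a : ℤ} (ha : a ≤ 0) : Sym U M a fun _ k => gaussExp η θ k :=
  Sym.cexp_neg hU h0 (fun M => sym_half_covQ hU hη hθ M)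
    (fun _ ha => symBound_gaussExp h0 hη hθ ha) ha

lemma sym_inv_covQ {U : Set E6} (hU : IsOpen U) (h0 : (0 : E6) ∉ U) {ν : PMF (Fin 6 → ℤ)}
    (h : StepLaw ν) (M : ℕ) : Sym U M (-2) fun _ k => 2 * (covQ ν k : ℂ)⁻¹ := by
  obtain ⟨c, hc, hQ⟩ := exists_covQ_ge h.moment h.irr
  refine ((sym_covQ hU h.moment M).inv hU h0 hc fun v _ k _ => ?_).const_mul hU 2
  rw [Complex.norm_real, Real.norm_of_nonneg (covQ_nonneg k)]
  exact_mod_cast hQ k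

/-- The exponential provides any further decay: degree `-4` is what is used near the origin, degree
`-8` what is used for integrability at infinity. -/
lemma sym_gaussSymbol {U : Set E6} (hU : IsOpen U) (h0 : (0 : E6) ∉ U) (hη : StepLaw η)
    (hθ : StepLaw θ) (M : ℕ) {a : ℤ} (ha : a ≤ -4) : Sym U M a fun _ k => gaussSymbol η θ k := by
  have := (sym_gaussExp hU h0 hη hθ M (a := a + 4) (by omega)).mul hU h0
    ((sym_inv_covQ hU h0 hη M).mul hU h0 (sym_inv_covQ hU h0 hθ M))
  rwa [show a + 4 + (-2 + -2) = a by ring] at this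

lemma integrable_gaussSymbol (hη : StepLaw η) (hθ : StepLaw θ) :
    Integrable (gaussSymbol η θ) := by
  obtain ⟨C, hC⟩ := (sym_gaussSymbol isOpen_compl_singleton zero_notMem_compl hη hθ 0
    (a := -4) le_rfl).bound
  obtain ⟨C', hC'⟩ := (sym_gaussSymbol isOpen_compl_singleton zero_notMem_compl hη hθ 0
    (a := -8) (by norm_num)).bound
  refine integrable_of_norm_le_zpow (a := -4) (b := -8) ?_ (by norm_num) (by norm_num)
    (ae_ne_zero_E6.mono fun k hk => hC 0 (by simp) k hk)
    (ae_ne_zero_E6.mono fun k hk => hC' 0 (by simp) k hk)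
  have h1 := continuous_covQ hη.moment
  have h2 := continuous_covQ hθ.moment
  have m1 : Measurable fun k => (covQ η k : ℂ)⁻¹ :=
    (Complex.continuous_ofReal.comp h1).measurable.inv
  have m2 : Measurable fun k => (covQ θ k : ℂ)⁻¹ :=
    (Complex.continuous_ofReal.comp h2).measurable.inv
  have m3 : Measurable (gaussExp η θ) := by
    have : Continuous (gaussExp η θ) := by unfold gaussExp; fun_prop
    exact this.measurable
  exact (m3.mul ((m1.const_mul 2).mul (m2.const_mul 2))).aestronglyMeasurable

lemma pbox_norm_le : ∀ k ∈ pbox, ‖k‖ ≤ 5 * Real.pi := fun _ => norm_le_of_mem_pbox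

/-- The difference equals `(φ - 1 + Q/2) · (1 - φ)⁻¹ · (2/Q)`, of degree `3 - 2 - 2`. -/
lemma StepLaw.sym_inv_sub {ν : PMF (Fin 6 → ℤ)} (h : StepLaw ν) :
    Sym pbox 6 (-1) fun _ k => (1 - charfn ν k)⁻¹ - 2 * (covQ ν k : ℂ)⁻¹ := by
  have h3 := sym_charRem (U := pbox) isOpen_pbox zero_notMem_pbox pbox_norm_le h.moment (M := 6)
    (n := 3) (j := 0) (a := 3) (by norm_num) (by norm_num) (by norm_num)
  have := (h3.mul isOpen_pbox zero_notMem_pbox h.sym_inv).mul isOpen_pbox zero_notMem_pbox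
    (sym_inv_covQ isOpen_pbox zero_notMem_pbox h 6)
  refine this.congr isOpen_pbox fun v _ k hk => ?_
  have hne := h.charfn_ne_one hk
  have hQ : (covQ ν k : ℂ) ≠ 0 := by
    exact_mod_cast (covQ_pos h.moment h.irr hk.1).ne'
  rw [charRem_three h.moment h.mean]
  field_simp
  ring

/-- The function vanishes near the origin, and where `|k| > 1` a symbol of degree 0 is also one of
degree 1. -/
lemma sym_window_sub_one : Sym pbox 6 1 fun _ k => window k - 1 := by
  have hV : IsOpen (pbox ∩ {k : E6 | 1 < ‖k‖}) :=
    isOpen_pbox.inter (isOpen_lt continuous_const continuous_norm)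
  have hV0 : (0 : E6) ∉ pbox ∩ {k : E6 | 1 < ‖k‖} := fun h => zero_notMem_pbox h.1
  have hW : IsOpen (pbox ∩ Metric.ball (0 : E6) (Real.pi / 2)) := isOpen_pbox.inter Metric.isOpen_ball
  have h1 : Sym (pbox ∩ Metric.ball (0 : E6) (Real.pi / 2)) 6 1 fun _ k => window k - 1 :=
    (sym_zero hW 6 1).congr hW fun v _ k hk => by
      rw [window_eq_one (mem_ball_zero_iff.1 hk.2).le, sub_self]
  have h2 : Sym (pbox ∩ {k : E6 | 1 < ‖k‖}) 6 1 fun _ k => window k - 1 := by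
    refine Sym.of_weight_le (a := 0) (c := 1) hV0 (fun k hk => ?_)
      ((sym_window hV hV0 6 le_rfl).sub hV (sym_const hV 6 1))
    simpa using le_of_lt hk.2
  refine (h1.union h2).mono fun k hk => ?_
  by_cases h : 1 < ‖k‖
  · exact Or.inr ⟨hk, h⟩
  · refine Or.inl ⟨hk, mem_ball_zero_iff.2 ?_⟩
    linarith [Real.pi_gt_three, not_lt.1 h]

/-- `|exp(-q) - 1| ≤ q` gives a quadratic bound, more than is needed. The derivative `-q' exp(-q)`
has degree 1, which on a bounded set may be lowered to 0. -/
lemma sym_gaussExp_sub_one (hη : StepLaw η) (hθ : StepLaw θ) :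
    Sym pbox 6 1 fun _ k => gaussExp η θ k - 1 := by
  have hE := sym_gaussExp isOpen_pbox zero_notMem_pbox hη hθ 6 (a := 0) le_rfl
  have hq := sym_half_covQ isOpen_pbox hη hθ 6
  refine Sym.intro isOpen_pbox
    (f' := fun v k => -(dirD (fun _ k => (((covQ η k + covQ θ k) / 2 : ℝ) : ℂ)) v k
      * gaussExp η θ k)) ?_ (fun v hv k hk => ?_) ?_
  · obtain ⟨C, hC⟩ := hq.bound
    refine ⟨|C| * (5 * Real.pi), fun v hv k hk => ?_⟩
    have h1 := hC v hv k hk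
    have hk0 : 0 < ‖k‖ := norm_pos_iff.2 hk.1
    have hnn : 0 ≤ (covQ η k + covQ θ k) / 2 := by
      have := covQ_nonneg (ν := η) k
      have := covQ_nonneg (ν := θ) k
      positivity
    have h2 : ‖gaussExp η θ k - 1‖ ≤ (covQ η k + covQ θ k) / 2 := by
      rw [gaussExp, ← Complex.ofReal_neg, ← Complex.ofReal_exp, ← Complex.ofReal_one,
        ← Complex.ofReal_sub, Complex.norm_real, Real.norm_eq_abs, abs_sub_comm,
        abs_of_nonneg (by linarith [Real.exp_le_one_iff.2 (neg_nonpos.2 hnn)])]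
      linarith [Real.add_one_le_exp (-((covQ η k + covQ θ k) / 2))]
    rw [Complex.norm_real, Real.norm_of_nonneg hnn] at h1
    calc ‖gaussExp η θ k - 1‖ ≤ C * ‖k‖ ^ (2 : ℤ) := h2.trans h1
      _ ≤ |C| * ‖k‖ ^ (2 : ℤ) := by gcongr; exact le_abs_self C
      _ = |C| * ‖k‖ * ‖k‖ ^ (1 : ℤ) := by rw [zpow_one]; norm_cast; ring
      _ ≤ |C| * (5 * Real.pi) * ‖k‖ ^ (1 : ℤ) := by gcongr; exact pbox_norm_le k hk
  · have := ((hq.2.1.hasDerivAt hv hk).neg.cexp).sub_const (1 : ℂ)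
    refine this.congr_deriv ?_
    simp [gaussExp]; ring
  · refine Sym.neg isOpen_pbox ?_
    have := (hq.2.2).mul isOpen_pbox zero_notMem_pbox hE.of_succ
    exact Sym.of_le_of_bounded zero_notMem_pbox pbox_norm_le (by norm_num) this

/-- The difference between the symbol of the lattice sum and the Gaussian symbol. -/
def symbolDiff (η θ : PMF (Fin 6 → ℤ)) (k : E6) : ℂ :=
  window k * ((1 - charfn η k)⁻¹ * (1 - charfn θ k)⁻¹) - gaussSymbol η θ k

/-- With `A, B` the lattice factors, `a, b` their Gaussian counterparts, `w` the window and `e` the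
exponential, `wAB - eab = w(A - a)B + wa(B - b) + ((w - 1) - (e - 1))ab`. The degrees are `-1 - 2`,
`-2 - 1` and `1 - 4`. -/
lemma sym_symbolDiff_pbox (hη : StepLaw η) (hθ : StepLaw θ) :
    Sym pbox 6 (-3) fun _ k => symbolDiff η θ k := by
  have hU := isOpen_pbox
  have h0 := zero_notMem_pbox
  have hw := sym_window hU h0 6 (a := 0) le_rfl
  have t1 := (hw.mul hU h0 (hη.sym_inv_sub.mul hU h0 hθ.sym_inv))
  have t2 := (hw.mul hU h0 ((sym_inv_covQ hU h0 hη 6).mul hU h0 hθ.sym_inv_sub))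
  have t3 := ((sym_window_sub_one.sub hU (sym_gaussExp_sub_one hη hθ)).mul hU h0
    ((sym_inv_covQ hU h0 hη 6).mul hU h0 (sym_inv_covQ hU h0 hθ 6)))
  have := (t1.add hU t2).add hU t3
  refine this.congr hU fun v _ k hk => ?_
  simp only [symbolDiff, gaussSymbol]
  ring

lemma sym_symbolDiff (hη : StepLaw η) (hθ : StepLaw θ) :
    Sym {0}ᶜ 6 (-3) fun _ k => symbolDiff η θ k := by
  refine ((sym_symbolDiff_pbox hη hθ).union (V := farSet) ?_).mono compl_zero_subset
  have h1 : Sym farSet 6 (-3) fun _ k => gaussSymbol η θ k := by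
    refine Sym.of_weight_le (a := -4) (c := 1) zero_notMem_farSet (fun k hk => ?_)
      (sym_gaussSymbol isOpen_farSet zero_notMem_farSet hη hθ 6 le_rfl)
    obtain ⟨i, hi⟩ := hk
    have h2 : |k i| ≤ ‖k‖ := PiLp.norm_apply_le k i
    rw [one_mul]
    exact zpow_le_zpow_right₀ (by linarith [Real.pi_gt_three]) (by norm_num)
  refine (h1.neg isOpen_farSet).congr isOpen_farSet fun v _ k hk => ?_
  obtain ⟨i, hi⟩ := hk
  rw [symbolDiff, window_eq_zero hi.le]
  ring

lemma integrable_window_inv_inv (hη : StepLaw η) (hθ : StepLaw θ) :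
    Integrable fun k => window k * ((1 - charfn η k)⁻¹ * (1 - charfn θ k)⁻¹) := by
  obtain ⟨C, hC⟩ := (hη.sym_inv.mul isOpen_pbox zero_notMem_pbox hθ.sym_inv).bound
  refine (integrable_norm_window_mul_zpow (a := -2 + -2) (by norm_num) C).mono'
    (continuous_window.measurable.mul
      (StepLaw.measurable_inv.mul StepLaw.measurable_inv)).aestronglyMeasurable ?_
  filter_upwards [ae_ne_zero_E6] with k hk
  by_cases hw : window k = 0
  · simp [hw]
  · rw [norm_mul]
    exact mul_le_mul_of_nonneg_left (hC 0 (by simp) k (mem_pbox_of_window_ne_zero hk hw))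
      (norm_nonneg _)

/-- A symbol of degree `-3` has Fourier integral `O(|z|^(-3))` in dimension 6. Six derivatives are
enough, as `-3 - 6 < -6`. -/
theorem tsum_green_mul_green_sub_le (hη : StepLaw η) (hθ : StepLaw θ)
    (hs : ∀ x, θ (-x) = θ x) : ∃ C : ℝ, ∀ z : Fin 6 → ℤ, z ≠ 0 →
      ‖(2 * Real.pi) ^ 6 * ((∑' x, green η (z + x) * green θ x).toReal : ℂ)
        - ∫ k, gaussSymbol η θ k * chr (toE z) k‖ ≤ C * ‖toE z‖ ^ (-3 : ℤ) := by
  have hi1 := integrable_window_inv_inv hη hθ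
  have hi2 := integrable_gaussSymbol hη hθ
  obtain ⟨C, -, hC⟩ := norm_integral_mul_chr_le (a := -3) (M := 6) (by norm_num) (by norm_num)
    (f := symbolDiff η θ) (hi1.sub hi2) (sym_symbolDiff hη hθ)
  refine ⟨C, fun z hz => ?_⟩
  have hz' : toE z ≠ 0 := norm_ne_zero_iff.1 (by linarith [one_le_norm_toE hz])
  have := hC (toE z) hz'
  rw [← (tsum_green_mul_green_fourier hη hθ hs z).2, ← integral_sub
    (Integrable.mul_chr hi1 (toE z)) (Integrable.mul_chr hi2 (toE z))]
  simp only [symbolDiff, sub_mul] at this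
  exact this

end

end

section

/-! ### The covariance matrix and Gaussian kernels -/

section
variable {ν : PMF (Fin 6 → ℤ)}

lemma covMatrix_apply (h0 : MeanZero ν) (i j : Fin 6) :
    covMatrix ν i j = ∫ x, (x i : ℝ) * x j ∂ν.toMeasure := by
  simp only [covMatrix, Matrix.of_apply, covariance]
  rw [h0 i, h0 j]
  simp

lemma covQ_eq_dotProduct (h : StepLaw ν) (k : E6) :
    covQ ν k = k.ofLp ⬝ᵥ (covMatrix ν *ᵥ k.ofLp) := by
  have hi : ∀ i j : Fin 6, Integrable (fun x : Fin 6 → ℤ => (x i : ℝ) * x j) ν.toMeasure :=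
    fun i j => by
      have := integrable_inner_mul_inner h.moment (EuclideanSpace.single i 1)
        (EuclideanSpace.single j 1)
      simpa [inner_toE, PiLp.single_apply] using this
  simp only [covQ, inner_toE, dotProduct, Matrix.mulVec, covMatrix_apply h.mean]
  have e : ∀ x : Fin 6 → ℤ, (∑ i, k i * (x i : ℝ)) ^ 2
      = ∑ i, ∑ j, k i * k j * ((x i : ℝ) * x j) := fun x => by
    rw [sq, Finset.sum_mul_sum]
    exact Finset.sum_congr rfl fun i _ => Finset.sum_congr rfl fun j _ => by ring
  simp only [e]
  rw [integral_finsetSum _ fun i _ => integrable_finsetSum _ fun j _ => (hi i j).const_mul _]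
  refine Finset.sum_congr rfl fun i _ => ?_
  rw [integral_finsetSum _ fun j _ => (hi i j).const_mul _, Finset.mul_sum]
  refine Finset.sum_congr rfl fun j _ => ?_
  rw [integral_const_mul]
  ring

lemma posDef_covMatrix (h : StepLaw ν) : (covMatrix ν).PosDef := by
  refine Matrix.PosDef.of_dotProduct_mulVec_pos ?_ fun x hx => ?_
  · ext i j
    simp only [Matrix.conjTranspose_apply, star_trivial, covMatrix_apply h.mean]
    simp only [mul_comm]
  · have := covQ_pos h.moment h.irr (k := WithLp.toLp 2 x) (by simpa using hx)
    rw [covQ_eq_dotProduct h] at this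
    simpa using this

open scoped MatrixOrder ComplexOrder in
lemma exists_symm_sqrt (h : StepLaw ν) : ∃ S : Matrix (Fin 6) (Fin 6) ℝ,
    Sᵀ = S ∧ S * S = covMatrix ν ∧ S.det ≠ 0 ∧ |S.det| = √(covMatrix ν).det := by
  have hp := posDef_covMatrix h
  have hs : (CFC.sqrt (covMatrix ν)) * (CFC.sqrt (covMatrix ν)) = covMatrix ν :=
    CFC.sqrt_mul_sqrt_self _ hp.posSemidef.nonneg
  have hd : (CFC.sqrt (covMatrix ν)).det * (CFC.sqrt (covMatrix ν)).det = (covMatrix ν).det := by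
    rw [← Matrix.det_mul, hs]
  refine ⟨CFC.sqrt (covMatrix ν), ?_, hs, fun h0 => ?_, ?_⟩
  · have := (Matrix.nonneg_iff_posSemidef.1 (CFC.sqrt_nonneg (covMatrix ν))).isHermitian
    rwa [Matrix.IsHermitian, Matrix.conjTranspose_eq_transpose_of_trivial] at this
  · rw [h0, zero_mul] at hd
    exact hp.det_pos.ne hd
  · rw [← hd, Real.sqrt_mul_self_eq_abs]

/-- `L` is the symmetric square root of the covariance matrix. It turns `Q` and `J` into Euclidean
norms, so that Gaussian integrals reduce to the isotropic case with Jacobian `√det Γ`. -/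
lemma exists_linearEquiv (h : StepLaw ν) : ∃ L : E6 ≃L[ℝ] E6,
    (∀ k, covQ ν k = ‖L k‖ ^ 2) ∧ (∀ x, normJ ν x = ‖L.symm x‖) ∧
    (∀ k x, inner ℝ k (L x) = inner ℝ (L k) x) ∧
    |LinearMap.det (L : E6 →ₗ[ℝ] E6)| = √(covMatrix ν).det := by
  obtain ⟨S, hT, hS, hd, hdet⟩ := exists_symm_sqrt h
  have hu : IsUnit S.det := isUnit_iff_ne_zero.2 hd
  have hTi : S⁻¹ᵀ = S⁻¹ := by rw [Matrix.transpose_nonsing_inv, hT]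
  have key : ∀ (A : Matrix (Fin 6) (Fin 6) ℝ), Aᵀ = A → ∀ x : E6,
      ‖Matrix.toEuclideanCLM (n := Fin 6) (𝕜 := ℝ) A x‖ ^ 2 = x.ofLp ⬝ᵥ ((A * A) *ᵥ x.ofLp) := by
    intro A hA x
    rw [← real_inner_self_eq_norm_sq, EuclideanSpace.inner_eq_star_dotProduct, star_trivial,
      Matrix.ofLp_toEuclideanCLM, ← Matrix.mulVec_mulVec, Matrix.dotProduct_mulVec x.ofLp,
      ← Matrix.mulVec_transpose, hA]
  refine ⟨ContinuousLinearEquiv.equivOfInverse (Matrix.toEuclideanCLM (n := Fin 6) (𝕜 := ℝ) S)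
    (Matrix.toEuclideanCLM (n := Fin 6) (𝕜 := ℝ) S⁻¹) (fun x => ?_) (fun x => ?_), fun k => ?_,
    fun x => ?_, fun k x => ?_, ?_⟩
  · rw [← mul_apply_eq_comp, ← map_mul, Matrix.nonsing_inv_mul _ hu, map_one]; rfl
  · rw [← mul_apply_eq_comp, ← map_mul, Matrix.mul_nonsing_inv _ hu, map_one]; rfl
  · rw [covQ_eq_dotProduct h, ← hS]
    exact (key S hT k).symm
  · rw [normJ, ← hS, Matrix.mul_inv_rev, ← key S⁻¹ hTi x, Real.sqrt_sq (norm_nonneg _)]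
    rfl
  · simp only [EuclideanSpace.inner_eq_star_dotProduct, star_trivial]
    change (Matrix.toEuclideanCLM (n := Fin 6) (𝕜 := ℝ) S x).ofLp ⬝ᵥ k.ofLp
      = x.ofLp ⬝ᵥ (Matrix.toEuclideanCLM (n := Fin 6) (𝕜 := ℝ) S k).ofLp
    rw [Matrix.ofLp_toEuclideanCLM, Matrix.ofLp_toEuclideanCLM, Matrix.dotProduct_mulVec x.ofLp,
      ← Matrix.mulVec_transpose, hT]
  · rw [← hdet, ← LinearMap.det_toLpLin 2 S]
    rfl

lemma integral_comp_continuousLinearEquiv {F : Type*} [NormedAddCommGroup F] [NormedSpace ℝ F]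
    (L : E6 ≃L[ℝ] E6) (f : E6 → F) :
    ∫ y, f (L y) = |LinearMap.det (L : E6 →ₗ[ℝ] E6)|⁻¹ • ∫ x, f x := by
  have hd : LinearMap.det (L : E6 →ₗ[ℝ] E6) ≠ 0 :=
    (LinearEquiv.isUnit_det' L.toLinearEquiv).ne_zero
  have he : MeasurableEmbedding L := L.toHomeomorph.measurableEmbedding
  have := Measure.map_linearMap_addHaar_eq_smul_addHaar (volume : Measure E6) hd
  rw [← he.integral_map]
  change ∫ x, f x ∂(Measure.map (L : E6 →ₗ[ℝ] E6) volume) = _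
  rw [this, integral_smul_measure, ENNReal.toReal_ofReal (abs_nonneg _), abs_inv]

lemma det_symm (L : E6 ≃L[ℝ] E6) : LinearMap.det (L.symm : E6 →ₗ[ℝ] E6)
    = (LinearMap.det (L : E6 →ₗ[ℝ] E6))⁻¹ := LinearEquiv.det_coe_symm L.toLinearEquiv

/-- The density of the Gaussian law with covariance matrix `t Γ`. -/
def heat (ν : PMF (Fin 6 → ℤ)) (t : ℝ) (x : E6) : ℝ :=
  ((2 * Real.pi * t) ^ 3 * √(covMatrix ν).det)⁻¹ * Real.exp (-(normJ ν x ^ 2 / (2 * t)))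

lemma integral_gauss {b : ℝ} (hb : 0 < b) (w : E6) :
    ∫ v : E6, Complex.exp (-((b * ‖v‖ ^ 2 : ℝ) : ℂ)) * Complex.exp (-(inner ℝ w v : ℂ) * Complex.I)
      = (((Real.pi / b) ^ 3 * Real.exp (-(‖w‖ ^ 2 / (4 * b))) : ℝ) : ℂ) := by
  have := GaussianFourier.integral_cexp_neg_mul_sq_norm_add (V := E6) (b := b) (by simpa using hb)
    (-Complex.I) w
  rw [finrank_euclideanSpace_fin] at this
  have h3 : ((6 : ℕ) / 2 : ℂ) = (3 : ℕ) := by norm_num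
  rw [h3, Complex.cpow_natCast, neg_sq, Complex.I_sq] at this
  calc _ = ∫ v : E6, Complex.exp (-(b : ℂ) * ‖v‖ ^ 2 + -Complex.I * (inner ℝ w v : ℂ)) := by
        refine integral_congr_ae (Eventually.of_forall fun v => ?_)
        simp only [← Complex.exp_add]
        congr 1
        push_cast; ring
    _ = _ := by
        rw [this]
        push_cast
        congr 2
        ring

/-- This transform and its inverse below are both computed directly, by the linear change of
variables, rather than deduced from one another. -/
lemma integral_heat_mul_chr (h : StepLaw ν) {t : ℝ} (ht : 0 < t) (k : E6) :
    ∫ x, (heat ν t x : ℂ) * chr x k = Complex.exp (-((t * covQ ν k / 2 : ℝ) : ℂ)) := by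
  obtain ⟨L, hQ, hJ, hL, hdet⟩ := exists_linearEquiv h
  have hD : 0 < √(covMatrix ν).det := Real.sqrt_pos.2 (posDef_covMatrix h).det_pos
  have h1 := integral_comp_continuousLinearEquiv L fun x => (heat ν t x : ℂ) * chr x k
  rw [hdet, eq_inv_smul_iff₀ hD.ne'] at h1
  rw [← h1]
  have h2 : ∀ y, (heat ν t (L y) : ℂ) * chr (L y) k
      = (((2 * Real.pi * t) ^ 3 * √(covMatrix ν).det)⁻¹ : ℝ) *
        (Complex.exp (-(((2 * t)⁻¹ * ‖y‖ ^ 2 : ℝ) : ℂ)) *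
          Complex.exp (-(inner ℝ (L k) y : ℂ) * Complex.I)) := fun y => by
    simp only [heat, chr, hJ, hL, L.symm_apply_apply]
    rw [Complex.ofReal_mul, mul_assoc, Complex.ofReal_exp, Complex.ofReal_neg, div_eq_inv_mul]
  simp only [h2]
  rw [integral_const_mul, integral_gauss (by positivity), ← hQ, ← Complex.ofReal_mul,
    ← Complex.ofReal_neg, ← Complex.ofReal_exp, Complex.real_smul, ← Complex.ofReal_mul]
  congr 1
  have e : -(covQ ν k / (4 * (2 * t)⁻¹)) = -(t * covQ ν k / 2) := by field_simp; ring
  rw [e]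
  field_simp

lemma integral_exp_covQ_mul_chr (h : StepLaw ν) {t : ℝ} (ht : 0 < t) (x : E6) :
    ∫ k, Complex.exp (-((t * covQ ν k / 2 : ℝ) : ℂ)) * chr x k
      = (2 * Real.pi) ^ 6 * (heat ν t x : ℂ) := by
  obtain ⟨L, hQ, hJ, hL, hdet⟩ := exists_linearEquiv h
  have hD : 0 < √(covMatrix ν).det := Real.sqrt_pos.2 (posDef_covMatrix h).det_pos
  have h1 := integral_comp_continuousLinearEquiv L.symm
    fun k => Complex.exp (-((t * covQ ν k / 2 : ℝ) : ℂ)) * chr x k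
  rw [det_symm, abs_inv, inv_inv, hdet, eq_comm, ← eq_inv_smul_iff₀ hD.ne'] at h1
  rw [h1]
  have h2 : ∀ y, Complex.exp (-((t * covQ ν (L.symm y) / 2 : ℝ) : ℂ)) * chr x (L.symm y)
      = (Complex.exp (-((t / 2 * ‖y‖ ^ 2 : ℝ) : ℂ)) *
          Complex.exp (-(inner ℝ (L.symm x) y : ℂ) * Complex.I)) := fun y => by
    simp only [chr, hQ, L.apply_symm_apply]
    have : inner ℝ (L.symm y) x = inner ℝ (L.symm x) y := by
      have := hL (L.symm y) (L.symm x)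
      rw [L.apply_symm_apply, L.apply_symm_apply] at this
      rw [this, real_inner_comm]
    rw [this, mul_div_right_comm]
  simp only [h2]
  rw [integral_gauss (by positivity), ← hJ, Complex.real_smul, ← Complex.ofReal_mul]
  have e : ((2 * Real.pi) ^ 6 : ℂ) = (((2 * Real.pi) ^ 6 : ℝ) : ℂ) := by push_cast; ring
  rw [e, ← Complex.ofReal_mul, heat]
  congr 1
  have e : normJ ν x ^ 2 / (4 * (t / 2)) = normJ ν x ^ 2 / (2 * t) := by congr 1; ring
  rw [e]
  field_simp

lemma normJ_smul (h : StepLaw ν) (c : ℝ) (x : E6) : normJ ν (c • x) = |c| * normJ ν x := by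
  obtain ⟨L, -, hJ, -, -⟩ := exists_linearEquiv h
  rw [hJ, hJ, map_smul, norm_smul, Real.norm_eq_abs]

lemma continuous_normJ (h : StepLaw ν) : Continuous (normJ ν) := by
  obtain ⟨L, -, hJ, -, -⟩ := exists_linearEquiv h
  rw [funext hJ]
  fun_prop

lemma exists_normJ_ge (h : StepLaw ν) : ∃ c : ℝ, 0 < c ∧ ∀ x, c * ‖x‖ ≤ normJ ν x := by
  obtain ⟨L, -, hJ, -, -⟩ := exists_linearEquiv h
  have h0 : 0 < ‖(L : E6 →L[ℝ] E6)‖ + 1 := by positivity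
  refine ⟨(‖(L : E6 →L[ℝ] E6)‖ + 1)⁻¹, inv_pos.2 h0, fun x => ?_⟩
  rw [hJ, inv_mul_le_iff₀ h0]
  have h1 := (L : E6 →L[ℝ] E6).le_opNorm (L.symm x)
  rw [ContinuousLinearEquiv.coe_coe, L.apply_symm_apply] at h1
  nlinarith [norm_nonneg (L.symm x)]

lemma normJ_pos (h : StepLaw ν) {x : E6} (hx : x ≠ 0) : 0 < normJ ν x := by
  obtain ⟨c, hc, hJ⟩ := exists_normJ_ge h
  exact lt_of_lt_of_le (mul_pos hc (norm_pos_iff.2 hx)) (hJ x)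

lemma greenConst_eq (ν : PMF (Fin 6 → ℤ)) :
    greenConst ν = (2 * Real.pi ^ 3 * √(covMatrix ν).det)⁻¹ := by
  have h1 : ((6 : ℕ) : ℝ) / 2 = (3 : ℕ) := by norm_num
  have h2 : Real.Gamma ((3 : ℕ) : ℝ) = 2 := by
    have := Real.Gamma_nat_eq_factorial 2
    norm_num [Nat.factorial] at this ⊢
  rw [greenConst, h1, h2, Real.rpow_natCast]
  norm_num
  field_simp
  norm_num

end

end

section

/-! ### Time integrals of the Gaussian kernels -/

section
variable {ν : PMF (Fin 6 → ℤ)}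

lemma integral_Ioi_exp_mul {q : ℝ} (hq : 0 < q) :
    IntegrableOn (fun t : ℝ => Real.exp (-(t * q / 2))) (Set.Ioi 1) ∧
      ∫ t in Set.Ioi (1 : ℝ), Real.exp (-(t * q / 2)) = Real.exp (-(q / 2)) * (2 * q⁻¹) := by
  have e : ∀ t : ℝ, Real.exp (-(t * q / 2)) = Real.exp (-(q / 2) * t) := fun t => by
    congr 1; ring
  simp only [e]
  refine ⟨exp_neg_integrableOn_Ioi 1 (by positivity), ?_⟩
  rw [integral_exp_mul_Ioi (by linarith)]
  field_simp

lemma hasDerivAt_primitive {b t : ℝ} (hb : b ≠ 0) (ht : 0 < t) :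
    HasDerivAt (fun t : ℝ => Real.exp (-(b / t)) * (1 / (b * t) + 1 / b ^ 2))
      ((t ^ 3)⁻¹ * Real.exp (-(b / t))) t := by
  have h1 : HasDerivAt (fun t : ℝ => -(b / t)) (b / t ^ 2) t := by
    have := ((hasDerivAt_const t b).div (hasDerivAt_id t) ht.ne').neg
    refine this.congr_deriv ?_
    simp [neg_div]
  have h2 : HasDerivAt (fun t : ℝ => 1 / (b * t) + 1 / b ^ 2) (-(b / (b * t) ^ 2)) t := by
    have := ((hasDerivAt_const t (1 : ℝ)).div ((hasDerivAt_id t).const_mul b)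
      (mul_ne_zero hb ht.ne')).add_const (1 / b ^ 2)
    refine this.congr_deriv ?_
    simp [neg_div]
  refine (h1.exp.mul h2).congr_deriv ?_
  field_simp
  ring

/-- In dimension 6 the time profile `t^(-3) exp(-b/t)` has an elementary primitive. The value `1/b²`
is the integral over all times, and the subtracted term is the contribution of `t ≤ 1`. -/
lemma integral_Ioi_heat_profile {b : ℝ} (hb : 0 < b) :
    IntegrableOn (fun t : ℝ => (t ^ 3)⁻¹ * Real.exp (-(b / t))) (Set.Ioi 1) ∧
      ∫ t in Set.Ioi (1 : ℝ), (t ^ 3)⁻¹ * Real.exp (-(b / t))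
        = 1 / b ^ 2 - Real.exp (-b) * (1 / b + 1 / b ^ 2) := by
  have hd : ∀ t ∈ Set.Ici (1 : ℝ), HasDerivAt
      (fun t : ℝ => Real.exp (-(b / t)) * (1 / (b * t) + 1 / b ^ 2))
      ((t ^ 3)⁻¹ * Real.exp (-(b / t))) t := fun t ht =>
    hasDerivAt_primitive hb.ne' (lt_of_lt_of_le one_pos ht)
  have hlim : Tendsto (fun t : ℝ => Real.exp (-(b / t)) * (1 / (b * t) + 1 / b ^ 2)) atTop
      (𝓝 (1 / b ^ 2)) := by
    have h1 : Tendsto (fun t : ℝ => b / t) atTop (𝓝 0) := tendsto_const_nhds.div_atTop tendsto_id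
    have h2 : Tendsto (fun t : ℝ => 1 / (b * t)) atTop (𝓝 0) :=
      tendsto_const_nhds.div_atTop (tendsto_id.const_mul_atTop hb)
    have h3 := (Real.continuous_exp.tendsto _).comp h1.neg
    have := h3.mul (h2.add_const (1 / b ^ 2))
    simpa using this
  have hpos : ∀ t ∈ Set.Ioi (1 : ℝ), 0 ≤ (t ^ 3)⁻¹ * Real.exp (-(b / t)) := fun t ht => by
    have : (0 : ℝ) < t := lt_trans one_pos ht
    positivity
  refine ⟨integrableOn_Ioi_deriv_of_nonneg' hd hpos hlim, ?_⟩
  rw [integral_Ioi_of_hasDerivAt_of_nonneg' hd hpos hlim]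
  simp

/-- The contribution of the times `t > 1` to the Gaussian Green's function. -/
def lateGreen (ν : PMF (Fin 6 → ℤ)) (x : E6) : ℝ := ∫ t in Set.Ioi (1 : ℝ), heat ν t x

/-- The Gaussian Green's function. -/
def gaussGreen (ν : PMF (Fin 6 → ℤ)) (x : E6) : ℝ := greenConst ν * normJ ν x ^ (-4 : ℤ)

lemma heat_nonneg {t : ℝ} (ht : 0 < t) (x : E6) : 0 ≤ heat ν t x := by
  rw [heat]; positivity

lemma heat_eq (t : ℝ) (x : E6) : heat ν t x = ((2 * Real.pi) ^ 3 * √(covMatrix ν).det)⁻¹ *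
    ((t ^ 3)⁻¹ * Real.exp (-(normJ ν x ^ 2 / 2 / t))) := by
  rw [heat, div_div, mul_pow, mul_right_comm, mul_inv _ (t ^ 3), mul_assoc]

lemma integrableOn_heat (h : StepLaw ν) {x : E6} (hx : x ≠ 0) :
    IntegrableOn (fun t => heat ν t x) (Set.Ioi 1) := by
  have hJ := normJ_pos h hx
  simp only [heat_eq]
  exact (integral_Ioi_heat_profile (b := normJ ν x ^ 2 / 2) (by positivity)).1.const_mul _

lemma gaussGreen_sub_lateGreen (h : StepLaw ν) {x : E6} (hx : x ≠ 0) :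
    gaussGreen ν x - lateGreen ν x = ((2 * Real.pi) ^ 3 * √(covMatrix ν).det)⁻¹ *
      (Real.exp (-(normJ ν x ^ 2 / 2)) * (2 / normJ ν x ^ 2 + 4 / normJ ν x ^ 4)) := by
  have hJ := normJ_pos h hx
  have hD : 0 < √(covMatrix ν).det := Real.sqrt_pos.2 (posDef_covMatrix h).det_pos
  simp only [lateGreen, heat_eq]
  rw [integral_const_mul,
    (integral_Ioi_heat_profile (b := normJ ν x ^ 2 / 2) (by positivity)).2, gaussGreen,
    greenConst_eq]
  have e : normJ ν x ^ (-4 : ℤ) = (normJ ν x ^ 4)⁻¹ := by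
    rw [zpow_neg]; norm_cast
  rw [e]
  field_simp
  ring

lemma lateGreen_nonneg (x : E6) : 0 ≤ lateGreen ν x :=
  setIntegral_nonneg measurableSet_Ioi fun _ ht => heat_nonneg (lt_trans one_pos ht) x

lemma greenConst_nonneg : 0 ≤ greenConst ν := by
  rw [greenConst_eq]; positivity

lemma gaussGreen_nonneg (x : E6) : 0 ≤ gaussGreen ν x :=
  mul_nonneg greenConst_nonneg (zpow_nonneg (Real.sqrt_nonneg _) _)

lemma lateGreen_le (h : StepLaw ν) {x : E6} (hx : x ≠ 0) : lateGreen ν x ≤ gaussGreen ν x := by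
  have := gaussGreen_sub_lateGreen h hx
  have h2 : 0 ≤ ((2 * Real.pi) ^ 3 * √(covMatrix ν).det)⁻¹ *
      (Real.exp (-(normJ ν x ^ 2 / 2)) * (2 / normJ ν x ^ 2 + 4 / normJ ν x ^ 4)) := by positivity
  linarith

lemma exists_normJ_zpow_le (h : StepLaw ν) {a : ℤ} (ha : a ≤ 0) :
    ∃ C : ℝ, 0 ≤ C ∧ ∀ x, x ≠ 0 → normJ ν x ^ a ≤ C * ‖x‖ ^ a := by
  obtain ⟨c, hc, hJ⟩ := exists_normJ_ge h
  refine ⟨c ^ a, by positivity, fun x hx => ?_⟩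
  have hx0 : 0 < ‖x‖ := norm_pos_iff.2 hx
  rw [← mul_zpow]
  exact zpow_le_zpow_of_nonpos_exp (by positivity) (hJ x) ha

lemma exists_gaussGreen_le (h : StepLaw ν) :
    ∃ C : ℝ, 0 ≤ C ∧ ∀ x, x ≠ 0 → gaussGreen ν x ≤ C * ‖x‖ ^ (-4 : ℤ) := by
  obtain ⟨C, hC, hb⟩ := exists_normJ_zpow_le h (a := -4) (by norm_num)
  refine ⟨greenConst ν * C, mul_nonneg greenConst_nonneg hC, fun x hx => ?_⟩
  rw [gaussGreen, mul_assoc]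
  exact mul_le_mul_of_nonneg_left (hb x hx) greenConst_nonneg

/-- The times `t ≤ 1` contribute a term of order `|x|^(-4)` at the origin and of Gaussian decay at
infinity. The exponent `-5` is locally integrable, and convolved with `|x|^(-4)` it gives precisely
`|z|^(-3)`. -/
lemma exists_gaussGreen_sub_le (h : StepLaw ν) :
    ∃ C : ℝ, 0 ≤ C ∧ ∀ x, x ≠ 0 → gaussGreen ν x - lateGreen ν x ≤ C * ‖x‖ ^ (-5 : ℤ) := by
  obtain ⟨C, hC, hb⟩ := exists_normJ_zpow_le h (a := -5) (by norm_num)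
  obtain ⟨C1, hC1, h1⟩ := exists_exp_neg_sq_le (c := 1 / 2) (by norm_num) (a := -1) (by norm_num)
  obtain ⟨C3, hC3, h3⟩ := exists_exp_neg_sq_le (c := 1 / 2) (by norm_num) (a := -3) (by norm_num)
  set D := ((2 * Real.pi) ^ 3 * √(covMatrix ν).det)⁻¹ with hD
  have hD0 : 0 ≤ D := by positivity
  refine ⟨D * (2 * C3 + 4 * C1) * C, by positivity, fun x hx => ?_⟩
  have hJ := normJ_pos h hx
  have e1 := h1 _ hJ
  have e3 := h3 _ hJ
  rw [show 1 / 2 * normJ ν x ^ 2 = normJ ν x ^ 2 / 2 by ring] at e1 e3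
  rw [gaussGreen_sub_lateGreen h hx, ← hD, mul_assoc, mul_assoc]
  refine mul_le_mul_of_nonneg_left ?_ hD0
  calc _ = Real.exp (-(normJ ν x ^ 2 / 2)) * (2 / normJ ν x ^ 2)
        + Real.exp (-(normJ ν x ^ 2 / 2)) * (4 / normJ ν x ^ 4) := by ring
    _ ≤ (C3 * normJ ν x ^ (-3 : ℤ)) * (2 / normJ ν x ^ 2)
        + (C1 * normJ ν x ^ (-1 : ℤ)) * (4 / normJ ν x ^ 4) := by gcongr
    _ = (2 * C3 + 4 * C1) * normJ ν x ^ (-5 : ℤ) := by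
        simp only [zpow_neg]
        norm_cast
        field_simp
    _ ≤ _ := mul_le_mul_of_nonneg_left (hb x hx) (by positivity)

end

end

section

/-! ### Convolutions of homogeneous functions -/

/-- With `r = |z|/2`: on the ball of radius `r` about either singularity the other factor is at most
its value at distance `r`. Off both balls the smaller of `|x|` and `|z + x|` may carry the whole
exponent `a + b < -6`; the two cases account for the constant `Cc` appearing twice. -/
lemma lintegral_conv_norm_zpow_le {a b : ℤ} (ha : -6 < a) (ha0 : a ≤ 0) (hb : -6 < b) (hb0 : b ≤ 0)
    (hab : a + b < -6) : ∃ C : ℝ, 0 ≤ C ∧ ∀ z : E6, z ≠ 0 →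
      ∫⁻ x, ENNReal.ofReal (‖z + x‖ ^ a * ‖x‖ ^ b) ≤ ENNReal.ofReal (C * ‖z‖ ^ (6 + a + b)) := by
  obtain ⟨Ca, hCa, ka⟩ := lintegral_ball_norm_zpow ha
  obtain ⟨Cb, hCb, kb⟩ := lintegral_ball_norm_zpow hb
  obtain ⟨Cc, hCc, kc⟩ := lintegral_compl_ball_norm_zpow hab
  refine ⟨(Cb + Ca + Cc + Cc) * (1 / 2) ^ (6 + a + b), by positivity, fun z hz => ?_⟩
  have hz0 : 0 < ‖z‖ := norm_pos_iff.2 hz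
  set r := ‖z‖ / 2 with hr
  have hr0 : 0 < r := by positivity
  set B : Set E6 := Metric.ball 0 r with hB
  have hBm : MeasurableSet B := Metric.isOpen_ball.measurableSet
  have hm : ∀ c : ℤ, Measurable fun x : E6 => ENNReal.ofReal (‖x‖ ^ c) := fun c =>
    (measurable_norm.pow_const c).ennreal_ofReal
  have hz1 : ∀ x : E6, x ∈ B → r ≤ ‖z + x‖ := fun x hx => by
    have h1 : ‖x‖ < r := mem_ball_zero_iff.1 hx
    have h2 : ‖z‖ ≤ ‖z + x‖ + ‖x‖ := by
      simpa using norm_sub_le (z + x) x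
    linarith
  have hz2 : ∀ x : E6, z + x ∈ B → r ≤ ‖x‖ := fun x hx => by
    have h1 : ‖z + x‖ < r := mem_ball_zero_iff.1 hx
    have h2 : ‖z‖ ≤ ‖z + x‖ + ‖x‖ := by
      simpa using norm_sub_le (z + x) x
    linarith
  set g1 : E6 → ℝ≥0∞ := B.indicator fun x => ENNReal.ofReal (‖x‖ ^ b) with hg1
  set g2 : E6 → ℝ≥0∞ := B.indicator fun x => ENNReal.ofReal (‖x‖ ^ a) with hg2
  set g3 : E6 → ℝ≥0∞ := Bᶜ.indicator fun x => ENNReal.ofReal (‖x‖ ^ (a + b)) with hg3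
  have m1 : Measurable g1 := (hm b).indicator hBm
  have m2 : Measurable g2 := (hm a).indicator hBm
  have m3 : Measurable g3 := (hm (a + b)).indicator hBm.compl
  have hpt : ∀ x : E6, ENNReal.ofReal (‖z + x‖ ^ a * ‖x‖ ^ b) ≤
      ENNReal.ofReal (r ^ a) * g1 x + ENNReal.ofReal (r ^ b) * g2 (z + x) + g3 x + g3 (z + x) := by
    intro x
    by_cases hx : x ∈ B
    · refine le_trans ?_ (le_self_add.trans (le_self_add.trans le_self_add))
      rw [hg1, Set.indicator_of_mem hx, ← ENNReal.ofReal_mul (by positivity)]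
      refine ENNReal.ofReal_le_ofReal (mul_le_mul_of_nonneg_right ?_ (by positivity))
      exact zpow_le_zpow_of_nonpos_exp hr0 (hz1 x hx) ha0
    by_cases hx' : z + x ∈ B
    · refine le_trans ?_ ((le_add_self).trans (le_self_add.trans le_self_add))
      rw [hg2, Set.indicator_of_mem hx', ← ENNReal.ofReal_mul (by positivity), mul_comm]
      refine ENNReal.ofReal_le_ofReal (mul_le_mul_of_nonneg_right ?_ (by positivity))
      exact zpow_le_zpow_of_nonpos_exp hr0 (hz2 x hx') hb0
    have n1 : r ≤ ‖x‖ := by simpa [hB] using hx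
    have n2 : r ≤ ‖z + x‖ := by simpa [hB] using hx'
    rcases le_total ‖x‖ ‖z + x‖ with h | h
    · refine le_trans ?_ ((le_add_self).trans le_self_add)
      rw [hg3, Set.indicator_of_mem (Set.mem_compl hx), zpow_add₀ (by linarith)]
      refine ENNReal.ofReal_le_ofReal (mul_le_mul_of_nonneg_right ?_ (by positivity))
      exact zpow_le_zpow_of_nonpos_exp (by linarith) h ha0
    · refine le_trans ?_ le_add_self
      rw [hg3, Set.indicator_of_mem (Set.mem_compl hx'), zpow_add₀ (by linarith)]
      refine ENNReal.ofReal_le_ofReal (mul_le_mul_of_nonneg_left ?_ (by positivity))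
      exact zpow_le_zpow_of_nonpos_exp (by linarith) h hb0
  have i1 : ∫⁻ x, g1 x ≤ ENNReal.ofReal (Cb * r ^ (6 + b)) := by
    rw [hg1, lintegral_indicator hBm]; exact kb r hr0.le
  have i2 : ∫⁻ x, g2 x ≤ ENNReal.ofReal (Ca * r ^ (6 + a)) := by
    rw [hg2, lintegral_indicator hBm]; exact ka r hr0.le
  have i3 : ∫⁻ x, g3 x ≤ ENNReal.ofReal (Cc * r ^ (6 + (a + b))) := by
    rw [hg3, lintegral_indicator hBm.compl]; exact kc r hr0
  have s2 : Measurable fun x => g2 (z + x) := m2.comp (measurable_const_add z)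
  have s3 : Measurable fun x => g3 (z + x) := m3.comp (measurable_const_add z)
  refine (lintegral_mono hpt).trans ?_
  rw [lintegral_add_right _ s3, lintegral_add_right _ m3, lintegral_add_right _ (s2.const_mul _),
    lintegral_const_mul _ m1, lintegral_const_mul _ s2, lintegral_add_left_eq_self g2 z,
    lintegral_add_left_eq_self g3 z]
  calc _ ≤ ENNReal.ofReal (r ^ a) * ENNReal.ofReal (Cb * r ^ (6 + b))
        + ENNReal.ofReal (r ^ b) * ENNReal.ofReal (Ca * r ^ (6 + a))
        + ENNReal.ofReal (Cc * r ^ (6 + (a + b))) + ENNReal.ofReal (Cc * r ^ (6 + (a + b))) := by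
        gcongr
    _ = _ := by
        rw [← ENNReal.ofReal_mul (by positivity), ← ENNReal.ofReal_mul (by positivity),
          ← ENNReal.ofReal_add (by positivity) (by positivity),
          ← ENNReal.ofReal_add (by positivity) (by positivity),
          ← ENNReal.ofReal_add (by positivity) (by positivity)]
        congr 1
        rw [hr, div_eq_mul_one_div ‖z‖ 2, mul_comm ‖z‖ (1 / 2)]
        have h2 : ((1 : ℝ) / 2) ≠ 0 := by norm_num
        simp only [mul_zpow, zpow_add₀ hz0.ne', zpow_add₀ h2]
        ring

lemma ae_add_ne_zero (z : E6) : ∀ᵐ x : E6, z + x ≠ 0 := by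
  have : {x : E6 | ¬ (z + x ≠ 0)} = {-z} := by
    ext x; simp [add_eq_zero_iff_neg_eq, eq_comm]
  rw [ae_iff, this]
  simp

lemma integrable_conv {f g : E6 → ℝ} (hf : Measurable f) (hg : Measurable g) {a b : ℤ}
    (ha : -6 < a) (ha0 : a ≤ 0) (hb : -6 < b) (hb0 : b ≤ 0) (hab : a + b < -6) {Cf Cg : ℝ}
    (hCf : 0 ≤ Cf) (hCg : 0 ≤ Cg)
    (hfb : ∀ x, x ≠ 0 → |f x| ≤ Cf * ‖x‖ ^ a) (hgb : ∀ x, x ≠ 0 → |g x| ≤ Cg * ‖x‖ ^ b) :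
    ∃ C : ℝ, 0 ≤ C ∧ ∀ z : E6, z ≠ 0 → Integrable (fun x => f (z + x) * g x) ∧
      |∫ x, f (z + x) * g x| ≤ C * ‖z‖ ^ (6 + a + b) := by
  obtain ⟨C, hC, key⟩ := lintegral_conv_norm_zpow_le ha ha0 hb hb0 hab
  refine ⟨Cf * Cg * C, by positivity, fun z hz => ?_⟩
  have hm : Measurable fun x => f (z + x) * g x := (hf.comp (measurable_const_add z)).mul hg
  have hle : ∫⁻ x, ‖f (z + x) * g x‖ₑ ≤ ENNReal.ofReal (Cf * Cg * C * ‖z‖ ^ (6 + a + b)) := by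
    calc _ ≤ ∫⁻ x, ENNReal.ofReal (Cf * Cg) * ENNReal.ofReal (‖z + x‖ ^ a * ‖x‖ ^ b) := by
          refine lintegral_mono_ae ?_
          filter_upwards [ae_ne_zero_E6, ae_add_ne_zero z] with x hx hzx
          rw [← ofReal_norm, ← ENNReal.ofReal_mul (by positivity), norm_mul]
          refine ENNReal.ofReal_le_ofReal ?_
          calc _ ≤ (Cf * ‖z + x‖ ^ a) * (Cg * ‖x‖ ^ b) :=
                mul_le_mul (hfb _ hzx) (hgb _ hx) (abs_nonneg _) (by positivity)
            _ = _ := by ring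
      _ ≤ ENNReal.ofReal (Cf * Cg) * ENNReal.ofReal (C * ‖z‖ ^ (6 + a + b)) := by
          rw [lintegral_const_mul' _ _ ENNReal.ofReal_ne_top]
          gcongr
          exact key z hz
      _ = _ := by
          rw [← ENNReal.ofReal_mul (by positivity)]
          congr 1; ring
  have hint : Integrable fun x => f (z + x) * g x :=
    ⟨hm.aestronglyMeasurable, hle.trans_lt ENNReal.ofReal_lt_top⟩
  refine ⟨hint, ?_⟩
  rw [← Real.norm_eq_abs]
  refine (norm_integral_le_integral_norm _).trans ?_
  rw [integral_norm_eq_lintegral_enorm hm.aestronglyMeasurable]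
  exact ENNReal.toReal_le_of_le_ofReal (by positivity) hle

section
variable {η θ ν : PMF (Fin 6 → ℤ)}

lemma measurable_heat (h : StepLaw ν) : Measurable fun p : ℝ × E6 => heat ν p.1 p.2 := by
  have hJ := (continuous_normJ h).measurable
  unfold heat
  fun_prop

lemma measurable_lateGreen (h : StepLaw ν) : Measurable (lateGreen ν) := by
  have : StronglyMeasurable fun p : E6 × ℝ => heat ν p.2 p.1 :=
    ((measurable_heat h).comp measurable_swap).stronglyMeasurable
  exact (this.integral_prod_right (ν := volume.restrict (Set.Ioi 1))).measurable

lemma measurable_gaussGreen (h : StepLaw ν) : Measurable (gaussGreen ν) :=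
  ((continuous_normJ h).measurable.pow_const (-4 : ℤ)).const_mul _

lemma integrable_heat (h : StepLaw ν) {t : ℝ} (ht : 0 < t) : Integrable (heat ν t) := by
  obtain ⟨c, hc, hJ⟩ := exists_normJ_ge h
  set D := ((2 * Real.pi * t) ^ 3 * √(covMatrix ν).det)⁻¹ with hD
  have hD0 : 0 ≤ D := by positivity
  have key : ∀ a : ℤ, a ≤ 0 → ∃ C, ∀ᵐ x : E6, ‖heat ν t x‖ ≤ C * ‖x‖ ^ a := by
    intro a ha
    obtain ⟨C, hC, hb⟩ := exists_exp_neg_sq_le (c := c ^ 2 / (2 * t)) (by positivity) ha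
    refine ⟨D * C, ae_ne_zero_E6.mono fun x hx => ?_⟩
    have hx0 : 0 < ‖x‖ := norm_pos_iff.2 hx
    rw [Real.norm_of_nonneg (heat_nonneg ht x), heat, ← hD, mul_assoc]
    refine mul_le_mul_of_nonneg_left ((Real.exp_le_exp.2 ?_).trans (hb _ hx0)) hD0
    rw [neg_le_neg_iff, div_mul_eq_mul_div, ← mul_pow]
    gcongr
    exact hJ x
  obtain ⟨C, h1⟩ := key 0 le_rfl
  obtain ⟨C', h2⟩ := key (-8) (by norm_num)
  exact integrable_of_norm_le_zpow (((measurable_heat h).comp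
    (measurable_const.prodMk measurable_id)).aestronglyMeasurable) (by norm_num) (by norm_num) h1 h2

/-- The integral of `exp (-t Q / 2)` over the times `t > 1`. -/
def lateSymbol (ν : PMF (Fin 6 → ℤ)) (k : E6) : ℝ := Real.exp (-(covQ ν k / 2)) * (2 * (covQ ν k)⁻¹)

lemma measurable_lateSymbol (h : StepLaw ν) : Measurable (lateSymbol ν) := by
  have := (continuous_covQ h.moment).measurable
  unfold lateSymbol
  fun_prop

lemma lateSymbol_nonneg (k : E6) : 0 ≤ lateSymbol ν k := by
  have := covQ_nonneg (ν := ν) k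
  rw [lateSymbol]; positivity

lemma integrable_lateSymbol (h : StepLaw ν) : Integrable (lateSymbol ν) := by
  obtain ⟨c, hc, hQ⟩ := exists_covQ_ge h.moment h.irr
  have key : ∀ a : ℤ, a ≤ 0 → ∃ C, ∀ᵐ x : E6, ‖lateSymbol ν x‖ ≤ C * ‖x‖ ^ (a - 2) := by
    intro a ha
    obtain ⟨C, hC, hb⟩ := exists_exp_neg_sq_le (c := c / 2) (by positivity) ha
    refine ⟨C * (2 * c⁻¹), ae_ne_zero_E6.mono fun x hx => ?_⟩
    have hx0 : 0 < ‖x‖ := norm_pos_iff.2 hx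
    have h1 : Real.exp (-(covQ ν x / 2)) ≤ C * ‖x‖ ^ a := by
      refine (Real.exp_le_exp.2 ?_).trans (hb _ hx0)
      linarith [hQ x]
    have h2 : (covQ ν x)⁻¹ ≤ c⁻¹ * ‖x‖ ^ (-2 : ℤ) := by
      refine (inv_anti₀ (by positivity) (hQ x)).trans (le_of_eq ?_)
      rw [mul_inv, zpow_neg]; norm_cast
    rw [Real.norm_of_nonneg (lateSymbol_nonneg x), lateSymbol]
    have hq : 0 ≤ (covQ ν x)⁻¹ := inv_nonneg.2 (covQ_nonneg x)
    calc _ ≤ (C * ‖x‖ ^ a) * (2 * (c⁻¹ * ‖x‖ ^ (-2 : ℤ))) := by gcongr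
      _ = _ := by rw [sub_eq_add_neg, zpow_add₀ hx0.ne']; ring
  obtain ⟨C, h1⟩ := key 0 le_rfl
  obtain ⟨C', h2⟩ := key (-8) (by norm_num)
  exact integrable_of_norm_le_zpow (measurable_lateSymbol h).aestronglyMeasurable
    (by norm_num) (by norm_num) h1 h2

/-- Because the exponentials are positive, integrating the norm over time gives `|Ψ|` times
`lateSymbol`. The integrability assumed is thus exactly the condition for Fubini. -/
lemma integral_time_swap (h : StepLaw ν) {Ψ : E6 → ℂ} (hm : AEStronglyMeasurable Ψ)
    (hi : Integrable fun k => Ψ k * (lateSymbol ν k : ℂ)) :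
    ∫ t in Set.Ioi (1 : ℝ), ∫ k, Ψ k * Complex.exp (-((t * covQ ν k / 2 : ℝ) : ℂ))
      = ∫ k, Ψ k * (lateSymbol ν k : ℂ) := by
  have e : ∀ t k, Complex.exp (-((t * covQ ν k / 2 : ℝ) : ℂ))
      = ((Real.exp (-(t * covQ ν k / 2)) : ℝ) : ℂ) := fun t k => by
    rw [Complex.ofReal_exp, Complex.ofReal_neg]
  simp only [e]
  have hQm := (continuous_covQ h.moment).measurable
  have hmeas : AEStronglyMeasurable (Function.uncurry fun (t : ℝ) (k : E6) =>
      Ψ k * ((Real.exp (-(t * covQ ν k / 2)) : ℝ) : ℂ))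
      ((volume.restrict (Set.Ioi (1 : ℝ))).prod volume) := by
    have m2 : Measurable fun p : ℝ × E6 => ((Real.exp (-(p.1 * covQ ν p.2 / 2)) : ℝ) : ℂ) := by
      fun_prop
    exact (hm.comp_snd).mul m2.aestronglyMeasurable
  rw [integral_integral_swap]
  · refine integral_congr_ae (ae_ne_zero_E6.mono fun k hk => ?_)
    have hq := covQ_pos h.moment h.irr hk
    simp only
    rw [integral_const_mul, integral_complex_ofReal, (integral_Ioi_exp_mul hq).2, lateSymbol]
  · rw [integrable_prod_iff' hmeas]
    refine ⟨ae_ne_zero_E6.mono fun k hk => ?_, ?_⟩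
    · exact ((integral_Ioi_exp_mul (covQ_pos h.moment h.irr hk)).1.ofReal (𝕜 := ℂ)).const_mul (Ψ k)
    · refine hi.norm.congr (ae_ne_zero_E6.mono fun k hk => ?_)
      have hq := covQ_pos h.moment h.irr hk
      simp only [Function.uncurry, norm_mul, Complex.norm_real, Real.norm_eq_abs, Real.abs_exp]
      rw [integral_const_mul, (integral_Ioi_exp_mul hq).2, ← Real.norm_eq_abs,
        Real.norm_of_nonneg (lateSymbol_nonneg k), lateSymbol]

lemma chr_add (x y k : E6) : chr (x + y) k = chr x k * chr y k := by
  simp only [chr, inner_add_right, ← Complex.exp_add]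
  congr 1
  push_cast; ring

lemma lateGreen_fourier (h : StepLaw ν) (x : E6) :
    (2 * Real.pi) ^ 6 * (lateGreen ν x : ℂ) = ∫ k, chr x k * (lateSymbol ν k : ℂ) := by
  have hi : Integrable fun k => chr x k * (lateSymbol ν k : ℂ) := by
    exact (Integrable.mul_chr ((integrable_lateSymbol h).ofReal (𝕜 := ℂ)) x).congr
      (Eventually.of_forall fun k => mul_comm _ _)
  rw [← integral_time_swap h (continuous_chr x).aestronglyMeasurable hi, lateGreen,
    ← integral_complex_ofReal, ← integral_const_mul]
  refine setIntegral_congr_fun measurableSet_Ioi fun t ht => ?_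
  beta_reduce
  rw [← integral_exp_covQ_mul_chr h (lt_trans one_pos ht)]
  simp only [mul_comm]

/-- At a fixed time the second factor is integrable in space, so space and frequency integrals may
be exchanged. `lateGreen` decays only like `|x|^(-4)`, so this exchange is made before integrating
over `t`. -/
lemma integral_lateGreen_mul_heat (hη : StepLaw η) (hθ : StepLaw θ) {t : ℝ} (ht : 0 < t) (z : E6) :
    (2 * Real.pi) ^ 6 * ∫ x, ((lateGreen η (z + x) * heat θ t x : ℝ) : ℂ)
      = ∫ k, chr z k * (lateSymbol η k : ℂ) * Complex.exp (-((t * covQ θ k / 2 : ℝ) : ℂ)) := by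
  have e1 : ∀ k, chr z k * (lateSymbol η k : ℂ) * Complex.exp (-((t * covQ θ k / 2 : ℝ) : ℂ))
      = ∫ x, (heat θ t x : ℂ) * (lateSymbol η k : ℂ) * chr (z + x) k := fun k => by
    rw [← integral_heat_mul_chr hθ ht, ← integral_const_mul]
    refine integral_congr_ae (Eventually.of_forall fun x => ?_)
    simp only [chr_add]; ring
  have e2 : ∀ x, (2 * Real.pi) ^ 6 * ((lateGreen η (z + x) * heat θ t x : ℝ) : ℂ)
      = ∫ k, (heat θ t x : ℂ) * (lateSymbol η k : ℂ) * chr (z + x) k := fun x => by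
    rw [Complex.ofReal_mul, ← mul_assoc, lateGreen_fourier hη, mul_comm, ← integral_const_mul]
    refine integral_congr_ae (Eventually.of_forall fun k => ?_)
    simp only; ring
  simp only [e1]
  rw [← integral_const_mul]
  simp only [e2]
  refine integral_integral_swap ?_
  have hi := (integrable_heat hθ ht).ofReal (𝕜 := ℂ) |>.mul_prod
    ((integrable_lateSymbol hη).ofReal (𝕜 := ℂ))
  have hc : Continuous fun p : E6 × E6 => chr (z + p.1) p.2 := by
    unfold chr; fun_prop
  refine hi.mul_bdd (c := 1) hc.aestronglyMeasurable (Eventually.of_forall fun p => ?_)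
  rw [norm_chr]

end

end

section

/-! ### The limit function -/

section
variable {η θ : PMF (Fin 6 → ℤ)}

lemma exists_abs_gaussGreen_le {ν : PMF (Fin 6 → ℤ)} (h : StepLaw ν) :
    ∃ C : ℝ, 0 ≤ C ∧ ∀ x, x ≠ 0 → |gaussGreen ν x| ≤ C * ‖x‖ ^ (-4 : ℤ) := by
  obtain ⟨C, hC, hb⟩ := exists_gaussGreen_le h
  exact ⟨C, hC, fun x hx => (abs_of_nonneg (gaussGreen_nonneg x)).trans_le (hb x hx)⟩

lemma exists_abs_lateGreen_le {ν : PMF (Fin 6 → ℤ)} (h : StepLaw ν) :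
    ∃ C : ℝ, 0 ≤ C ∧ ∀ x, x ≠ 0 → |lateGreen ν x| ≤ C * ‖x‖ ^ (-4 : ℤ) := by
  obtain ⟨C, hC, hb⟩ := exists_gaussGreen_le h
  exact ⟨C, hC, fun x hx =>
    (abs_of_nonneg (lateGreen_nonneg x)).trans_le ((lateGreen_le h hx).trans (hb x hx))⟩

lemma exists_abs_gaussGreen_sub_le {ν : PMF (Fin 6 → ℤ)} (h : StepLaw ν) :
    ∃ C : ℝ, 0 ≤ C ∧ ∀ x, x ≠ 0 → |gaussGreen ν x - lateGreen ν x| ≤ C * ‖x‖ ^ (-5 : ℤ) := by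
  obtain ⟨C, hC, hb⟩ := exists_gaussGreen_sub_le h
  exact ⟨C, hC, fun x hx =>
    (abs_of_nonneg (sub_nonneg.2 (lateGreen_le h hx))).trans_le (hb x hx)⟩

lemma integrable_lateGreen_mul (hη : StepLaw η) (hθ : StepLaw θ) {z : E6} (hz : z ≠ 0) :
    Integrable fun x => lateGreen η (z + x) * lateGreen θ x := by
  obtain ⟨C, hC, hb⟩ := exists_abs_lateGreen_le hη
  obtain ⟨C', hC', hb'⟩ := exists_abs_lateGreen_le hθ
  obtain ⟨_, -, h⟩ := integrable_conv (measurable_lateGreen hη) (measurable_lateGreen hθ)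
    (by norm_num) (by norm_num) (by norm_num) (by norm_num) (by norm_num) hC hC' hb hb'
  exact (h z hz).1

lemma ofReal_lateSymbol_mul (k : E6) :
    (lateSymbol η k : ℂ) * (lateSymbol θ k : ℂ) = gaussSymbol η θ k := by
  have : gaussExp η θ k = ((Real.exp (-(covQ η k / 2)) * Real.exp (-(covQ θ k / 2)) : ℝ) : ℂ) := by
    rw [← Real.exp_add, gaussExp, ← Complex.ofReal_neg, ← Complex.ofReal_exp]
    congr 2; ring
  rw [gaussSymbol, this, lateSymbol, lateSymbol]
  push_cast; ring

/-- Integrates the fixed-time identity over `t > 1`: on the frequency side this completes the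
Gaussian symbol, on the space side it completes the second Green's function. -/
lemma integral_lateGreen_mul_lateGreen (hη : StepLaw η) (hθ : StepLaw θ) {z : E6} (hz : z ≠ 0) :
    (2 * Real.pi) ^ 6 * ((∫ x, lateGreen η (z + x) * lateGreen θ x : ℝ) : ℂ)
      = ∫ k, gaussSymbol η θ k * chr z k := by
  have hprod : ∀ k, chr z k * (lateSymbol η k : ℂ) * (lateSymbol θ k : ℂ)
      = gaussSymbol η θ k * chr z k := fun k => by
    rw [mul_assoc, ofReal_lateSymbol_mul, mul_comm]
  have hi : Integrable fun k => chr z k * (lateSymbol η k : ℂ) * (lateSymbol θ k : ℂ) := by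
    simp only [hprod]
    exact Integrable.mul_chr (integrable_gaussSymbol hη hθ) z
  have hswap := integral_time_swap hθ (Ψ := fun k => chr z k * (lateSymbol η k : ℂ))
    ((continuous_chr z).measurable.mul
      (Complex.measurable_ofReal.comp (measurable_lateSymbol hη))).aestronglyMeasurable hi
  simp only [hprod] at hswap
  rw [← hswap]
  have h1 : ∀ t ∈ Set.Ioi (1 : ℝ),
      ∫ k, chr z k * (lateSymbol η k : ℂ) * Complex.exp (-((t * covQ θ k / 2 : ℝ) : ℂ))
        = (2 * Real.pi) ^ 6 * ∫ x, ((lateGreen η (z + x) * heat θ t x : ℝ) : ℂ) := fun t ht =>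
    (integral_lateGreen_mul_heat hη hθ (lt_trans one_pos ht) z).symm
  have h2 := setIntegral_congr_fun (μ := volume) measurableSet_Ioi h1
  refine Eq.trans ?_ h2.symm
  rw [integral_const_mul]
  congr 1
  have h3 : ∀ t : ℝ, ∫ x, ((lateGreen η (z + x) * heat θ t x : ℝ) : ℂ)
      = ((∫ x, lateGreen η (z + x) * heat θ t x : ℝ) : ℂ) := fun t => integral_complex_ofReal
  simp only [h3]
  rw [integral_complex_ofReal]
  congr 1
  have h4 : ∀ x, lateGreen η (z + x) * lateGreen θ x
      = ∫ t in Set.Ioi (1 : ℝ), lateGreen η (z + x) * heat θ t x := fun x => by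
    rw [integral_const_mul]; rfl
  have hm : AEStronglyMeasurable (Function.uncurry fun (x : E6) (t : ℝ) =>
      lateGreen η (z + x) * heat θ t x) (volume.prod (volume.restrict (Set.Ioi (1 : ℝ)))) :=
    ((((measurable_lateGreen hη).comp (measurable_const_add z)).comp measurable_fst).mul
      ((measurable_heat hθ).comp measurable_swap)).aestronglyMeasurable
  have hl := integrable_lateGreen_mul hη hθ hz
  simp only [h4]
  refine integral_integral_swap ?_
  rw [integrable_prod_iff hm]
  refine ⟨ae_ne_zero_E6.mono fun x hx => (integrableOn_heat hθ hx).const_mul (lateGreen η (z + x)), ?_⟩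
  refine hl.congr (Eventually.of_forall fun x => ?_)
  beta_reduce
  rw [h4]
  refine setIntegral_congr_fun measurableSet_Ioi fun t ht => ?_
  exact (Real.norm_of_nonneg (mul_nonneg (lateGreen_nonneg _)
    (heat_nonneg (lt_trans one_pos ht) x))).symm

lemma limitF_eq (η θ : PMF (Fin 6 → ℤ)) (z : E6) :
    limitF η θ z = ∫ x, gaussGreen η (z + x) * gaussGreen θ x := by
  rw [limitF, ← integral_const_mul]
  refine integral_congr_ae (Eventually.of_forall fun x => ?_)
  simp only [gaussGreen, kernelF]
  ring

lemma integrable_kernelF (hη : StepLaw η) (hθ : StepLaw θ) {z : E6} (hz : z ≠ 0) :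
    Integrable (kernelF η θ z) := by
  obtain ⟨C, hC, hb⟩ := exists_normJ_zpow_le hη (a := -4) (by norm_num)
  obtain ⟨C', hC', hb'⟩ := exists_normJ_zpow_le hθ (a := -4) (by norm_num)
  obtain ⟨_, -, h⟩ := integrable_conv (f := fun x => normJ η x ^ (-4 : ℤ))
    (g := fun x => normJ θ x ^ (-4 : ℤ))
    ((continuous_normJ hη).measurable.pow_const _) ((continuous_normJ hθ).measurable.pow_const _)
    (by norm_num) (by norm_num) (by norm_num) (by norm_num) (by norm_num) hC hC'
    (fun x hx => (abs_of_nonneg (zpow_nonneg (Real.sqrt_nonneg _) _)).trans_le (hb x hx))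
    (fun x hx => (abs_of_nonneg (zpow_nonneg (Real.sqrt_nonneg _) _)).trans_le (hb' x hx))
  exact (h z hz).1

/-- With `G` the full and `L` the late Green's functions, `G_η G_θ - L_η L_θ = (G_η - L_η) G_θ + L_η
(G_θ - L_θ)`. Each convolution is of order `|z|^(6 - 5 - 4)`. -/
theorem limitF_sub_le (hη : StepLaw η) (hθ : StepLaw θ) : ∃ C : ℝ, 0 ≤ C ∧ ∀ z : E6, z ≠ 0 →
    ‖(2 * Real.pi) ^ 6 * (limitF η θ z : ℂ) - ∫ k, gaussSymbol η θ k * chr z k‖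
      ≤ C * ‖z‖ ^ (-3 : ℤ) := by
  obtain ⟨Cη, pη, bη⟩ := exists_abs_lateGreen_le hη
  obtain ⟨Cθ, pθ, bθ⟩ := exists_abs_gaussGreen_le hθ
  obtain ⟨Dη, qη, dη⟩ := exists_abs_gaussGreen_sub_le hη
  obtain ⟨Dθ, qθ, dθ⟩ := exists_abs_gaussGreen_sub_le hθ
  have lη := measurable_lateGreen hη
  have gη := measurable_gaussGreen hη
  have lθ := measurable_lateGreen hθ
  have gθ := measurable_gaussGreen hθ
  obtain ⟨C1, hC1, h1⟩ := integrable_conv (gη.sub lη) gθ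
    (by norm_num) (by norm_num) (by norm_num) (by norm_num) (by norm_num) qη pθ dη bθ
  obtain ⟨C2, hC2, h2⟩ := integrable_conv lη (gθ.sub lθ)
    (by norm_num) (by norm_num) (by norm_num) (by norm_num) (by norm_num) pη qθ bη dθ
  refine ⟨(2 * Real.pi) ^ 6 * (C1 + C2), by positivity, fun z hz => ?_⟩
  obtain ⟨i1, e1⟩ := h1 z hz
  obtain ⟨i2, e2⟩ := h2 z hz
  have i3 := integrable_lateGreen_mul hη hθ hz
  have key : limitF η θ z - ∫ x, lateGreen η (z + x) * lateGreen θ x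
      = (∫ x, (gaussGreen η - lateGreen η) (z + x) * gaussGreen θ x)
        + ∫ x, lateGreen η (z + x) * (gaussGreen θ - lateGreen θ) x := by
    have i12 : Integrable fun x => (gaussGreen η - lateGreen η) (z + x) * gaussGreen θ x
        + lateGreen η (z + x) * (gaussGreen θ - lateGreen θ) x := i1.add i2
    rw [← integral_add i1 i2, sub_eq_iff_eq_add, ← integral_add i12 i3, limitF_eq]
    refine integral_congr_ae (Eventually.of_forall fun x => ?_)
    simp only [Pi.sub_apply]
    ring
  rw [← integral_lateGreen_mul_lateGreen hη hθ hz, ← mul_sub, ← Complex.ofReal_sub, key, norm_mul,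
    Complex.norm_real, Real.norm_eq_abs]
  have e : ‖((2 * Real.pi) ^ 6 : ℂ)‖ = (2 * Real.pi) ^ 6 := by
    rw [norm_pow, norm_mul, Complex.norm_real, Real.norm_of_nonneg Real.pi_pos.le]
    norm_num
  rw [e, mul_assoc]
  refine mul_le_mul_of_nonneg_left ((abs_add_le _ _).trans ?_) (by positivity)
  rw [add_mul]
  exact add_le_add e1 e2

/-- Substituting `c • x` for `x` gives `c^(-8)` from the kernel and `c^6` from the volume. -/
lemma limitF_smul (hη : StepLaw η) (hθ : StepLaw θ) {c : ℝ} (hc : 0 < c) (z : E6) :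
    limitF η θ (c • z) = c ^ (-2 : ℤ) * limitF η θ z := by
  have h1 : ∀ x, kernelF η θ (c • z) (c • x) = c ^ (-8 : ℤ) * kernelF η θ z x := fun x => by
    rw [kernelF, kernelF, ← smul_add, normJ_smul hη, normJ_smul hθ, abs_of_pos hc, mul_zpow,
      mul_zpow, show (-8 : ℤ) = -4 + -4 by norm_num, zpow_add₀ hc.ne']
    ring
  have h2 := Measure.integral_comp_smul (volume : Measure E6) (kernelF η θ (c • z)) c
  simp only [h1] at h2
  rw [integral_const_mul, finrank_euclideanSpace_fin, abs_of_pos (by positivity), smul_eq_mul,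
    eq_inv_mul_iff_mul_eq₀ (by positivity)] at h2
  rw [limitF, limitF, ← h2, ← mul_assoc (c ^ 6), show (c ^ 6 : ℝ) = c ^ (6 : ℤ) by norm_cast,
    ← zpow_add₀ hc.ne']
  norm_num
  ring

lemma continuous_integral_mul_chr {f : E6 → ℂ} (hf : Integrable f) :
    Continuous fun z => ∫ k, f k * chr z k := by
  refine continuous_of_dominated (bound := fun k => ‖f k‖)
    (fun z => (Integrable.mul_chr hf z).aestronglyMeasurable) (fun z => Eventually.of_forall fun k => ?_)
    hf.norm (Eventually.of_forall fun k => ?_)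
  · rw [norm_mul, norm_chr, mul_one]
  · unfold chr; fun_prop

/-- The limit function is within `O(|z|^(-3))` of a continuous function `G`. By homogeneity `N² G(N
z)` differs from it by `O(|z|^(-3) / N)`, so it is a locally uniform limit of continuous functions
off the origin. The moving singularity of the kernel is never touched. -/
lemma continuousOn_limitF (hη : StepLaw η) (hθ : StepLaw θ) :
    ContinuousOn (limitF η θ) {0}ᶜ := by
  obtain ⟨C, hC, hb⟩ := limitF_sub_le hη hθ
  set F : ℕ → E6 → ℝ := fun n z => (n + 1 : ℝ) ^ 2 *
    (((2 * Real.pi) ^ 6)⁻¹ * (∫ k, gaussSymbol η θ k * chr ((n + 1 : ℝ) • z) k).re) with hF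
  have hFc : ∀ n, Continuous (F n) := fun n => by
    have h1 := continuous_integral_mul_chr (integrable_gaussSymbol hη hθ)
    have h2 : Continuous fun z : E6 => ((n + 1 : ℝ)) • z := continuous_const_smul _
    exact continuous_const.mul (continuous_const.mul (Complex.continuous_re.comp (h1.comp h2)))
  have hdiff : ∀ n : ℕ, ∀ z : E6, z ≠ 0 → |limitF η θ z - F n z|
      ≤ ((2 * Real.pi) ^ 6)⁻¹ * C * ‖z‖ ^ (-3 : ℤ) * (1 / (n + 1 : ℝ)) := by
    intro n z hz
    have hn : (0 : ℝ) < n + 1 := by positivity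
    have hp : (0 : ℝ) < (2 * Real.pi) ^ 6 := by positivity
    have h1 := hb ((n + 1 : ℝ) • z) (smul_ne_zero hn.ne' hz)
    rw [limitF_smul hη hθ hn, norm_smul, Real.norm_of_nonneg hn.le, mul_zpow] at h1
    have h2 := (Complex.abs_re_le_norm _).trans h1
    have e : ((2 * Real.pi) ^ 6 : ℂ) = (((2 * Real.pi) ^ 6 : ℝ) : ℂ) := by push_cast; ring
    rw [Complex.sub_re, e, ← Complex.ofReal_mul, Complex.ofReal_re] at h2
    set I := (∫ k, gaussSymbol η θ k * chr ((n + 1 : ℝ) • z) k).re with hI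
    have h3 : limitF η θ z - F n z = (n + 1 : ℝ) ^ 2 * (((2 * Real.pi) ^ 6)⁻¹ *
        ((2 * Real.pi) ^ 6 * ((n + 1 : ℝ) ^ (-2 : ℤ) * limitF η θ z) - I)) := by
      change limitF η θ z - (n + 1 : ℝ) ^ 2 * (((2 * Real.pi) ^ 6)⁻¹ * I) = _
      rw [show (n + 1 : ℝ) ^ (-2 : ℤ) = ((n + 1 : ℝ) ^ 2)⁻¹ by rw [zpow_neg]; norm_cast]
      field_simp
    rw [h3, abs_mul, abs_mul, abs_of_pos (inv_pos.2 hp), abs_of_pos (pow_pos hn 2)]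
    calc _ ≤ (n + 1 : ℝ) ^ 2 * (((2 * Real.pi) ^ 6)⁻¹ *
          (C * ((n + 1 : ℝ) ^ (-3 : ℤ) * ‖z‖ ^ (-3 : ℤ)))) := by gcongr
      _ = _ := by
        rw [show (n + 1 : ℝ) ^ (-3 : ℤ) = ((n + 1 : ℝ) ^ 3)⁻¹ by rw [zpow_neg]; norm_cast]
        field_simp
  have hloc : TendstoLocallyUniformlyOn F (limitF η θ) atTop {0}ᶜ := by
    rw [Metric.tendstoLocallyUniformlyOn_iff]
    intro ε hε z hz
    have hz0 : 0 < ‖z‖ := norm_pos_iff.2 hz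
    refine ⟨{y | ‖z‖ / 2 < ‖y‖}, mem_nhdsWithin_of_mem_nhds
      ((isOpen_lt continuous_const continuous_norm).mem_nhds (by simp only [Set.mem_ofPred_eq]; linarith)), ?_⟩
    have hlim := (tendsto_one_div_add_atTop_nhds_zero_nat (𝕜 := ℝ)).const_mul
      (((2 * Real.pi) ^ 6)⁻¹ * C * (‖z‖ / 2) ^ (-3 : ℤ))
    rw [mul_zero] at hlim
    filter_upwards [hlim.eventually_lt_const hε] with n hn y hy
    have hy' : ‖z‖ / 2 < ‖y‖ := hy
    have hy0 : y ≠ 0 := norm_pos_iff.1 (by linarith)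
    rw [Real.dist_eq]
    refine lt_of_le_of_lt ((hdiff n y hy0).trans ?_) hn
    have := zpow_le_zpow_of_nonpos_exp (n := -3) (by positivity) hy'.le (by norm_num)
    gcongr
  exact hloc.continuousOn (Frequently.of_forall fun n => (hFc n).continuousOn)

end

end

section

/-! ### Moment conditions and the main estimates -/

section
variable {η θ ν : PMF (Fin 6 → ℤ)}

lemma sixthMoment_of_tsum_ne_top {g : (Fin 6 → ℤ) → ℝ} {C : ℝ}
    (hg : ∑' x, ν x * ENNReal.ofReal (g x) ≠ ∞) (hC : 0 ≤ C)
    (h : ∀ x, ‖toE x‖ ^ 6 ≤ C * g x) : SixthMoment ν := by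
  refine ⟨aesm_of_countable _, ?_⟩
  rw [HasFiniteIntegral, lintegral_countable']
  refine lt_of_le_of_lt (b := ENNReal.ofReal C * ∑' x, ν x * ENNReal.ofReal (g x)) ?_
    (ENNReal.mul_lt_top ENNReal.ofReal_lt_top hg.lt_top)
  rw [← ENNReal.tsum_mul_left]
  refine ENNReal.tsum_le_tsum fun x => ?_
  rw [PMF.toMeasure_apply_singleton _ _ (measurableSet_singleton x), mul_left_comm, mul_comm,
    ← ENNReal.ofReal_mul hC, ← ofReal_norm, Real.norm_of_nonneg (by positivity)]
  exact mul_le_mul_right (ENNReal.ofReal_le_ofReal (h x)) _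

lemma sixthMoment_of_seventh
    (h : ∑' x : Fin 6 → ℤ, ν x * ENNReal.ofReal (‖toE x‖ ^ 7) ≠ ∞) : SixthMoment ν := by
  refine sixthMoment_of_tsum_ne_top h zero_le_one fun x => ?_
  rw [one_mul]
  rcases eq_or_ne x 0 with rfl | hx
  · simp [toE_zero]
  · exact pow_le_pow_right₀ (one_le_norm_toE hx) (by norm_num)

lemma sixthMoment_of_exp_sqrt
    (h : ∑' x : Fin 6 → ℤ, ν x * ENNReal.ofReal (Real.exp (Real.sqrt ‖toE x‖)) ≠ ∞) :
    SixthMoment ν := by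
  refine sixthMoment_of_tsum_ne_top (C := (Nat.factorial 12 : ℝ)) h (by positivity) fun x => ?_
  -- The twelfth term of the exponential series, since `√|x| ^ 12 = |x| ^ 6`.
  have h1 := Real.pow_div_factorial_le_exp _ (Real.sqrt_nonneg ‖toE x‖) 12
  rw [div_le_iff₀ (by positivity)] at h1
  have h2 : √‖toE x‖ ^ 12 = ‖toE x‖ ^ 6 := by
    rw [show 12 = 2 * 6 by norm_num, pow_mul, Real.sq_sqrt (norm_nonneg _)]
  rw [← h2, mul_comm]
  exact h1

lemma SixthMoment.tsum_one_add_norm_sq_ne_top (h : SixthMoment ν) :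
    ∑' x, ν x * ENNReal.ofReal ((1 + ‖toE x‖) ^ 2) ≠ ∞ := by
  have hi : Integrable (fun x => 1 + 2 * ‖toE x‖ ^ 1 + ‖toE x‖ ^ 2) ν.toMeasure :=
    ((integrable_const 1).add ((h.pow (by norm_num)).const_mul 2)).add (h.pow (by norm_num))
  have h1 := hi.lintegral_lt_top
  rw [lintegral_countable'] at h1
  refine ne_of_lt (lt_of_le_of_lt (le_of_eq (tsum_congr fun x => ?_)) h1)
  rw [PMF.toMeasure_apply_singleton _ _ (measurableSet_singleton x), mul_comm]
  congr 2
  ring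

/-- Both quantities have been compared with the same Gaussian Fourier integral; the triangle
inequality eliminates it. -/
lemma isBigO_tsum_green_sub_limitF (hη : StepLaw η) (hθ : StepLaw θ) (hs : ∀ x, θ (-x) = θ x) :
    (fun z : Fin 6 → ℤ => (∑' x, green η (z + x) * green θ x).toReal - limitF η θ (toE z))
      =O[comap (fun z : Fin 6 → ℤ => ‖toE z‖) atTop] fun z => ‖toE z‖ ^ (-3 : ℤ) := by
  obtain ⟨C, hC⟩ := tsum_green_mul_green_sub_le hη hθ hs
  obtain ⟨C', -, hC'⟩ := limitF_sub_le hη hθ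
  refine IsBigO.of_bound (((2 * Real.pi) ^ 6)⁻¹ * (C + C')) ?_
  have hev : ∀ᶠ z : Fin 6 → ℤ in comap (fun z : Fin 6 → ℤ => ‖toE z‖) atTop, 0 < ‖toE z‖ :=
    tendsto_comap.eventually (eventually_gt_atTop 0)
  filter_upwards [hev] with z hz
  have hz' : toE z ≠ 0 := norm_pos_iff.1 hz
  have hz0 : z ≠ 0 := by rintro rfl; exact hz' toE_zero
  have h1 := hC z hz0
  have h2 := hC' (toE z) hz'
  have hp : (0 : ℝ) < (2 * Real.pi) ^ 6 := by positivity
  have e : ((2 * Real.pi) ^ 6 : ℂ) = (((2 * Real.pi) ^ 6 : ℝ) : ℂ) := by push_cast; ring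
  have h3 := (norm_sub_le _ _).trans (add_le_add h1 h2)
  rw [sub_sub_sub_cancel_right, ← mul_sub, e, ← Complex.ofReal_sub, ← Complex.ofReal_mul,
    Complex.norm_real, norm_mul, Real.norm_of_nonneg hp.le] at h3
  rw [norm_zpow, norm_norm, mul_assoc, le_inv_mul_iff₀ hp, add_mul]
  exact h3

lemma exists_lintegral_greenSum_pow_le {μ : PMF ℕ} (hμ : ∑' k : ℕ, μ k * (k : ℝ≥0∞) = 1)
    (hη : StepLaw η) (hθ : StepLaw θ) {m : ℕ} (hm : 1 ≤ m)
    (hmom : ∑' k : ℕ, μ k * (k : ℝ≥0∞) ^ m ≠ ∞) :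
    ∃ C : ℝ, 0 < C ∧ ∀ z : Fin 6 → ℤ, z ≠ 0 →
      ∫⁻ ω, greenSum η z ω ^ m ∂(brwMeasure μ θ)
        ≤ ENNReal.ofReal (C * ‖toE z‖ ^ (-2 : ℤ)) := by
  obtain ⟨Bη, hBη, gη⟩ := hη.exists_green_le
  obtain ⟨Bθ, hBθ, gθ⟩ := hθ.exists_green_le
  set S := ∑' x, θ x * ENNReal.ofReal ((1 + ‖toE x‖) ^ 2) with hS
  set K := ENNReal.ofReal (2 * 625 * 768) with hK
  have hStop : S ≠ ∞ := hθ.moment.tsum_one_add_norm_sq_ne_top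
  -- One constant must serve for the bound on `g_η`, for one step of `θ` and for the convolution, so
  -- the three are added.
  obtain ⟨C, hC, hb⟩ := lintegral_greenSum_pow_le (μ := μ) (θ := θ) (η := η) (H := weight)
    (B := Bη + S + Bθ * K) hμ
    (ENNReal.add_ne_top.2 ⟨ENNReal.add_ne_top.2 ⟨hBη, hStop⟩,
      ENNReal.mul_ne_top hBθ ENNReal.ofReal_ne_top⟩)
    weight_le_one
    (fun z => (gη z).trans (mul_le_mul_left (le_self_add.trans le_self_add) _))
    (fun z => (stepOp_weight_le θ z).trans (mul_le_mul_left (le_add_self.trans le_self_add) _))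
    (fun z => by
      calc ∑' x, weight (z + x) ^ 2 * green θ x
          ≤ ∑' x, Bθ * (weight (z + x) ^ 2 * weight x ^ 2) :=
            ENNReal.tsum_le_tsum fun x => by
              rw [mul_left_comm]
              exact mul_le_mul_right (gθ x) _
        _ ≤ Bθ * (K * weight z) := by
            rw [ENNReal.tsum_mul_left]
            exact mul_le_mul_right (tsum_weight_sq_weight_sq_le z) _
        _ ≤ _ := by
            rw [← mul_assoc]
            exact mul_le_mul_left le_add_self _)
    hm hmom
  refine ⟨C.toReal + 1, by positivity, fun z hz => (hb z).trans ?_⟩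
  have hz1 := one_le_norm_toE hz
  have hz0 : 0 < ‖toE z‖ := by linarith
  rw [← ENNReal.ofReal_toReal hC, weight, ← ENNReal.ofReal_mul ENNReal.toReal_nonneg,
    ENNReal.toReal_ofReal ENNReal.toReal_nonneg]
  refine ENNReal.ofReal_le_ofReal (mul_le_mul (by linarith) ?_ (by positivity) (by positivity))
  rw [zpow_neg]
  refine inv_anti₀ (by positivity) ?_
  norm_cast
  gcongr
  linarith

end

end

end TreeWalk

end

/-! ### The theorem, from the convolution formula and the estimates above -/

theorem mainTheorem6
    (μ : PMF ℕ) (θ η : PMF (Fin 6 → ℤ))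
    (hμ_mean : ∑' k : ℕ, μ k * (k : ℝ≥0∞) = 1)
    (hμ_var : ∑' k : ℕ, μ k * (k : ℝ≥0∞) ^ 2 ≠ ∞)
    (hμ_nontrivial : μ ≠ PMF.pure 1)
    (hθ_symm : ∀ x : Fin 6 → ℤ, θ (-x) = θ x)
    (hθ_aper : TreeWalk.WalkAperiodic θ)
    (hθ_irr : TreeWalk.WalkIrreducible θ)
    (hθ_exp : ∑' x : Fin 6 → ℤ,
      θ x * ENNReal.ofReal (Real.exp (Real.sqrt ‖TreeWalk.toE x‖)) ≠ ∞)
    (hη_aper : TreeWalk.WalkAperiodic η)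
    (hη_irr : TreeWalk.WalkIrreducible η)
    (hη_mean : ∀ i : Fin 6, ∫ x : Fin 6 → ℤ, (x i : ℝ) ∂η.toMeasure = 0)
    (hη_mom : ∑' x : Fin 6 → ℤ, η x * ENNReal.ofReal (‖TreeWalk.toE x‖ ^ 7) ≠ ∞) :
    -- part 1: the first moment, with the properties of the limit function
    ((∀ z : Fin 6 → ℤ, ∫⁻ ω, TreeWalk.greenSum η z ω ∂(TreeWalk.brwMeasure μ θ) ≠ ∞) ∧
      (fun z : Fin 6 → ℤ =>
          (∫⁻ ω, TreeWalk.greenSum η z ω ∂(TreeWalk.brwMeasure μ θ)).toReal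
            - TreeWalk.limitF η θ (TreeWalk.toE z))
        =O[comap (fun z : Fin 6 → ℤ => ‖TreeWalk.toE z‖) atTop]
          (fun z : Fin 6 → ℤ => ‖TreeWalk.toE z‖ ^ (-3 : ℤ)) ∧
      (∀ z : EuclideanSpace ℝ (Fin 6), z ≠ 0 →
        Integrable (TreeWalk.kernelF η θ z) volume) ∧
      ContinuousOn (TreeWalk.limitF η θ) {0}ᶜ ∧
      (∀ (c : ℝ) (z : EuclideanSpace ℝ (Fin 6)), 0 < c → z ≠ 0 →
        TreeWalk.limitF η θ (c • z) = c ^ (-2 : ℤ) * TreeWalk.limitF η θ z)) ∧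
    -- part 2: higher moments
    (∀ m : ℕ, 2 ≤ m → ∑' k : ℕ, μ k * (k : ℝ≥0∞) ^ m ≠ ∞ →
      ∃ C : ℝ, 0 < C ∧ ∀ z : Fin 6 → ℤ, z ≠ 0 →
        ∫⁻ ω, TreeWalk.greenSum η z ω ^ m ∂(TreeWalk.brwMeasure μ θ)
          ≤ ENNReal.ofReal (C * ‖TreeWalk.toE z‖ ^ (-2 : ℤ))) := by
  have hη : TreeWalk.StepLaw η := ⟨TreeWalk.sixthMoment_of_seventh hη_mom, hη_mean, hη_irr⟩
  have hθ : TreeWalk.StepLaw θ :=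
    ⟨TreeWalk.sixthMoment_of_exp_sqrt hθ_exp, TreeWalk.meanZero_of_symm hθ_symm, hθ_irr⟩
  simp only [TreeWalk.lintegral_greenSum hμ_mean]
  exact ⟨⟨fun z => (TreeWalk.tsum_green_mul_green_fourier hη hθ hθ_symm z).1,
    TreeWalk.isBigO_tsum_green_sub_limitF hη hθ hθ_symm,
    fun z hz => TreeWalk.integrable_kernelF hη hθ hz,
    TreeWalk.continuousOn_limitF hη hθ,
    fun c z hc _ => TreeWalk.limitF_smul hη hθ hc z⟩,
    fun m hm hmom => TreeWalk.exists_lintegral_greenSum_pow_le hμ_mean hη hθ (by omega) hmom⟩
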